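/- An instance $G$ of the two-sided facility location game consists of a directed host graph on a vertex set $V=\{v_1,\dots,v_n\}$, $n\ge 1$, with edge set $E$ and vertex weights $w:V\to\mathbb{Q}_{\ge 0}$, together with $k$ facility agents $f_1,\dots,f_k$. Each vertex is a client. A facility placement profile is $\mathbf{s}=(s_1,\dots,s_k)\in V^k$. The shopping range of $v_i$ is $N(v_i)=\{v_i\}\cup\{z\mid (v_i,z)\in E\}$, and $N_{\mathbf{s}}(v_i)=\{f_j\mid s_j\in N(v_i)\}$. A client weight distribution $\sigma$ assigns to every profile $\mathbf{s}$, client $v_i$ and facility $f_j$ a real number $\sigma(\mathbf{s},v_i)_j\ge 0$. It is feasible if $\sigma(\mathbf{s},v_i)_j=0$ for $f_j\notin N_{\mathbf{s}}(v_i)$, and $\sum_{f_j\in N_{\mathbf{s}}(v_i)}\sigma(\mathbf{s},v_i)_j=w(v_i)$ whenever $N_{\mathbf{s}}(v_i)\ne\emptyset$. The load of $f_j$ is $\ell_j(\mathbf{s},\sigma)=\sum_i\sigma(\mathbf{s},v_i)_j$. In the Min-2-FLG the cost of client $v_i$ is $L_i(\mathbf{s},\sigma)=\sum_j\sigma(\mathbf{s},v_i)_j\,\ell_j(\mathbf{s},\sigma)$,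 and $\sigma$ is a client equilibrium if it is feasible and, for every profile $\mathbf{s}$, no client can lower her cost at $\mathbf{s}$ by switching to another feasible distribution of her own weight. For $\alpha\ge 1$, a state $(\mathbf{s},\sigma)$ is an $\alpha$-approximate subgame perfect equilibrium (SPE) of the Min-2-FLG if $\sigma$ is a client equilibrium and $\ell_j((s_j',s_{-j}),\sigma)\le\alpha\,\ell_j(\mathbf{s},\sigma)$ for every facility $f_j$ and every $s_j'\in V$. **Theorem.** A $(3+2\varepsilon)$-approximate SPE of the Min-2-FLG can be computed in polynomial time, in the following sense. There are a (multi-stack) Turing machine and a polynomial $p$ such that, for every instance $G$ and every rational $\varepsilon>0$, the machine, started on an encoding of $(G,\varepsilon)$ of length $L$, halts after at most $p(L+\lceil 1/\varepsilon\rceil)$ steps and outputs a facility placement profile $\mathbf{s}$ with the following property: a client equilibrium exists, and for every client equilibrium $\sigma$ the state $(\mathbf{s},\sigma)$ is a $(3+2\varepsilon)$-approximate SPE of the Min-2-FLG. Here numbers are encoded in binary (rationals as reduced fractions), the graph by its adjacency matrix, and the $k$ facility agents are listed one by one. In particular, for every fixed rational $\varepsilon>0$ the running time is polynomial in the size of the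 instance. -/

import Mathlib

open Computability Turing

/-- An instance of the two-sided facility location game: a directed host graph on the vertices
`Fin n` with edge set `E` and nonnegative rational vertex weights `w`, and `k` facility agents.
Each vertex is a client and at the same time a possible facility location. -/
structure FacilityGame where
  n : ℕ
  k : ℕ
  E : Finset (Fin n × Fin n)
  w : Fin n → ℚ≥0

namespace FacilityGame

variable (G : FacilityGame)

/-- A facility placement profile: one location for each facility agent. -/
abbrev Profile : Type := Fin G.k → Fin G.n

/-- Client weight distributions for one fixed profile: `x i j` is the weight that client `i`
distributes to facility `j`. -/
abbrev Distribution : Type := Fin G.n → Fin G.k → ℝ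

/-- The shopping range `N(v)` of client `v`: its closed out-neighborhood. -/
def shoppingRange (v : Fin G.n) : Finset (Fin G.n) :=
  insert v (Finset.univ.filter fun z => (v, z) ∈ G.E)

/-- `N_s(v)`: the facilities in the shopping range of client `v` under the profile `s`. -/
def facilitiesInRange (s : G.Profile) (v : Fin G.n) : Finset (Fin G.k) :=
  Finset.univ.filter fun j => s j ∈ G.shoppingRange v

/-- `y` is a feasible weight distribution of client `v` under `s`: it is nonnegative, gives nothing
to facilities outside the shopping range, and distributes the whole weight of `v` if there is a
facility in the shopping range. -/
def IsFeasible (s : G.Profile) (v : Fin G.n) (y : Fin G.k → ℝ) : Prop :=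
  (∀ j, 0 ≤ y j) ∧ (∀ j, j ∉ G.facilitiesInRange s v → y j = 0) ∧
    ((G.facilitiesInRange s v).Nonempty → ∑ j ∈ G.facilitiesInRange s v, y j = (G.w v : ℝ))

variable {G}

/-- The load of facility `j`. -/
def load (x : G.Distribution) (j : Fin G.k) : ℝ := ∑ i, x i j

/-- The cost (total waiting time) of client `i`. -/
def clientCost (x : G.Distribution) (i : Fin G.n) : ℝ := ∑ j, x i j * load x j

variable (G)

/-- `σ` is a client equilibrium of the Min-2-FLG: for every placement profile `s` it is feasible,
and no client can lower her total waiting time by changing only her own weight distribution to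
another feasible one. -/
def IsClientEquilibrium (σ : G.Profile → G.Distribution) : Prop :=
  ∀ (s : G.Profile) (i : Fin G.n), G.IsFeasible s i (σ s i) ∧
    ∀ y : Fin G.k → ℝ, G.IsFeasible s i y →
      clientCost (σ s) i ≤ clientCost (Function.update (σ s) i y) i

/-- The state `(s, σ)` is an `α`-approximate subgame perfect equilibrium of the Min-2-FLG:
clients are in equilibrium for every profile, and no facility can increase her load by more than
the factor `α` by relocating. -/
def IsApproxSPE (α : ℝ) (s : G.Profile) (σ : G.Profile → G.Distribution) : Prop :=
  (∀ (j : Fin G.k) (v : Fin G.n),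
    load (σ (Function.update s j v)) j ≤ α * load (σ s) j) ∧
  G.IsClientEquilibrium σ

/-- The binary code of a natural number, closed by a separator. -/
def natCode (m : ℕ) : List Γ' := encodingNatΓ'.encode m ++ [Γ'.comma]

/-- The code of a game: `n` in binary, the `k` facility agents listed as `k` marks, the adjacency
matrix row by row, and the weights as reduced fractions in binary. -/
def code : List Γ' :=
  natCode G.n ++ (List.replicate G.k (Γ'.bit true) ++ [Γ'.comma]) ++
  ((List.finRange G.n).flatMap fun i =>
    (List.finRange G.n).map fun j => Γ'.bit (decide ((i, j) ∈ G.E))) ++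
  ((List.finRange G.n).flatMap fun i => natCode (G.w i).num ++ natCode (G.w i).den)

/-- The input word: the code of the game followed by `ε` as a reduced fraction in binary. -/
def inputCode (ε : ℚ≥0) : List Γ' := G.code ++ (natCode ε.num ++ natCode ε.den)

/-- The code of a placement profile: the list of the locations, in binary. -/
def profileCode (s : G.Profile) : List Γ' :=
  (List.finRange G.k).flatMap fun j => natCode (s j)

end FacilityGame

/-! Client equilibria are hard to follow when a facility moves, so the search works with the uniform
load instead: every client splits her weight equally among the facilities in range. In a client
equilibrium the marginal cost, load plus own contribution, of a facility that a client uses is at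
most that of any other facility in her range (`IsClientEquilibrium.marginal_le`). Hence each client
gives a least loaded facility in her range at least an equal share, and a most loaded one at most an
equal share. So the uniform load is at most the true load at a least loaded facility and at least
the true load at a most loaded one (`uniformLoad_le_load`, `load_le_uniformLoad`).

Let no facility be able to raise its uniform load by more than the factor `α` at `s`. Let `j`
deviate, let `q` be most loaded afterwards, and let `m` be least loaded at `s`. The new load of `j`
is at most the uniform load of `q`. Compare this with moving `m`, instead of `j`, to the location of
`q`: each client who reaches this location sees at most two facilities more, and she saw at least
one, so at most a factor `3` is lost (`uniformLoad_update_le`). Uniform stability applied to `m` and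
the minimality of `m` then give the factor `3α`, and `α = 1 + 2ε/3` yields `3 + 2ε`. The same
profile works for every client equilibrium. One exists because the sum of squared loads and squared
contributions is a potential of the client game, continuous on a compact set.

Uniform loads form a congestion game with Rosenthal potential `∑ w_i H(c_i)`, where `c_i` counts the
facilities in range of client `i`. Best-response moves that gain more than the factor `1 + 2ε/3`
multiply the potential, shifted by a small positive unit, by at least `1 + 1/R` with `R` polynomial
in `k` and `1/ε` (`potential_move`). The potential is at most exponential in the input size, so
polynomially many moves suffice (`exists_iterate_step_eq_nil`).

For the machine model, structured programs on four stacks are compiled to a `FinTM2`, and all data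
are binary trees in prefix code. The predicate `PolyTime` is closed under composition, pairing, case
distinction and folds with polynomially bounded intermediate values. This covers one step of the
search. A while loop whose states stay polynomially small (`PolyTime.exists_while`) runs the whole
search. -/

/-! ### A structured programming language for four stacks -/

/-- The contents of the four stacks. -/
abbrev Store : Type := Fin 4 → List Γ'

/-- Structured programs over four stacks. -/
inductive StackProg : Type
  | push (k : Fin 4) (x : Γ')
  | move (k l : Fin 4)
  | pop (k : Fin 4)
  | seq (p q : StackProg)
  | ite (k : Fin 4) (f : Option Γ' → Bool) (p q : StackProg)
  | loop (k : Fin 4) (f : Option Γ' → Bool) (p : StackProg)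

namespace StackProg

/-- `Run p S S' t`: the program `p` transforms the store `S` into `S'` in `t` steps. -/
inductive Run : StackProg → Store → Store → ℕ → Prop
  | push (k x S) : Run (push k x) S (Function.update S k (x :: S k)) 1
  | move (k l S x r) (h : S k = x :: r) : Run (move k l) S
      (Function.update (Function.update S k r) l (x :: Function.update S k r l)) 1
  | pop (k S) : Run (pop k) S (Function.update S k (S k).tail) 1
  | seq {p q S S₁ S₂ t t'} : Run p S S₁ t → Run q S₁ S₂ t' → Run (seq p q) S S₂ (t + t')
  | ite_true {k f p q S S' t} : f (S k).head? = true → Run p S S' t →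
      Run (ite k f p q) S S' (t + 1)
  | ite_false {k f p q S S' t} : f (S k).head? = false → Run q S S' t →
      Run (ite k f p q) S S' (t + 1)
  | loop_done {k f p S} : f (S k).head? = false → Run (loop k f p) S S 1
  | loop_step {k f p S S₁ S₂ t t'} : f (S k).head? = true → Run p S S₁ t →
      Run (loop k f p) S₁ S₂ t' → Run (loop k f p) S S₂ (t + t' + 1)

/-- The labels of the machine that executes a program. -/
def Label : StackProg → Type
  | push _ _ => Unit
  | move _ _ => Unit
  | pop _ => Unit
  | seq p q => p.Label ⊕ q.Label
  | ite _ _ p q => Option (p.Label ⊕ q.Label)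
  | loop _ _ p => Option p.Label

/-- Programs have finitely many labels. -/
@[reducible]
def labelFintype : (p : StackProg) → Fintype p.Label
  | push _ _ => inferInstanceAs (Fintype Unit)
  | move _ _ => inferInstanceAs (Fintype Unit)
  | pop _ => inferInstanceAs (Fintype Unit)
  | seq p q => @instFintypeSum _ _ p.labelFintype q.labelFintype
  | ite _ _ p q => @instFintypeOption _ (@instFintypeSum _ _ p.labelFintype q.labelFintype)
  | loop _ _ p => @instFintypeOption _ p.labelFintype

/-- The label at which the execution of a program starts. -/
def entry : (p : StackProg) → p.Label
  | push _ _ => ()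
  | move _ _ => ()
  | pop _ => ()
  | seq p _ => Sum.inl p.entry
  | ite _ _ _ _ => none
  | loop _ _ _ => none

/-- The statement at each label of a program, where the labels are embedded into `Λ` and the
execution continues at `exit` when the program has finished. -/
def stmt {Λ : Type} : (p : StackProg) → (p.Label → Λ) → Λ → p.Label →
    TM2.Stmt (fun _ : Fin 4 => Γ') Λ (Option Γ')
  | push k x, _, exit, _ => .push k (fun _ => x) (.goto fun _ => exit)
  | move k l, _, exit, _ => .pop k (fun _ o => o) (.branch Option.isSome
      (.push l (fun v => v.getD .blank) (.goto fun _ => exit)) (.goto fun _ => exit))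
  | pop k, _, exit, _ => .pop k (fun _ o => o) (.goto fun _ => exit)
  | seq p q, e, exit, l => match l with
    | Sum.inl l => p.stmt (fun l => e (Sum.inl l)) (e (Sum.inr q.entry)) l
    | Sum.inr l => q.stmt (fun l => e (Sum.inr l)) exit l
  | ite k f p q, e, exit, l => match l with
    | none => .peek k (fun _ o => o) (.branch f (.goto fun _ => e (some (Sum.inl p.entry)))
        (.goto fun _ => e (some (Sum.inr q.entry))))
    | some (Sum.inl l) => p.stmt (fun l => e (some (Sum.inl l))) exit l
    | some (Sum.inr l) => q.stmt (fun l => e (some (Sum.inr l))) exit l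
  | loop k f p, e, exit, l => match l with
    | none => .peek k (fun _ o => o) (.branch f (.goto fun _ => e (some p.entry))
        (.goto fun _ => exit))
    | some l => p.stmt (fun l => e (some l)) (e none) l

/-- Compilation preserves the step count exactly: primitives and tests take one machine step each,
and sequencing is free because the exit of the first part is the entry of the second. The embedding
`e` and the label `exit` are arbitrary so that the induction applies to subprograms of a larger
machine. The register may end with any value, since it is overwritten before each use. -/
theorem Run.iterate_step {Λ : Type} (M : Λ → TM2.Stmt (fun _ : Fin 4 => Γ') Λ (Option Γ'))
    {p : StackProg} {S S' : Store} {t : ℕ} (h : Run p S S' t) :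
    ∀ (e : p.Label → Λ) (exit : Λ), (∀ l, M (e l) = p.stmt e exit l) → ∀ v, ∃ v',
      (flip bind (TM2.step M))^[t] (some ⟨some (e p.entry), v, S⟩) =
        some ⟨some exit, v', S'⟩ := by
  induction h with
  | push k x S =>
    intro e exit hM v
    exact ⟨v, by simp [flip, hM, stmt]⟩
  | move k l S x r h =>
    intro e exit hM v
    exact ⟨some x, by simp [flip, hM, stmt, h]⟩
  | pop k S =>
    intro e exit hM v
    exact ⟨(S k).head?, by simp [flip, hM, stmt]⟩
  | @seq p q S S₁ S₂ t t' _ _ ih₁ ih₂ =>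
    intro e exit hM v
    obtain ⟨v₁, h₁⟩ := ih₁ (fun l => e (Sum.inl l)) (e (Sum.inr q.entry))
      (fun l => hM (Sum.inl l)) v
    obtain ⟨v₂, h₂⟩ := ih₂ (fun l => e (Sum.inr l)) exit (fun l => hM (Sum.inr l)) v₁
    refine ⟨v₂, ?_⟩
    rw [add_comm, Function.iterate_add_apply]
    exact (congrArg _ h₁).trans h₂
  | @ite_true k f p q S S' t hf _ ih =>
    intro e exit hM v
    obtain ⟨v', h'⟩ := ih (fun l => e (some (Sum.inl l))) exit
      (fun l => hM (some (Sum.inl l))) (S k).head?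
    refine ⟨v', ?_⟩
    rw [Function.iterate_succ_apply, ← h']
    congr 1
    have := hM none
    simp only [stmt] at this
    simp [flip, entry, this, hf]
  | @ite_false k f p q S S' t hf _ ih =>
    intro e exit hM v
    obtain ⟨v', h'⟩ := ih (fun l => e (some (Sum.inr l))) exit
      (fun l => hM (some (Sum.inr l))) (S k).head?
    refine ⟨v', ?_⟩
    rw [Function.iterate_succ_apply, ← h']
    congr 1
    have := hM none
    simp only [stmt] at this
    simp [flip, entry, this, hf]
  | @loop_done k f p S hf =>
    intro e exit hM v
    have := hM none
    simp only [stmt] at this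
    exact ⟨(S k).head?, by simp [flip, entry, this, hf]⟩
  | @loop_step k f p S S₁ S₂ t t' hf _ _ ih₁ ih₂ =>
    intro e exit hM v
    obtain ⟨v₁, h₁⟩ := ih₁ (fun l => e (some l)) (e none) (fun l => hM (some l)) (S k).head?
    obtain ⟨v₂, h₂⟩ := ih₂ e exit hM v₁
    refine ⟨v₂, ?_⟩
    rw [Function.iterate_succ_apply, add_comm, Function.iterate_add_apply]
    refine (congrArg _ ?_).trans h₂
    refine Eq.trans (congrArg _ ?_) h₁
    have := hM none
    simp only [stmt] at this
    simp [flip, entry, this, hf]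

/-! ### The Turing machine of a program -/

/-- The machine that executes a program, with input on stack `1` and output on stack `2`. -/
def machine (p : StackProg) : FinTM2 where
  K := Fin 4
  k₀ := 1
  k₁ := 2
  Γ _ := Γ'
  Λ := Option p.Label
  main := some p.entry
  ΛFin := @instFintypeOption _ p.labelFintype
  σ := Option Γ'
  initialState := none
  Γk₀Fin := inferInstanceAs (Fintype Γ')
  m l := match l with
    | none => .load (fun _ => none) .halt
    | some l => p.stmt some none l

/-- The machine of a program, with the identity as input and output alphabet equivalence. -/
def machineAux (p : StackProg) : TM2ComputableAux Γ' Γ' where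
  tm := p.machine
  inputAlphabet := Equiv.refl Γ'
  outputAlphabet := Equiv.refl Γ'

theorem Run.outputsInTime {p : StackProg} {w w' : List Γ'} {t m : ℕ}
    (h : Run p ![[], w, [], []] ![[], [], w', []] t) (ht : t + 1 ≤ m) :
    Nonempty (TM2OutputsInTime p.machineAux.tm (w.map p.machineAux.inputAlphabet.symm)
      (some (w'.map p.machineAux.outputAlphabet.symm)) m) := by
  obtain ⟨v', h'⟩ := h.iterate_step p.machine.m some none (fun _ => rfl) none
  -- The extra step executes the final label `none`, which resets the register to its initial value,
  -- as `haltList` demands, and halts.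
  refine ⟨⟨⟨t + 1, ?_⟩, ht⟩⟩
  have hi : initList p.machineAux.tm (w.map p.machineAux.inputAlphabet.symm) =
      (⟨some (some p.entry), none, ![[], w, [], []]⟩ :
        TM2.Cfg (fun _ : Fin 4 => Γ') (Option p.Label) (Option Γ')) := by
    unfold initList
    congr 1
    funext k
    change Fin 4 at k
    have hw : w.map p.machineAux.inputAlphabet.symm = w := List.map_id w
    rw [hw]
    fin_cases k <;> rfl
  have ho : haltList p.machineAux.tm (w'.map p.machineAux.outputAlphabet.symm) =
      (⟨none, none, ![[], [], w', []]⟩ :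
        TM2.Cfg (fun _ : Fin 4 => Γ') (Option p.Label) (Option Γ')) := by
    unfold haltList
    congr 1
    funext k
    change Fin 4 at k
    have hw : w'.map p.machineAux.outputAlphabet.symm = w' := List.map_id w'
    rw [hw]
    fin_cases k <;> rfl
  rw [Option.map_some, ho, hi, Function.iterate_succ_apply']
  exact (congrArg _ h').trans rfl

end StackProg

/-! ### Binary trees as universal data -/

/-- Binary trees, the data format of the programs below. -/
inductive DataTree : Type
  | leaf
  | node (l r : DataTree)

namespace DataTree

/-- The number of nodes and leaves. -/
def size : DataTree → ℕ
  | leaf => 1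
  | node l r => l.size + r.size + 1

/-- Prefix code of a tree. -/
def code : DataTree → List Γ'
  | leaf => [Γ'.bit false]
  | node l r => Γ'.bit true :: (l.code ++ r.code)

@[simp] theorem length_code (x : DataTree) : x.code.length = x.size := by
  induction x with
  | leaf => rfl
  | node l r hl hr => simp [code, size, hl, hr]

/-- The left subtree. -/
def left : DataTree → DataTree
  | leaf => leaf
  | node l _ => l

/-- The right subtree. -/
def right : DataTree → DataTree
  | leaf => leaf
  | node _ r => r

end DataTree

/-! ### Programs that move trees -/

section UpdateStore
variable (a b c d x : List Γ')

@[simp] theorem store_update_zero :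
    Function.update (![a, b, c, d] : Store) 0 x = ![x, b, c, d] := by
  funext i; fin_cases i <;> rfl

@[simp] theorem store_update_one :
    Function.update (![a, b, c, d] : Store) 1 x = ![a, x, c, d] := by
  funext i; fin_cases i <;> rfl

@[simp] theorem store_update_two :
    Function.update (![a, b, c, d] : Store) 2 x = ![a, b, x, d] := by
  funext i; fin_cases i <;> rfl

@[simp] theorem store_update_three :
    Function.update (![a, b, c, d] : Store) 3 x = ![a, b, c, x] := by
  funext i; fin_cases i <;> rfl

end UpdateStore

namespace StackProg

/-- `RunLE p S S' T`: the program `p` transforms `S` into `S'` in at most `T` steps. -/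
def RunLE (p : StackProg) (S S' : Store) (T : ℕ) : Prop := ∃ t ≤ T, Run p S S' t

theorem RunLE.mono {p S S' T T'} (h : RunLE p S S' T) (hT : T ≤ T') : RunLE p S S' T' := by
  obtain ⟨t, ht, h⟩ := h
  exact ⟨t, ht.trans hT, h⟩

theorem RunLE.seq {p q S S₁ S₂ T T'} (h : RunLE p S S₁ T) (h' : RunLE q S₁ S₂ T') :
    RunLE (seq p q) S S₂ (T + T') := by
  obtain ⟨t, ht, h⟩ := h
  obtain ⟨t', ht', h'⟩ := h'
  exact ⟨t + t', by omega, h.seq h'⟩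

theorem RunLE.push {k : Fin 4} {x : Γ'} {S S' : Store} (h : S' = Function.update S k (x :: S k)) :
    RunLE (push k x) S S' 1 := by
  subst h; exact ⟨1, le_rfl, Run.push _ _ _⟩

theorem RunLE.pop {k : Fin 4} {S S' : Store} (h : S' = Function.update S k (S k).tail) :
    RunLE (pop k) S S' 1 := by
  subst h; exact ⟨1, le_rfl, Run.pop _ _⟩

theorem RunLE.ite_true {k f p q S S' T} (hf : f (S k).head? = true) (h : RunLE p S S' T) :
    RunLE (ite k f p q) S S' (T + 1) := by
  obtain ⟨t, ht, h⟩ := h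
  exact ⟨t + 1, by omega, h.ite_true hf⟩

theorem RunLE.ite_false {k f p q S S' T} (hf : f (S k).head? = false) (h : RunLE q S S' T) :
    RunLE (ite k f p q) S S' (T + 1) := by
  obtain ⟨t, ht, h⟩ := h
  exact ⟨t + 1, by omega, h.ite_false hf⟩

theorem RunLE.loop_done {k f p S} (hf : f (S k).head? = false) :
    RunLE (loop k f p) S S 1 := ⟨1, le_rfl, Run.loop_done hf⟩

theorem RunLE.loop_step {k f p S S₁ S₂ T T'} (hf : f (S k).head? = true) (h : RunLE p S S₁ T)
    (h' : RunLE (loop k f p) S₁ S₂ T') : RunLE (loop k f p) S S₂ (T + T' + 1) := by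
  obtain ⟨t, ht, h⟩ := h
  obtain ⟨t', ht', h'⟩ := h'
  exact ⟨t + t' + 1, by omega, h.loop_step hf h'⟩

/-- A step pushes at most one symbol on each stack. Running time therefore bounds output size, which
`PolyTime.size_le` exploits. -/
theorem Run.length_le {p S S' t} (h : Run p S S' t) (i : Fin 4) :
    (S' i).length ≤ (S i).length + t := by
  induction h with
  | push k x S => by_cases hk : i = k
                  · subst hk; simp
                  · simp [Function.update_of_ne hk]
  | move k l S x r h =>
    by_cases hl : i = l
    · subst hl
      by_cases hk : i = k
      · subst hk; simp [h]
      · simp [Function.update_of_ne hk]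
    · rw [Function.update_of_ne hl]
      by_cases hk : i = k
      · subst hk; simp [h]; omega
      · simp [Function.update_of_ne hk]
  | pop k S => by_cases hk : i = k
               · subst hk; simp; omega
               · simp [Function.update_of_ne hk]
  | seq _ _ h₁ h₂ => omega
  | ite_true _ _ h => omega
  | ite_false _ _ h => omega
  | loop_done _ => omega
  | loop_step _ _ _ h₁ h₂ => omega

/-- The test whether the top symbol marks a node. -/
def isNode (o : Option Γ') : Bool := o = some (Γ'.bit true)

/-- The program that does nothing. -/
def skip : StackProg := loop 0 (fun _ => false) (pop 0)

theorem runLE_skip (S : Store) : RunLE skip S S 1 := RunLE.loop_done rfl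

/-- Applies `act`, which consumes the top symbol of stack `0`, to all symbols of a tree code; stack
`3` counts the subtrees still to be read. -/
def treeLoop (act : StackProg) : StackProg :=
  seq (push 3 .comma)
    (loop 3 Option.isSome (seq (ite 0 isNode (push 3 .comma) (pop 3)) act))

/-- The prefix code is self-delimiting: a node symbol replaces one pending subtree by two, and a
leaf symbol removes one, so stack `3` is exhausted exactly at the end of the tree. The rest of the
run is an arbitrary continuation, which lets the induction chain the two subtrees of a node. -/
theorem runLE_treeLoop_aux {act : StackProg}
    {g : Γ' → List Γ' × List Γ' → List Γ' × List Γ'}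
    (hact : ∀ x A (o : List Γ' × List Γ') c,
      RunLE act ![x :: A, o.1, o.2, c] ![A, (g x o).1, (g x o).2, c] 1)
    (x : DataTree) : ∀ (r : List Γ') (o : List Γ' × List Γ') (c : List Γ') (S : Store) (T : ℕ),
    RunLE (loop 3 Option.isSome (seq (ite 0 isNode (push 3 .comma) (pop 3)) act))
      ![r, (x.code.foldl (fun o y => g y o) o).1, (x.code.foldl (fun o y => g y o) o).2, c] S T →
    RunLE (loop 3 Option.isSome (seq (ite 0 isNode (push 3 .comma) (pop 3)) act))
      ![x.code ++ r, o.1, o.2, .comma :: c] S (T + 4 * x.size) := by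
  induction x with
  | leaf =>
    intro r o c S T h
    refine (RunLE.loop_step (T := 3) (by simp) (RunLE.seq (T := 2) (T' := 1)
      (RunLE.ite_false (by simp [DataTree.code, isNode]) (RunLE.pop rfl)) ?_) h).mono
      (by simp [DataTree.size]; omega)
    simpa [DataTree.code] using hact (Γ'.bit false) r o c
  | node x y hx hy =>
    intro r o c S T h
    simp only [DataTree.code, List.cons_append, List.append_assoc]
    refine (RunLE.loop_step (T := 3) (T' := (T + 4 * y.size) + 4 * x.size)
      (S₁ := ![x.code ++ (y.code ++ r), (g (.bit true) o).1, (g (.bit true) o).2,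
        .comma :: .comma :: c]) (by simp)
      (RunLE.seq (T := 2) (T' := 1)
      (RunLE.ite_true (by simp [isNode]) (RunLE.push rfl)) ?_) ?_).mono
      (by simp only [DataTree.size]; omega)
    · simpa using hact (Γ'.bit true) (x.code ++ (y.code ++ r)) o (.comma :: .comma :: c)
    · apply hx
      apply hy
      simpa [DataTree.code] using h

theorem runLE_treeLoop {act : StackProg}
    {g : Γ' → List Γ' × List Γ' → List Γ' × List Γ'}
    (hact : ∀ x A (o : List Γ' × List Γ') c,
      RunLE act ![x :: A, o.1, o.2, c] ![A, (g x o).1, (g x o).2, c] 1)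
    (x : DataTree) (r : List Γ') (o : List Γ' × List Γ') :
    RunLE (treeLoop act) ![x.code ++ r, o.1, o.2, []]
      ![r, (x.code.foldl (fun o y => g y o) o).1, (x.code.foldl (fun o y => g y o) o).2, []]
      (4 * x.size + 2) := by
  refine (RunLE.seq (T := 1) (RunLE.push rfl) (T' := 1 + 4 * x.size) ?_).mono (by omega)
  simp only [store_update_three]
  exact runLE_treeLoop_aux hact x r o [] _ 1 (RunLE.loop_done (by simp))

/-- Removes the top tree of stack `0`. -/
def dropTree : StackProg := treeLoop (pop 0)

theorem runLE_dropTree (x : DataTree) (r b d : List Γ') :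
    RunLE dropTree ![x.code ++ r, b, d, []] ![r, b, d, []] (4 * x.size + 2) := by
  have h := runLE_treeLoop (act := pop 0) (g := fun _ o => o)
    (fun x A o c => RunLE.pop (by simp)) x r (b, d)
  have h' : ∀ (l : List Γ') (o : List Γ' × List Γ'), l.foldl (fun o _ => o) o = o := by
    intro l; induction l <;> simp_all
  unfold dropTree
  simpa [h'] using h

/-- Moves the top tree of stack `0` to stack `1`, reversing its code. -/
def moveTreeOne : StackProg := treeLoop (move 0 1)

theorem runLE_moveTreeOne (x : DataTree) (r b d : List Γ') :
    RunLE moveTreeOne ![x.code ++ r, b, d, []] ![r, x.code.reverse ++ b, d, []]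
      (4 * x.size + 2) := by
  have h := runLE_treeLoop (act := move 0 1) (g := fun x o => (x :: o.1, o.2))
    (fun x A o c => ⟨1, le_rfl, by
      simpa using Run.move 0 1 ![x :: A, o.1, o.2, c] x A rfl⟩) x r (b, d)
  have h' : ∀ (l : List Γ') (o : List Γ' × List Γ'),
      l.foldl (fun o x => (x :: o.1, o.2)) o = (l.reverse ++ o.1, o.2) := by
    intro l; induction l <;> simp_all
  unfold moveTreeOne
  simpa [h'] using h

/-- Moves the top tree of stack `0` to stack `2`, reversing its code. -/
def moveTreeTwo : StackProg := treeLoop (move 0 2)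

theorem runLE_moveTreeTwo (x : DataTree) (r b d : List Γ') :
    RunLE moveTreeTwo ![x.code ++ r, b, d, []] ![r, b, x.code.reverse ++ d, []]
      (4 * x.size + 2) := by
  have h := runLE_treeLoop (act := move 0 2) (g := fun x o => (o.1, x :: o.2))
    (fun x A o c => ⟨1, le_rfl, by
      simpa using Run.move 0 2 ![x :: A, o.1, o.2, c] x A rfl⟩) x r (b, d)
  have h' : ∀ (l : List Γ') (o : List Γ' × List Γ'),
      l.foldl (fun o x => (o.1, x :: o.2)) o = (o.1, l.reverse ++ o.2) := by
    intro l; induction l <;> simp_all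
  unfold moveTreeTwo
  simpa [h'] using h

/-- Moves the whole stack `k` to stack `l`. -/
def moveAll (k l : Fin 4) : StackProg := loop k Option.isSome (move k l)

theorem runLE_moveAll {k l : Fin 4} (hkl : k ≠ l) {S S' : Store} {w : List Γ'} (hw : S k = w)
    (hS' : S' = Function.update (Function.update S k []) l (w.reverse ++ S l)) :
    RunLE (moveAll k l) S S' (2 * w.length + 1) := by
  induction w generalizing S with
  | nil =>
    have : S' = S := by
      rw [hS']
      funext i
      by_cases hl : i = l
      · subst hl; simp
      · rw [Function.update_of_ne hl]
        by_cases hk : i = k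
        · subst hk; simp [hw]
        · rw [Function.update_of_ne hk]
    rw [this]
    exact RunLE.loop_done (by simp [hw])
  | cons x w ih =>
    refine (RunLE.loop_step (by simp [hw]) ⟨1, le_rfl, Run.move k l S x w hw⟩
      (ih (by rw [Function.update_of_ne hkl, Function.update_self]) ?_)).mono
      (by simp; omega)
    rw [hS']
    funext i
    by_cases hl : i = l
    · subst hl; simp [Function.update_of_ne hkl.symm]
    · by_cases hk : i = k
      · subst hk; simp [Function.update_of_ne hl]
      · simp [Function.update_of_ne hl, Function.update_of_ne hk]

/-- Pops stack `1` and pushes the symbols to the stacks `0` and `2`. -/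
def splitBits : StackProg :=
  loop 1 Option.isSome (seq (ite 1 isNode (seq (push 0 (.bit true)) (push 2 (.bit true)))
    (seq (push 0 (.bit false)) (push 2 (.bit false)))) (pop 1))

theorem runLE_splitBits (w : List Bool) : ∀ (a d : List Γ'),
    RunLE splitBits ![a, w.map .bit, d, []]
      ![(w.map .bit).reverse ++ a, [], (w.map .bit).reverse ++ d, []] (5 * w.length + 1) := by
  induction w with
  | nil => intro a d; exact RunLE.loop_done (by simp)
  | cons x w ih =>
    intro a d
    have h : RunLE splitBits ![a, (x :: w).map .bit, d, []] _ (4 + (5 * w.length + 1) + 1) :=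
      RunLE.loop_step (by simp) (RunLE.seq (T := 3) (T' := 1)
        (S₁ := ![.bit x :: a, (x :: w).map .bit, .bit x :: d, []]) ?_ ?_)
        (ih (.bit x :: a) (.bit x :: d))
    · exact RunLE.mono (by simpa using h) (by simp; omega)
    · cases x
      · exact RunLE.ite_false (by simp [isNode]) (RunLE.seq (RunLE.push rfl) (RunLE.push (by simp)))
      · exact RunLE.ite_true (by simp [isNode]) (RunLE.seq (RunLE.push rfl) (RunLE.push (by simp)))
    · exact RunLE.pop (by simp)

theorem _root_.DataTree.exists_code_eq_map (x : DataTree) : ∃ w : List Bool, x.code = w.map .bit := by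
  induction x with
  | leaf => exact ⟨[false], rfl⟩
  | node l r hl hr =>
    obtain ⟨u, hu⟩ := hl
    obtain ⟨v, hv⟩ := hr
    exact ⟨true :: (u ++ v), by simp [DataTree.code, hu, hv]⟩

/-- Duplicates the top tree of stack `0`. -/
def dupTree : StackProg :=
  seq moveTreeOne (seq splitBits (seq (moveAll 2 1) (moveAll 1 0)))

/-- Moving to stack `1` reverses the code, and splitting restores its order on both stacks `0` and
`2`. The second copy returns by way of stack `1`, because one transfer alone would reverse it. -/
theorem runLE_dupTree (x : DataTree) (r : List Γ') :
    RunLE dupTree ![x.code ++ r, [], [], []] ![x.code ++ (x.code ++ r), [], [], []]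
      (13 * x.size + 5) := by
  obtain ⟨w, hw⟩ := x.exists_code_eq_map
  have hl : w.length = x.size := by rw [← x.length_code, hw, List.length_map]
  have h₁ := runLE_moveTreeOne x r [] []
  have h₂ := runLE_splitBits w.reverse r []
  have h₃ : RunLE (moveAll 2 1) ![x.code ++ r, [], x.code, []] ![x.code ++ r, x.code.reverse, [], []]
      (2 * x.code.length + 1) := runLE_moveAll (by decide) rfl (by simp)
  have h₄ : RunLE (moveAll 1 0) ![x.code ++ r, x.code.reverse, [], []]
      ![x.code ++ (x.code ++ r), [], [], []] (2 * x.code.reverse.length + 1) :=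
    runLE_moveAll (by decide) rfl (by simp)
  rw [List.map_reverse, ← hw, List.reverse_reverse] at h₂
  simp only [List.append_nil] at h₁ h₂
  exact (h₁.seq (h₂.seq (h₃.seq h₄))).mono (by simp; omega)

/-- Swaps the two top trees of stack `0`. -/
def swapTrees : StackProg :=
  seq moveTreeOne (seq moveTreeTwo (seq (moveAll 1 0) (moveAll 2 0)))

theorem runLE_swapTrees (x y : DataTree) (r : List Γ') :
    RunLE swapTrees ![x.code ++ (y.code ++ r), [], [], []] ![y.code ++ (x.code ++ r), [], [], []]
      (6 * x.size + 6 * y.size + 6) := by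
  have h₁ := runLE_moveTreeOne x (y.code ++ r) [] []
  have h₂ := runLE_moveTreeTwo y r x.code.reverse []
  have h₃ : RunLE (moveAll 1 0) ![r, x.code.reverse, y.code.reverse, []]
      ![x.code ++ r, [], y.code.reverse, []]
      (2 * x.code.reverse.length + 1) := runLE_moveAll (by decide) rfl (by simp)
  have h₄ : RunLE (moveAll 2 0) ![x.code ++ r, [], y.code.reverse, []]
      ![y.code ++ (x.code ++ r), [], [], []] (2 * y.code.reverse.length + 1) :=
    runLE_moveAll (by decide) rfl (by simp)
  simp only [List.append_nil] at h₁ h₂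
  exact (h₁.seq (h₂.seq (h₃.seq h₄))).mono (by simp; omega)

/-- Pushes a word onto stack `0`. -/
def pushWord : List Γ' → StackProg
  | [] => skip
  | x :: w => seq (pushWord w) (push 0 x)

theorem runLE_pushWord (w r b c d : List Γ') :
    RunLE (pushWord w) ![r, b, c, d] ![w ++ r, b, c, d] (w.length + 1) := by
  induction w with
  | nil => exact runLE_skip _
  | cons x w ih => exact ih.seq (T' := 1) (RunLE.push (by simp))

end StackProg

/-! ### Functions computable in polynomial time -/

/-- Natural coefficients make evaluation monotone, so a bound on a size can be substituted into a
time bound. -/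
theorem Polynomial.eval_nat_mono (p : Polynomial ℕ) : Monotone fun n => p.eval n := by
  intro m n h
  simp only [Polynomial.eval_eq_sum, Polynomial.sum]
  exact Finset.sum_le_sum fun i _ => Nat.mul_le_mul_left _ (Nat.pow_le_pow_left h i)

/-- Types whose elements are represented by trees. -/
class TreeCode (α : Type) where
  /-- The tree that represents an element. -/
  tree : α → DataTree

open TreeCode

/-- The size of the representation of an element. -/
def treeSize {α : Type} [TreeCode α] (a : α) : ℕ := (tree a).size

/-- The code of the representation of an element. -/
def treeWord {α : Type} [TreeCode α] (a : α) : List Γ' := (tree a).code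

section Instances

instance : TreeCode Bool := ⟨fun b => cond b (.node .leaf .leaf) .leaf⟩

instance {α β : Type} [TreeCode α] [TreeCode β] : TreeCode (α × β) :=
  ⟨fun x => .node (tree x.1) (tree x.2)⟩

/-- The tree of a list. -/
def listTree {α : Type} [TreeCode α] : List α → DataTree
  | [] => .leaf
  | a :: l => .node (tree a) (listTree l)

instance {α : Type} [TreeCode α] : TreeCode (List α) := ⟨listTree⟩

instance : TreeCode ℕ := ⟨fun n => tree n.bits⟩

/-- The tree of an optional element. -/
def optionTree {α : Type} [TreeCode α] : Option α → DataTree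
  | none => .leaf
  | some a => .node .leaf (tree a)

instance {α : Type} [TreeCode α] : TreeCode (Option α) := ⟨optionTree⟩

instance {α : Type} [TreeCode α] {p : α → Prop} : TreeCode (Subtype p) := ⟨fun a => tree a.1⟩

end Instances

section Size
variable {α β : Type} [TreeCode α] [TreeCode β]

theorem length_treeWord (a : α) : (treeWord a).length = treeSize a := DataTree.length_code _

theorem treeSize_prod (x : α × β) : treeSize x = treeSize x.1 + treeSize x.2 + 1 := rfl

theorem treeSize_nil : treeSize ([] : List α) = 1 := rfl

theorem treeSize_cons (a : α) (l : List α) : treeSize (a :: l) = treeSize a + treeSize l + 1 := rfl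

theorem treeSize_bool_le (b : Bool) : treeSize b ≤ 3 := by cases b <;> decide

theorem treeSize_append (l l' : List α) : treeSize (l ++ l') + 1 = treeSize l + treeSize l' := by
  induction l with
  | nil => simp [treeSize_nil, add_comm]
  | cons a l ih => simp only [List.cons_append, treeSize_cons]; omega

theorem treeSize_reverse (l : List α) : treeSize l.reverse = treeSize l := by
  induction l with
  | nil => rfl
  | cons a l ih =>
    have := treeSize_append l.reverse [a]
    simp only [List.reverse_cons, treeSize_cons, treeSize_nil] at *; omega

theorem treeSize_le_of_mem {a : α} {l : List α} (h : a ∈ l) : treeSize a ≤ treeSize l := by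
  induction l with
  | nil => simp at h
  | cons b l ih =>
    rw [treeSize_cons]
    rcases List.mem_cons.1 h with rfl | h
    · omega
    · have := ih h; omega

theorem length_lt_treeSize (l : List α) : l.length < treeSize l := by
  induction l with
  | nil => simp [treeSize_nil]
  | cons b l ih => rw [treeSize_cons, List.length_cons]; omega

theorem treeSize_list_le {l : List α} {B : ℕ} (h : ∀ a ∈ l, treeSize a ≤ B) :
    treeSize l ≤ l.length * (B + 1) + 1 := by
  induction l with
  | nil => simp [treeSize_nil]
  | cons b l ih =>
    have h₁ := h b (by simp)
    have h₂ := ih fun a ha => h a (by simp [ha])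
    rw [treeSize_cons, List.length_cons, Nat.succ_mul]; omega

theorem treeSize_sublist {l l' : List α} (h : l.Sublist l') : treeSize l ≤ treeSize l' := by
  induction h with
  | slnil => rfl
  | cons a _ ih => rw [treeSize_cons]; omega
  | cons_cons a _ ih => rw [treeSize_cons, treeSize_cons]; omega

end Size

/-! ### Polynomial time and its closure properties -/

/-- `f` is computed in polynomial time by a stack program that replaces the code of the argument on
top of stack `0` by the code of the value. -/
def PolyTime {α β : Type} [TreeCode α] [TreeCode β] (f : α → β) : Prop :=
  -- The word `r` is arbitrary, so a program can run while other data are kept below its argument.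
  ∃ (p : StackProg) (q : Polynomial ℕ), ∀ (a : α) (r : List Γ'),
    p.RunLE ![treeWord a ++ r, [], [], []] ![treeWord (f a) ++ r, [], [], []]
      (q.eval (treeSize a))

/-- `M a` is bounded by a polynomial in the size of `a`. -/
def PolyBound {α : Type} [TreeCode α] (M : α → ℕ) : Prop :=
  ∃ q : Polynomial ℕ, ∀ a, M a ≤ q.eval (treeSize a)

namespace PolyBound
variable {α : Type} [TreeCode α]

theorem const (n : ℕ) : PolyBound fun _ : α => n := ⟨Polynomial.C n, fun a => by simp⟩

theorem add {M N : α → ℕ} (hM : PolyBound M) (hN : PolyBound N) :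
    PolyBound fun a => M a + N a := by
  obtain ⟨p, hp⟩ := hM
  obtain ⟨q, hq⟩ := hN
  exact ⟨p + q, fun a => by simpa using add_le_add (hp a) (hq a)⟩

theorem mul {M N : α → ℕ} (hM : PolyBound M) (hN : PolyBound N) :
    PolyBound fun a => M a * N a := by
  obtain ⟨p, hp⟩ := hM
  obtain ⟨q, hq⟩ := hN
  exact ⟨p * q, fun a => by simpa using Nat.mul_le_mul (hp a) (hq a)⟩

theorem mono {M N : α → ℕ} (hN : PolyBound N) (h : ∀ a, M a ≤ N a) : PolyBound M := by
  obtain ⟨q, hq⟩ := hN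
  exact ⟨q, fun a => (h a).trans (hq a)⟩

theorem size : PolyBound fun a : α => treeSize a := ⟨Polynomial.X, fun a => by simp⟩

theorem eval {M : α → ℕ} (hM : PolyBound M) (q : Polynomial ℕ) :
    PolyBound fun a => q.eval (M a) := by
  obtain ⟨p, hp⟩ := hM
  exact ⟨q.comp p, fun a => by rw [Polynomial.eval_comp]; exact q.eval_nat_mono (hp a)⟩

end PolyBound

namespace PolyTime
open StackProg
variable {α β γ δ : Type} [TreeCode α] [TreeCode β] [TreeCode γ] [TreeCode δ]

theorem of_bound {f : α → β} (p : StackProg) (M : α → ℕ) (hM : PolyBound M)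
    (h : ∀ a r, p.RunLE ![treeWord a ++ r, [], [], []] ![treeWord (f a) ++ r, [], [], []] (M a)) :
    PolyTime f := by
  obtain ⟨q, hq⟩ := hM
  exact ⟨p, q, fun a r => (h a r).mono (hq a)⟩

theorem size_le {f : α → β} (hf : PolyTime f) : PolyBound fun a => treeSize (f a) := by
  obtain ⟨p, q, h⟩ := hf
  refine (PolyBound.size.add (PolyBound.size.eval q)).mono fun a => ?_
  obtain ⟨t, ht, hr⟩ := h a []
  have := hr.length_le 0
  simp [length_treeWord] at this
  omega

theorem of_tree_eq {f : α → β} (h : ∀ a, tree (f a) = tree a) : PolyTime f :=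
  of_bound skip (fun _ => 1) (.const 1) fun a r => by
    have : treeWord (f a) = treeWord a := congrArg _ (h a)
    rw [this]; exact runLE_skip _

protected theorem id : PolyTime fun a : α => a := of_tree_eq fun _ => rfl

theorem comp {g : β → γ} {f : α → β} (hg : PolyTime g) (hf : PolyTime f) :
    PolyTime fun a => g (f a) := by
  have hs := hf.size_le
  obtain ⟨p, q, h⟩ := hf
  obtain ⟨p', q', h'⟩ := hg
  exact of_bound (seq p p') (fun a => q.eval (treeSize a) + q'.eval (treeSize (f a)))
    ((PolyBound.size.eval q).add (hs.eval q')) fun a r => (h a r).seq (h' (f a) r)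

theorem const (b : β) : PolyTime fun _ : α => b :=
  of_bound (seq dropTree (pushWord (treeWord b)))
    (fun a => (4 * treeSize a + 2) + ((treeWord b).length + 1))
    ((((PolyBound.const 4).mul .size).add (.const _)).add (.const _)) fun a r =>
    (runLE_dropTree (tree a) r [] []).seq (runLE_pushWord _ _ _ _ _)

/-- If the tree of `k a` has the subtrees of `f a` and `g a`, it is computed from these. -/
theorem node {f : α → β} {g : α → γ} {k : α → δ} (hf : PolyTime f) (hg : PolyTime g)
    (h : ∀ a, tree (k a) = .node (tree (f a)) (tree (g a))) : PolyTime k := by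
  have hs := hg.size_le
  obtain ⟨p, q, hp⟩ := hf
  obtain ⟨p', q', hp'⟩ := hg
  -- The right subtree is computed first, from one copy of the argument. After the swap the left one
  -- is computed on top of it, and a single node symbol completes the prefix code.
  refine of_bound (seq dupTree (seq p' (seq swapTrees (seq p (push 0 (.bit true))))))
    (fun a => (13 * treeSize a + 5) + (q'.eval (treeSize a) +
      ((6 * treeSize (g a) + 6 * treeSize a + 6) + (q.eval (treeSize a) + 1))))
    ((((PolyBound.const 13).mul .size).add (.const _)).add ((PolyBound.size.eval _).add
    (((((PolyBound.const 6).mul hs).add ((PolyBound.const 6).mul .size)).add (.const _)).add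
    ((PolyBound.size.eval _).add (.const _))))) fun a r => ?_
  refine (runLE_dupTree (tree a) r).seq ((hp' a (treeWord a ++ r)).seq
    ((runLE_swapTrees (tree (g a)) (tree a) r).seq ((hp a _).seq (RunLE.push ?_))))
  simp [treeWord, h, DataTree.code]

theorem pair {f : α → β} {g : α → γ} (hf : PolyTime f) (hg : PolyTime g) :
    PolyTime fun a => (f a, g a) := hf.node hg fun _ => rfl

theorem cons {f : α → β} {g : α → List β} (hf : PolyTime f) (hg : PolyTime g) :
    PolyTime fun a => f a :: g a := hf.node hg fun _ => rfl

theorem some {f : α → β} (hf : PolyTime f) : PolyTime fun a => Option.some (f a) :=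
  (const false).node hf fun _ => rfl

/-- A function whose tree is the left subtree of the argument. -/
theorem left {k : α → β} (h : ∀ a, tree (k a) = (tree a).left) : PolyTime k := by
  refine of_bound (ite 0 isNode (seq (pop 0) (seq moveTreeOne (seq dropTree (moveAll 1 0)))) skip)
    (fun a => 10 * treeSize a + 7)
    (((PolyBound.const 10).mul .size).add (.const _)) fun a r => ?_
  simp only [treeWord, treeSize, h]
  rcases tree a with _ | ⟨x, y⟩
  · exact (RunLE.ite_false (by simp [isNode, DataTree.code]) (runLE_skip _)).mono (by omega)
  · simp only [DataTree.code, DataTree.left, List.cons_append, List.append_assoc]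
    have h₁ : RunLE (pop 0) ![.bit true :: (x.code ++ (y.code ++ r)), [], [], []]
      ![x.code ++ (y.code ++ r), [], [], []] 1 := RunLE.pop (by simp)
    have h₂ := runLE_moveTreeOne x (y.code ++ r) [] []
    have h₃ := runLE_dropTree y r (x.code.reverse ++ []) []
    have h₄ : RunLE (moveAll 1 0) ![r, x.code.reverse ++ [], [], []] ![x.code ++ r, [], [], []] _ :=
      runLE_moveAll (by decide) rfl (by simp)
    refine (RunLE.ite_true (by simp [isNode]) (h₁.seq (h₂.seq (h₃.seq h₄)))).mono ?_
    simp [DataTree.size]; omega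

/-- A function whose tree is the right subtree of the argument. -/
theorem right {k : α → β} (h : ∀ a, tree (k a) = (tree a).right) : PolyTime k := by
  refine of_bound (ite 0 isNode (seq (pop 0) dropTree) skip)
    (fun a => 4 * treeSize a + 4)
    (((PolyBound.const 4).mul .size).add (.const _)) fun a r => ?_
  simp only [treeWord, treeSize, h]
  rcases tree a with _ | ⟨x, y⟩
  · exact (RunLE.ite_false (by simp [isNode, DataTree.code]) (runLE_skip _)).mono (by omega)
  · simp only [DataTree.code, DataTree.right, List.cons_append, List.append_assoc]
    have h₁ : RunLE (pop 0) ![.bit true :: (x.code ++ (y.code ++ r)), [], [], []]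
      ![x.code ++ (y.code ++ r), [], [], []] 1 := RunLE.pop (by simp)
    refine (RunLE.ite_true (by simp [isNode]) (h₁.seq (runLE_dropTree x (y.code ++ r) [] []))).mono ?_
    simp [DataTree.size]; omega

protected theorem fst : PolyTime fun x : α × β => x.1 := left fun _ => rfl

protected theorem snd : PolyTime fun x : α × β => x.2 := right fun _ => rfl

theorem isNode_tree_iff (x : DataTree) (r : List Γ') :
    isNode (x.code ++ r).head? = true ↔ x ≠ .leaf := by
  cases x <;> simp [DataTree.code, isNode]

/-- Case distinction on whether the tree of the argument is a leaf. -/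
theorem cases {f g k : α → β} (hf : PolyTime f) (hg : PolyTime g)
    (h₁ : ∀ a, tree a ≠ .leaf → k a = f a) (h₂ : ∀ a, tree a = .leaf → k a = g a) :
    PolyTime k := by
  obtain ⟨p, q, hp⟩ := hf
  obtain ⟨p', q', hp'⟩ := hg
  refine of_bound (ite 0 isNode p p')
    (fun a => q.eval (treeSize a) + q'.eval (treeSize a) + 1)
    (((PolyBound.size.eval _).add (PolyBound.size.eval _)).add (.const _)) fun a r => ?_
  by_cases h : tree a = .leaf
  · rw [h₂ a h]
    exact (RunLE.ite_false (by simpa [treeWord, h] using (isNode_tree_iff (tree a) r).not)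
      (hp' a r)).mono (by omega)
  · rw [h₁ a h]
    exact (RunLE.ite_true (by simpa [treeWord, h] using isNode_tree_iff (tree a) r)
      (hp a r)).mono (by omega)

/-- A Boolean function that tests whether the tree of the argument is not a leaf. -/
theorem of_eq_node {k : α → Bool} (h : ∀ a, k a = true ↔ tree a ≠ .leaf) : PolyTime k :=
  cases (const true) (const false) (fun a ha => (h a).2 ha)
    (fun a ha => by simpa [ha] using h a)

/-- Case distinction on a computable condition. -/
theorem dite {c : α → Bool} {f : {a // c a = true} → β} {g : {a // ¬ c a = true} → β} {k : α → β}
    (hc : PolyTime c) (hf : PolyTime f) (hg : PolyTime g)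
    (h₁ : ∀ a h, k a = f ⟨a, h⟩) (h₂ : ∀ a h, k a = g ⟨a, h⟩) : PolyTime k := by
  obtain ⟨p₀, q₀, hp₀⟩ := hc
  obtain ⟨p, q, hp⟩ := hf
  obtain ⟨p', q', hp'⟩ := hg
  -- The Boolean has tree size at most `3`, so dropping it costs at most `4 * 3 + 2 = 14` steps. The
  -- branches receive the saved copy of the argument, and membership in the subtype does not change
  -- its tree.
  refine of_bound (seq dupTree (seq p₀ (.ite 0 isNode (seq dropTree p) (seq dropTree p'))))
    (fun a => (13 * treeSize a + 5) + (q₀.eval (treeSize a) +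
      (14 + q.eval (treeSize a) + q'.eval (treeSize a) + 1)))
    ((((PolyBound.const 13).mul .size).add (.const _)).add ((PolyBound.size.eval _).add
    ((((PolyBound.const _).add (PolyBound.size.eval _)).add (PolyBound.size.eval _)).add
      (.const _)))) fun a r => ?_
  refine (runLE_dupTree (tree a) r).seq ((hp₀ a (treeWord a ++ r)).seq ?_)
  have hd := runLE_dropTree (tree (c a)) (treeWord a ++ r) [] []
  have hs : (tree (c a)).size ≤ 3 := treeSize_bool_le _
  by_cases h : c a = true
  · rw [h₁ a h]
    rw [h] at hd hs ⊢
    have := hd.seq (hp ⟨a, h⟩ r)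
    exact (RunLE.ite_true rfl this).mono (by simp only [treeSize, tree] at *; omega)
  · rw [h₂ a h]
    have h' : c a = false := by simpa using h
    rw [h'] at hd hs ⊢
    have := hd.seq (hp' ⟨a, h⟩ r)
    exact (RunLE.ite_false rfl this).mono (by simp only [treeSize, tree] at *; omega)

theorem val {p : α → Prop} : PolyTime fun a : Subtype p => a.1 := of_tree_eq fun _ => rfl

theorem ite {c : α → Bool} {f g : α → β} (hc : PolyTime c) (hf : PolyTime f) (hg : PolyTime g) :
    PolyTime fun a => if c a = true then f a else g a :=
  dite hc (hf.comp val) (hg.comp val) (fun _ h => if_pos h) (fun _ h => if_neg h)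

/-- Iteration of `body` while the first component is nonempty. -/
theorem exists_while {body : List α × β → List α × β} (hb : PolyTime body)
    (hfix : ∀ s, s.1 = [] → body s = s) :
    ∃ (p : StackProg) (q : Polynomial ℕ), ∀ (N M : ℕ) (s : List α × β) (r : List Γ'),
      (body^[N] s).1 = [] → (∀ i ≤ N, treeSize (body^[i] s) ≤ M) →
      p.RunLE ![treeWord s ++ r, [], [], []] ![treeWord (body^[N] s) ++ r, [], [], []]
        ((N + 1) * q.eval M) := by
  obtain ⟨p, q, hp⟩ := hb
  have htree : ∀ (s : List α × β) (r : List Γ'), treeWord s ++ r =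
      .bit true :: (treeWord s.1 ++ (treeWord s.2 ++ r)) := by
    intro s r
    simp [treeWord, tree, DataTree.code]
  -- The loop keeps the state without its outer node symbol. The top symbol then tells whether the
  -- list in the first component is empty, and the node symbol is restored only around `body`.
  let L := loop 0 isNode (seq (push 0 (.bit true)) (seq p (pop 0)))
  have key : ∀ (N M : ℕ) (s : List α × β) (r : List Γ'),
      (body^[N] s).1 = [] → (∀ i ≤ N, treeSize (body^[i] s) ≤ M) →
      L.RunLE ![treeWord s.1 ++ (treeWord s.2 ++ r), [], [], []]
        ![treeWord (body^[N] s).1 ++ (treeWord (body^[N] s).2 ++ r), [], [], []]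
        (N * (q.eval M + 3) + 1) := by
    intro N
    induction N with
    | zero =>
      intro M s r h₀ _
      exact (RunLE.loop_done (by simp at h₀; rw [h₀]; rfl)).mono (by omega)
    | succ N ih =>
      intro M s r h₀ hM
      -- The loop may stop before `N` rounds; the remaining iterations change nothing by `hfix`.
      by_cases hs : s.1 = []
      · have hit : ∀ i, body^[i] s = s := fun i => Function.iterate_fixed (hfix s hs) i
        rw [hit]
        exact (RunLE.loop_done (by rw [hs]; rfl)).mono (by omega)
      · rw [Function.iterate_succ_apply] at h₀ ⊢
        have ih' := ih M (body s) r h₀ fun i hi => by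
          have := hM (i + 1) (by omega)
          rwa [Function.iterate_succ_apply] at this
        have hrun := hp s r
        rw [htree, htree] at hrun
        have hq : q.eval (treeSize s) ≤ q.eval M := q.eval_nat_mono (hM 0 (by omega))
        refine (RunLE.loop_step (T := 1 + (q.eval (treeSize s) + 1)) ?_ ?_ ih').mono ?_
        · obtain ⟨l, b⟩ := s
          cases l with
          | nil => exact absurd rfl hs
          | cons a l => rfl
        · exact (RunLE.push (by simp)).seq (hrun.seq (RunLE.pop (by simp)))
        · rw [Nat.succ_mul]; omega
  refine ⟨seq (pop 0) (seq L (push 0 (.bit true))), q + 6, fun N M s r h₀ hM => ?_⟩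
  rw [htree, htree]
  refine (RunLE.seq (T := 1) (RunLE.pop (by simp)) ((key N M s r h₀ hM).seq (T' := 1)
    (RunLE.push (by simp)))).mono ?_
  simp only [Polynomial.eval_add, Polynomial.eval_ofNat]
  nlinarith

/-- The tail of a list is computed in polynomial time. -/
theorem tail {f : α → List β} (hf : PolyTime f) : PolyTime fun a => (f a).tail :=
  (right (α := List β) (k := List.tail) fun l => by cases l <;> rfl).comp hf

/-- The head of a list is computed in polynomial time, if the default value is a leaf. -/
theorem headD {f : α → List β} (hf : PolyTime f) (d : β) (hd : tree d = .leaf) :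
    PolyTime fun a => (f a).headD d :=
  (left (α := List β) (k := fun l => l.headD d)
    fun l => by cases l; exacts [hd, rfl]).comp hf

/-- Folds over lists with polynomially bounded intermediate results. -/
theorem foldl {l : α → List β} {b : α → γ} {f : α → γ → β → γ} (hl : PolyTime l) (hb : PolyTime b)
    (hf : PolyTime fun x : α × γ × β => f x.1 x.2.1 x.2.2) (M : α → ℕ) (hM : PolyBound M)
    (h : ∀ a l₁ l₂, l a = l₁ ++ l₂ → treeSize (l₁.foldl (f a) (b a)) ≤ M a) :
    PolyTime fun a => (l a).foldl (f a) (b a) := by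
  -- The parameter `a` travels in the loop state, because a program sees nothing but its stack.
  let body : List β × (α × γ) → List β × (α × γ) := fun s =>
    match s with
    | ([], s) => ([], s)
    | (x :: l, a, c) => (l, a, f a c x)
  have hbody : PolyTime body := by
    have hc : PolyTime fun s : List β × (α × γ) => !s.1.isEmpty :=
      (of_eq_node (k := fun l : List β => !l.isEmpty)
        fun l => by cases l <;> simp [tree, listTree]).comp PolyTime.fst
    have hne : ∀ s : {s : List β × (α × γ) // (!s.1.isEmpty) = true}, s.1.1 ≠ [] := by
      rintro ⟨⟨l, s⟩, h⟩; simpa using h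
    -- No default element of `β` is available, so the head is taken on the subtype of states with a
    -- nonempty list.
    have hhead : PolyTime fun s : {s : List β × (α × γ) // (!s.1.isEmpty) = true} =>
        s.1.1.head (hne s) := by
      refine (left (α := {l : List β // l ≠ []}) (k := fun l => l.1.head l.2) ?_).comp
        (f := fun s : {s : List β × (α × γ) // (!s.1.isEmpty) = true} => ⟨s.1.1, hne s⟩)
        ((PolyTime.left fun _ => rfl))
      rintro ⟨l, h⟩
      cases l
      · exact absurd rfl h
      · rfl
    refine dite (f := fun s => (s.1.1.tail, s.1.2.1, f s.1.2.1 s.1.2.2 (s.1.1.head (hne s))))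
      (g := fun s => s.1) hc ?_ val ?_ ?_
    · exact (tail (PolyTime.fst.comp val)).pair ((PolyTime.fst.comp (PolyTime.snd.comp val)).pair
        (hf.comp ((PolyTime.fst.comp (PolyTime.snd.comp val)).pair
        ((PolyTime.snd.comp (PolyTime.snd.comp val)).pair hhead))))
    · rintro ⟨l, s⟩ h
      cases l
      · simp at h
      · rfl
    · rintro ⟨l, s⟩ h
      cases l
      · rfl
      · simp at h
  obtain ⟨p, q, hp⟩ := exists_while hbody (by rintro ⟨l, s⟩ h; cases h; rfl)
  obtain ⟨p₀, q₀, hp₀⟩ := hl.pair (PolyTime.id.pair hb)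
  obtain ⟨p₁, q₁, hp₁⟩ := (PolyTime.snd (α := List β) (β := α × γ))
  obtain ⟨p₂, q₂, hp₂⟩ := (PolyTime.snd (α := α) (β := γ))
  have hiter : ∀ (l₁ l₂ : List β) a c,
      body^[l₁.length] (l₁ ++ l₂, a, c) = (l₂, a, l₁.foldl (f a) c) := by
    intro l₁
    induction l₁ with
    | nil => intro l₂ a c; rfl
    | cons x l₁ ih => intro l₂ a c; exact ih l₂ a (f a c x)
  refine of_bound (seq p₀ (seq p (seq p₁ p₂)))
    (fun a => q₀.eval (treeSize a) + ((treeSize (l a) + 1) *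
      q.eval (treeSize (l a) + (treeSize a + M a + 1) + 1) +
      (q₁.eval (1 + (treeSize a + M a + 1) + 1) + q₂.eval (treeSize a + M a + 1))))
    ((PolyBound.size.eval _).add (((hl.size_le.add (.const _)).mul
      (((hl.size_le.add ((PolyBound.size.add hM).add (.const _))).add (.const _)).eval _)).add
      (((((PolyBound.const _).add ((PolyBound.size.add hM).add (.const _))).add (.const _)).eval
        _).add (((PolyBound.size.add hM).add (.const _)).eval _)))) fun a r => ?_
  have hend := hiter (l a) [] a (b a)
  rw [List.append_nil] at hend
  have hrun := hp (l a).length (treeSize (l a) + (treeSize a + M a + 1) + 1) (l a, a, b a) r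
    (by rw [hend]) (fun i hi => by
      have := hiter ((l a).take i) ((l a).drop i) a (b a)
      rw [List.take_append_drop, List.length_take, min_eq_left hi] at this
      rw [this, treeSize_prod, treeSize_prod]
      have h₁ := h a ((l a).take i) ((l a).drop i) (List.take_append_drop i _).symm
      have h₂ := treeSize_sublist (List.drop_sublist i (l a))
      simp only; omega)
  rw [hend] at hrun
  have hM' := h a (l a) [] (List.append_nil _).symm
  refine ((hp₀ a r).seq (hrun.seq ((hp₁ _ r).seq (hp₂ _ r)))).mono ?_
  have hlen := length_lt_treeSize (l a)
  have e₁ : q₁.eval (treeSize (([] : List β), a, (l a).foldl (f a) (b a))) ≤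
      q₁.eval (1 + (treeSize a + M a + 1) + 1) := q₁.eval_nat_mono (by
    simp only [treeSize_prod, treeSize_nil]; omega)
  have e₂ : q₂.eval (treeSize (a, (l a).foldl (f a) (b a))) ≤
      q₂.eval (treeSize a + M a + 1) := q₂.eval_nat_mono (by
    simp only [treeSize_prod]; omega)
  gcongr

end PolyTime

namespace PolyTime
variable {α β γ δ : Type} [TreeCode α] [TreeCode β] [TreeCode γ] [TreeCode δ]

/-! ### Lists -/

/-- Folds over lists in which every step increases the size by a bounded amount. -/
theorem foldl_of_growth {l : α → List β} {b : α → γ} {f : α → γ → β → γ} (hl : PolyTime l)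
    (hb : PolyTime b) (hf : PolyTime fun x : α × γ × β => f x.1 x.2.1 x.2.2) (N : α → ℕ)
    (hN : PolyBound N) (h : ∀ a c x, x ∈ l a → treeSize (f a c x) ≤ treeSize c + N a) :
    PolyTime fun a => (l a).foldl (f a) (b a) := by
  refine foldl hl hb hf (fun a => treeSize (b a) + treeSize (l a) * N a)
    (hb.size_le.add (hl.size_le.mul hN)) fun a l₁ l₂ hl₁ => ?_
  have key : ∀ (l₁ : List β) c, (∀ x ∈ l₁, x ∈ l a) →
      treeSize (l₁.foldl (f a) c) ≤ treeSize c + l₁.length * N a := by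
    intro l₁
    induction l₁ with
    | nil => intro c _; simp
    | cons x l₁ ih =>
      intro c hx
      have h₁ := ih (f a c x) fun y hy => hx y (by simp [hy])
      have h₂ := h a c x (hx x (by simp))
      rw [List.foldl_cons, List.length_cons, Nat.succ_mul]
      omega
  have hlen : l₁.length ≤ treeSize (l a) := by
    have := length_lt_treeSize (l a)
    rw [hl₁, List.length_append] at this
    rw [hl₁]; omega
  exact (key l₁ (b a) fun x hx => by simp [hl₁, hx]).trans
    (Nat.add_le_add_left (Nat.mul_le_mul_right _ hlen) _)

theorem reverse {l : α → List β} (hl : PolyTime l) : PolyTime fun a => (l a).reverse := by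
  have h : PolyTime fun a => (l a).foldl (fun acc x => x :: acc) [] :=
    foldl_of_growth hl (const []) (cons (PolyTime.snd.comp .snd) (PolyTime.fst.comp .snd))
      (fun a => treeSize (l a) + 1) (hl.size_le.add (.const 1)) fun a c x hx => by
        have := treeSize_le_of_mem hx
        rw [treeSize_cons]; omega
  simpa [List.foldl_flip_cons_eq_append] using h

theorem append {l l' : α → List β} (hl : PolyTime l) (hl' : PolyTime l') :
    PolyTime fun a => l a ++ l' a := by
  have h : PolyTime fun a => (l a).reverse.foldl (fun acc x => x :: acc) (l' a) :=
    foldl_of_growth hl.reverse hl' (cons (PolyTime.snd.comp .snd) (PolyTime.fst.comp .snd))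
      (fun a => treeSize (l a) + 1) (hl.size_le.add (.const 1)) fun a c x hx => by
        have := treeSize_le_of_mem (List.mem_reverse.1 hx)
        rw [treeSize_cons]; omega
  simpa [List.foldl_flip_cons_eq_append] using h

theorem flatMap {l : α → List β} {f : α → β → List γ} (hl : PolyTime l)
    (hf : PolyTime fun x : α × β => f x.1 x.2) : PolyTime fun a => (l a).flatMap (f a) := by
  obtain ⟨q, hq⟩ := hf.size_le
  have h : PolyTime fun a => (l a).foldl (fun acc x => acc ++ f a x) [] :=
    foldl_of_growth hl (const []) (append (PolyTime.fst.comp .snd)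
      (hf.comp (PolyTime.fst.pair (PolyTime.snd.comp .snd))))
      (fun a => q.eval (treeSize a + treeSize (l a) + 1))
      (((PolyBound.size.add hl.size_le).add (.const _)).eval q) fun a c x hx => by
        have h₁ := treeSize_append c (f a x)
        have h₂ := hq (a, x)
        have h₃ := treeSize_le_of_mem hx
        have h₄ : q.eval (treeSize (a, x)) ≤ q.eval (treeSize a + treeSize (l a) + 1) :=
          q.eval_nat_mono (by rw [treeSize_prod]; simp only; omega)
        simp only at h₂; omega
  have e : ∀ (f : β → List γ) (l : List β) (c : List γ),
      l.foldl (fun acc x => acc ++ f x) c = c ++ l.flatMap f := by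
    intro f l; induction l <;> simp_all
  simpa [e] using h

theorem map {l : α → List β} {f : α → β → γ} (hl : PolyTime l)
    (hf : PolyTime fun x : α × β => f x.1 x.2) : PolyTime fun a => (l a).map (f a) := by
  have h := flatMap (f := fun a x => [f a x]) hl (hf.cons (const []))
  simpa only [List.map_eq_flatMap] using h

theorem filter {l : α → List β} {f : α → β → Bool} (hl : PolyTime l)
    (hf : PolyTime fun x : α × β => f x.1 x.2) : PolyTime fun a => (l a).filter (f a) := by
  have h := flatMap (f := fun a x => if f a x = true then [x] else []) hl
    (ite hf (PolyTime.snd.cons (const [])) (const []))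
  have e : ∀ (f : β → Bool) (l : List β),
      l.flatMap (fun x => if f x = true then [x] else []) = l.filter f := by
    intro f l
    induction l with
    | nil => rfl
    | cons x l ih => cases hx : f x <;> simp [hx, ih]
  simpa only [e] using h

/-! ### Booleans -/

theorem apply_bool {c : α → Bool} (hc : PolyTime c) (f : Bool → β) : PolyTime fun a => f (c a) := by
  have h := ite hc (const (f true)) (const (f false))
  have e : (fun a => f (c a)) = fun a => if c a = true then f true else f false := by
    funext a; cases c a <;> rfl
  rwa [e]

theorem not {c : α → Bool} (hc : PolyTime c) : PolyTime fun a => !c a := hc.apply_bool _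

theorem or {c d : α → Bool} (hc : PolyTime c) (hd : PolyTime d) : PolyTime fun a => c a || d a := by
  have h := ite hc (const true) hd
  have e : (fun a => c a || d a) = fun a => if c a = true then true else d a := by
    funext a; cases c a <;> rfl
  rwa [e]

theorem and {c d : α → Bool} (hc : PolyTime c) (hd : PolyTime d) :
    PolyTime fun a => c a && d a := by
  have h := ite hc hd (const false)
  have e : (fun a => c a && d a) = fun a => if c a = true then d a else false := by
    funext a; cases c a <;> rfl
  rwa [e]

theorem xor {c d : α → Bool} (hc : PolyTime c) (hd : PolyTime d) :
    PolyTime fun a => Bool.xor (c a) (d a) := by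
  have h := ite hc hd.not hd
  have e : (fun a => Bool.xor (c a) (d a)) = fun a => if c a = true then !d a else d a := by
    funext a; cases c a <;> simp
  rwa [e]

theorem isEmpty {l : α → List β} (hl : PolyTime l) : PolyTime fun a => (l a).isEmpty := by
  have h : PolyTime fun l : List β => !l.isEmpty :=
    of_eq_node fun l => by cases l <;> simp [tree, listTree]
  simpa using (h.comp hl).not

/-! ### Binary numbers -/

end PolyTime

theorem treeSize_nat_eq (n : ℕ) : treeSize n = treeSize n.bits := rfl

theorem treeSize_nat_le {n k : ℕ} (h : n < 2 ^ k) : treeSize n ≤ 4 * k + 1 := by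
  have h₁ : n.bits.length ≤ k := by rw [Nat.size_eq_bits_len]; exact Nat.size_le.2 h
  have h₂ := treeSize_list_le (l := n.bits) (B := 3) fun b _ => treeSize_bool_le b
  rw [treeSize_nat_eq]; omega

theorem lt_two_pow_treeSize (n : ℕ) : n < 2 ^ treeSize n := by
  have := length_lt_treeSize n.bits
  rw [Nat.size_eq_bits_len] at this
  exact (Nat.lt_size_self n).trans_le (Nat.pow_le_pow_right (by norm_num) this.le)

/-- Tree size is not monotone in the number, as a bit `true` has a larger tree than a bit `false`.
Up to the factor `4` only the bit length counts. -/
theorem treeSize_nat_mono_bound {m n : ℕ} (h : m ≤ n) : treeSize m ≤ 4 * treeSize n + 1 :=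
  treeSize_nat_le (h.trans_lt (lt_two_pow_treeSize n))

theorem treeSize_nat_le_self (n : ℕ) : treeSize n ≤ 4 * n + 1 := treeSize_nat_le n.lt_two_pow_self

/-- The number with the given bits, the least significant bit first. -/
def natOfBits (l : List Bool) : ℕ := l.foldr Nat.bit 0

theorem natOfBits_bits (n : ℕ) : natOfBits n.bits = n := by
  induction n using Nat.binaryRec' with
  | zero => simp [natOfBits]
  | bit b n h ih =>
    rw [Nat.bits_append_bit n b h]
    simpa [natOfBits] using congrArg (Nat.bit b) ih

theorem natOfBits_lt (l : List Bool) : natOfBits l < 2 ^ l.length := by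
  induction l with
  | nil => simp [natOfBits]
  | cons b l ih =>
    rw [List.length_cons, pow_succ]
    change Nat.bit b (natOfBits l) < _
    rw [Nat.bit_val]
    cases b <;> simp <;> omega

namespace PolyTime
variable {α β γ δ : Type} [TreeCode α] [TreeCode β] [TreeCode γ] [TreeCode δ]

theorem bits {n : α → ℕ} (hn : PolyTime n) : PolyTime fun a => (n a).bits :=
  (of_tree_eq (f := Nat.bits) fun _ => rfl).comp hn

theorem bodd {n : α → ℕ} (hn : PolyTime n) : PolyTime fun a => (n a).bodd :=
  (left (k := Nat.bodd) fun n => by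
    rw [Nat.bodd_eq_bits_head]
    simp only [tree]
    cases n.bits <;> rfl).comp hn

theorem half {n : α → ℕ} (hn : PolyTime n) : PolyTime fun a => n a / 2 :=
  (right (k := fun n : ℕ => n / 2) fun n => by
    rw [← Nat.div2_val]
    simp only [tree, Nat.div2_bits_eq_tail]
    cases n.bits <;> rfl).comp hn

theorem isPos {n : α → ℕ} (hn : PolyTime n) : PolyTime fun a => decide (0 < n a) := by
  have h : PolyTime fun n : ℕ => decide (0 < n) := of_eq_node fun n => by
    induction n using Nat.binaryRec' with
    | zero => simp [tree, listTree]
    | bit b n h ih =>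
      simp only [tree, Nat.bits_append_bit n b h, listTree]
      simp only [Nat.bit_val, decide_eq_true_eq, ne_eq, reduceCtorEq, not_false_eq_true, iff_true]
      cases b
      · have := mt h (by simp); simp; omega
      · simp
  exact h.comp hn

/-- Prepending a bit to `Nat.bits` gives the canonical bit list except for the bit `false` in front
of zero, which must stay the empty list. This forces the case distinction. -/
theorem bit {b : α → Bool} {n : α → ℕ} (hb : PolyTime b) (hn : PolyTime n) :
    PolyTime fun a => Nat.bit (b a) (n a) := by
  refine dite (c := fun a => b a || decide (0 < n a))
    (f := fun a => Nat.bit (b a.1) (n a.1)) (g := fun _ => 0) (hb.or hn.isPos)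
    (node (hb.comp val) (hn.comp val) ?_) (const 0) (fun _ _ => rfl) ?_
  · rintro ⟨a, h⟩
    simp only [tree]
    rw [Nat.bits_append_bit]
    · rfl
    · intro h₀
      simpa [h₀] using h
  · intro a h
    simp only [Bool.or_eq_true, decide_eq_true_eq, not_or, not_lt, Nat.le_zero] at h
    simp [h.1, h.2]

theorem natOfBits {l : α → List Bool} (hl : PolyTime l) : PolyTime fun a => natOfBits (l a) := by
  have h : PolyTime fun a => (l a).reverse.foldl (fun n b => Nat.bit b n) 0 :=
    foldl hl.reverse (const 0) (bit (PolyTime.snd.comp .snd) (PolyTime.fst.comp .snd))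
      (fun a => 4 * treeSize (l a) + 1) (((PolyBound.const 4).mul hl.size_le).add (.const 1))
      fun a l₁ l₂ h => by
        have h₁ := natOfBits_lt l₁.reverse
        rw [_root_.natOfBits, List.foldr_reverse] at h₁
        refine (treeSize_nat_le h₁).trans ?_
        have h₂ := length_lt_treeSize (l a).reverse
        rw [treeSize_reverse, h] at h₂
        simp at h₂ ⊢; omega
  simpa [_root_.natOfBits] using h

/-- One step of the binary addition of the two first components, with a carry and the list of the
bits that have been computed. -/
def addStep (s : (ℕ × ℕ) × (Bool × List Bool)) : (ℕ × ℕ) × (Bool × List Bool) :=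
  ((s.1.1 / 2, s.1.2 / 2), (((s.1.1.bodd && s.1.2.bodd) || (s.2.1 && (s.1.1.bodd || s.1.2.bodd))),
    Bool.xor (Bool.xor s.1.1.bodd s.1.2.bodd) s.2.1 :: s.2.2))

theorem polyTime_addStep : PolyTime addStep := by
  have h₁ : PolyTime fun s : (ℕ × ℕ) × (Bool × List Bool) => s.1.1 := PolyTime.fst.comp .fst
  have h₂ : PolyTime fun s : (ℕ × ℕ) × (Bool × List Bool) => s.1.2 := PolyTime.snd.comp .fst
  have h₃ : PolyTime fun s : (ℕ × ℕ) × (Bool × List Bool) => s.2.1 := PolyTime.fst.comp .snd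
  have h₄ : PolyTime fun s : (ℕ × ℕ) × (Bool × List Bool) => s.2.2 := PolyTime.snd.comp .snd
  exact (h₁.half.pair h₂.half).pair (((h₁.bodd.and h₂.bodd).or
    (h₃.and (h₁.bodd.or h₂.bodd))).pair (((h₁.bodd.xor h₂.bodd).xor h₃).cons h₄))

/-- The bound `2 ^ k` ensures that `k` rounds use up both numbers and the last carry. The bits are
produced least significant first and pushed in front, hence the reversal. -/
theorem iterate_addStep (k : ℕ) : ∀ (m n : ℕ) (c : Bool) (l : List Bool), m + n + c.toNat < 2 ^ k →
    ∃ l', (addStep^[k] ((m, n), (c, l))).2.2 = l' ++ l ∧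
      _root_.natOfBits l'.reverse = m + n + c.toNat := by
  induction k with
  | zero =>
    intro m n c l h
    refine ⟨[], rfl, ?_⟩
    simp only [_root_.natOfBits, List.reverse_nil, List.foldr_nil]; omega
  | succ k ih =>
    intro m n c l h
    have hm := Nat.bodd_add_div2 m
    have hn := Nat.bodd_add_div2 n
    rw [Nat.div2_val] at hm hn
    rw [pow_succ] at h
    obtain ⟨l', h₁, h₂⟩ := ih (m / 2) (n / 2) ((m.bodd && n.bodd) || (c && (m.bodd || n.bodd)))
      (Bool.xor (Bool.xor m.bodd n.bodd) c :: l) (by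
        cases hb : m.bodd <;> cases hb' : n.bodd <;> cases c <;> simp [hb, hb'] at * <;> omega)
    refine ⟨l' ++ [Bool.xor (Bool.xor m.bodd n.bodd) c], ?_, ?_⟩
    · rw [Function.iterate_succ_apply, List.append_assoc]
      exact h₁
    · rw [List.reverse_append]
      change Nat.bit _ (_root_.natOfBits l'.reverse) = _
      rw [h₂, Nat.bit_val]
      cases hb : m.bodd <;> cases hb' : n.bodd <;> cases c <;> simp [hb, hb'] at * <;> omega

theorem _root_.List.foldl_const_eq_iterate {α β : Type*} (f : β → β) (l : List α) (b : β) :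
    l.foldl (fun c _ => f c) b = f^[l.length] b := by
  induction l generalizing b with
  | nil => rfl
  | cons x l ih => exact ih (f b)

theorem add {m n : α → ℕ} (hm : PolyTime m) (hn : PolyTime n) : PolyTime fun a => m a + n a := by
  -- This list only serves as a round counter: the sum has at most as many bits as the two numbers
  -- together, plus one.
  have hfuel : PolyTime fun a => (m a).bits ++ (n a).bits ++ [true] :=
    (hm.bits.append hn.bits).append (const _)
  have h := foldl (l := fun a => (m a).bits ++ (n a).bits ++ [true])
    (b := fun a => ((m a, n a), (false, ([] : List Bool)))) (f := fun _ s _ => addStep s)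
    hfuel ((hm.pair hn).pair (const _)) (polyTime_addStep.comp (PolyTime.fst.comp .snd))
    (fun a => (4 * treeSize (m a) + 1) + (4 * treeSize (n a) + 1) +
      (5 + (treeSize ((m a).bits ++ (n a).bits ++ [true]) * 4 + 1)) + 1)
    ((((((PolyBound.const 4).mul hm.size_le).add (.const _)).add
      (((PolyBound.const 4).mul hn.size_le).add (.const _))).add
      ((PolyBound.const _).add ((hfuel.size_le.mul (.const _)).add (.const _)))).add (.const _))
    (fun a l₁ l₂ hl => by
      rw [List.foldl_const_eq_iterate]
      have key : ∀ k, (addStep^[k] ((m a, n a), (false, []))).1.1 ≤ m a ∧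
          (addStep^[k] ((m a, n a), (false, []))).1.2 ≤ n a ∧
          (addStep^[k] ((m a, n a), (false, []))).2.2.length = k := by
        intro k
        induction k with
        | zero => simp
        | succ k ih =>
          rw [Function.iterate_succ_apply']
          refine ⟨(Nat.div_le_self _ _).trans ih.1, (Nat.div_le_self _ _).trans ih.2.1, ?_⟩
          simp [addStep, ih.2.2]
      obtain ⟨h₁, h₂, h₃⟩ := key l₁.length
      have h₄ := length_lt_treeSize ((m a).bits ++ (n a).bits ++ [true])
      rw [hl, List.length_append] at h₄
      have h₅ := treeSize_list_le (l := (addStep^[l₁.length] ((m a, n a), (false, []))).2.2)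
        (B := 3) fun b _ => treeSize_bool_le b
      have h₆ := treeSize_bool_le (addStep^[l₁.length] ((m a, n a), (false, []))).2.1
      have h₇ := treeSize_nat_mono_bound h₁
      have h₈ := treeSize_nat_mono_bound h₂
      rw [treeSize_prod, treeSize_prod, treeSize_prod, hl]
      omega)
  have h' := ((PolyTime.snd.comp (PolyTime.snd.comp h)).reverse).natOfBits
  have e : ∀ m n : ℕ, _root_.natOfBits ((m.bits ++ n.bits ++ [true]).foldl (fun s _ => addStep s)
      ((m, n), (false, ([] : List Bool)))).2.2.reverse = m + n := by
    intro m n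
    rw [List.foldl_const_eq_iterate]
    obtain ⟨l', h₁, h₂⟩ := iterate_addStep (m.bits ++ n.bits ++ [true]).length m n false [] (by
      have hm : m < 2 ^ m.bits.length := by rw [Nat.size_eq_bits_len]; exact Nat.lt_size_self m
      have hn : n < 2 ^ n.bits.length := by rw [Nat.size_eq_bits_len]; exact Nat.lt_size_self n
      have h₁ : 2 ^ m.bits.length ≤ 2 ^ (m.bits.length + n.bits.length) :=
        Nat.pow_le_pow_right (by norm_num) (by omega)
      have h₂ : 2 ^ n.bits.length ≤ 2 ^ (m.bits.length + n.bits.length) :=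
        Nat.pow_le_pow_right (by norm_num) (by omega)
      simp only [List.length_append, List.length_singleton, pow_succ, Bool.toNat_false]
      omega)
    rw [h₁, List.append_nil, h₂]; rfl
  simpa only [e] using h'

/-- One step of the comparison of two numbers, least significant bits first. -/
def ltStep (s : (ℕ × ℕ) × Bool) : (ℕ × ℕ) × Bool :=
  ((s.1.1 / 2, s.1.2 / 2), if Bool.xor s.1.1.bodd s.1.2.bodd = true then s.1.2.bodd else s.2)

/-- The most significant position at which the numbers differ decides the comparison. Scanning
upwards, each differing bit overrides the verdict `c` on the lower bits. -/
theorem iterate_ltStep (k : ℕ) : ∀ (m n : ℕ) (c : Bool), m < 2 ^ k → n < 2 ^ k →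
    ((ltStep^[k] ((m, n), c)).2 = true ↔ m < n ∨ (m = n ∧ c = true)) := by
  induction k with
  | zero =>
    intro m n c hm hn
    obtain rfl : m = 0 := by simpa using hm
    obtain rfl : n = 0 := by simpa using hn
    simp
  | succ k ih =>
    intro m n c hm hn
    have hm' := Nat.bodd_add_div2 m
    have hn' := Nat.bodd_add_div2 n
    rw [Nat.div2_val] at hm' hn'
    rw [pow_succ] at hm hn
    rw [Function.iterate_succ_apply]
    refine (ih (m / 2) (n / 2) _ (by omega) (by omega)).trans ?_
    cases hb : m.bodd <;> cases hb' : n.bodd <;> cases c <;> simp [hb, hb'] at * <;> omega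

theorem lt {m n : α → ℕ} (hm : PolyTime m) (hn : PolyTime n) :
    PolyTime fun a => decide (m a < n a) := by
  have hfuel : PolyTime fun a => (m a).bits ++ (n a).bits := hm.bits.append hn.bits
  have h₁ : PolyTime fun s : (ℕ × ℕ) × Bool => s.1.1 := PolyTime.fst.comp .fst
  have h₂ : PolyTime fun s : (ℕ × ℕ) × Bool => s.1.2 := PolyTime.snd.comp .fst
  have hstep : PolyTime ltStep :=
    (h₁.half.pair h₂.half).pair (ite (h₁.bodd.xor h₂.bodd) h₂.bodd .snd)
  have h := foldl (l := fun a => (m a).bits ++ (n a).bits)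
    (b := fun a => ((m a, n a), false)) (f := fun _ s _ => ltStep s)
    hfuel ((hm.pair hn).pair (const _)) (hstep.comp (PolyTime.fst.comp .snd))
    (fun a => (4 * treeSize (m a) + 1) + (4 * treeSize (n a) + 1) + 5)
    ((((((PolyBound.const 4).mul hm.size_le).add (.const _)).add
      (((PolyBound.const 4).mul hn.size_le).add (.const _))).add (.const _)))
    (fun a l₁ l₂ hl => by
      rw [List.foldl_const_eq_iterate]
      have key : ∀ k, (ltStep^[k] ((m a, n a), false)).1.1 ≤ m a ∧
          (ltStep^[k] ((m a, n a), false)).1.2 ≤ n a := by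
        intro k
        induction k with
        | zero => simp
        | succ k ih =>
          rw [Function.iterate_succ_apply']
          exact ⟨(Nat.div_le_self _ _).trans ih.1, (Nat.div_le_self _ _).trans ih.2⟩
      obtain ⟨h₁, h₂⟩ := key l₁.length
      have h₆ := treeSize_bool_le (ltStep^[l₁.length] ((m a, n a), false)).2
      have h₇ := treeSize_nat_mono_bound h₁
      have h₈ := treeSize_nat_mono_bound h₂
      rw [treeSize_prod, treeSize_prod]
      omega)
  have e : ∀ m n : ℕ, ((m.bits ++ n.bits).foldl (fun s _ => ltStep s) ((m, n), false)).2 =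
      decide (m < n) := by
    intro m n
    rw [List.foldl_const_eq_iterate, Bool.eq_iff_iff, iterate_ltStep]
    · simp
    · refine (Nat.lt_size_self m).trans_le (Nat.pow_le_pow_right (by norm_num) ?_)
      rw [← Nat.size_eq_bits_len]; simp
    · refine (Nat.lt_size_self n).trans_le (Nat.pow_le_pow_right (by norm_num) ?_)
      rw [← Nat.size_eq_bits_len]; simp
  simpa only [e] using PolyTime.snd.comp h

theorem eq {m n : α → ℕ} (hm : PolyTime m) (hn : PolyTime n) :
    PolyTime fun a => decide (m a = n a) := by
  have h := (hm.lt hn).not.and (hn.lt hm).not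
  have e : (fun a => decide (m a = n a)) = fun a => !decide (m a < n a) && !decide (n a < m a) := by
    funext a
    rw [Bool.eq_iff_iff]
    simp only [decide_eq_true_eq, Bool.and_eq_true, Bool.not_eq_true', decide_eq_false_iff_not]
    omega
  rwa [e]

theorem mul {m n : α → ℕ} (hm : PolyTime m) (hn : PolyTime n) : PolyTime fun a => m a * n a := by
  have e : ∀ (n : ℕ) (l : List Bool),
      l.foldr (fun b c => (if b = true then n else 0) + (c + c)) 0 = _root_.natOfBits l * n := by
    intro n l
    induction l with
    | nil => simp [_root_.natOfBits]
    | cons b l ih =>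
      rw [List.foldr_cons, ih]
      change _ = Nat.bit b (_root_.natOfBits l) * n
      rw [Nat.bit_val]
      cases b <;> simp <;> ring
  have h : PolyTime fun a => (m a).bits.reverse.foldl
      (fun c b => (if b = true then n a else 0) + (c + c)) 0 := by
    refine foldl (f := fun a c b => (if b = true then n a else 0) + (c + c)) hm.bits.reverse
      (const 0) (add (ite (PolyTime.snd.comp .snd) (hn.comp .fst) (const 0))
      (add (PolyTime.fst.comp .snd) (PolyTime.fst.comp .snd)))
      (fun a => 4 * (treeSize (m a) + treeSize (n a)) + 1)
      (((PolyBound.const 4).mul (hm.size_le.add hn.size_le)).add (.const 1)) fun a l₁ l₂ h => ?_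
    -- Every intermediate value of the double-and-add scheme is `n a` times the number formed by the
    -- leading bits read so far.
    rw [← List.reverse_reverse l₁, List.foldl_reverse, e]
    have h₂ := length_lt_treeSize (m a).bits.reverse
    rw [treeSize_reverse, ← treeSize_nat_eq, h] at h₂
    refine treeSize_nat_le ?_
    rw [pow_add]
    refine Nat.mul_lt_mul'' ((natOfBits_lt _).trans_le (Nat.pow_le_pow_right (by norm_num) ?_))
      (lt_two_pow_treeSize _)
    simp at h₂ ⊢; omega
  simpa only [List.foldl_reverse, e, natOfBits_bits] using h

/-! ### Indexing -/

theorem length {l : α → List β} (hl : PolyTime l) : PolyTime fun a => (l a).length := by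
  have e : ∀ l : List β, l.foldl (fun n _ => n + 1) 0 = l.length := by
    intro l
    induction l using List.reverseRecOn with
    | nil => rfl
    | append_singleton l x ih => simp [ih]
  have h : PolyTime fun a => (l a).foldl (fun n _ => n + 1) 0 :=
    foldl hl (const 0) (add (PolyTime.fst.comp .snd) (const 1)) (fun a => 4 * treeSize (l a) + 1)
      (((PolyBound.const 4).mul hl.size_le).add (.const 1)) fun a l₁ l₂ h => by
        have h₁ := length_lt_treeSize (l a)
        rw [h, List.length_append] at h₁
        have h₂ := treeSize_nat_le_self l₁.length
        rw [h, e]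
        omega
  simpa only [e] using h

/-- `List.range n` is exponentially long in the binary length of `n`, so ranges are only generated
up to the length of a list already present. -/
theorem range_length {l : α → List β} (hl : PolyTime l) :
    PolyTime fun a => List.range (l a).length := by
  have e : ∀ l : List β, l.foldl (fun c _ => c ++ [c.length]) [] = List.range l.length := by
    intro l
    induction l using List.reverseRecOn with
    | nil => rfl
    | append_singleton l x ih => simp [ih, List.range_succ]
  have h : PolyTime fun a => (l a).foldl (fun c _ => c ++ [c.length]) [] := by
    refine foldl hl (const []) (append (PolyTime.fst.comp .snd)
      ((length (PolyTime.fst.comp .snd)).cons (const [])))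
      (fun a => treeSize (l a) * (4 * treeSize (l a) + 1 + 1) + 1)
      ((hl.size_le.mul ((((PolyBound.const 4).mul hl.size_le).add (.const 1)).add (.const 1))).add
        (.const 1)) fun a l₁ l₂ h => ?_
    rw [e]
    have h₁ := length_lt_treeSize (l a)
    have h₂ : l₁.length ≤ treeSize (l a) := by rw [h, List.length_append] at h₁; rw [h]; omega
    refine (treeSize_list_le (B := 4 * treeSize (l a) + 1) fun i hi => ?_).trans ?_
    · have := treeSize_nat_le_self i
      have := List.mem_range.1 hi
      omega
    · rw [List.length_range]; gcongr
  simpa only [e] using h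

theorem getD {l : α → List β} {i : α → ℕ} {d : α → β} (hl : PolyTime l) (hi : PolyTime i)
    (hd : PolyTime d) : PolyTime fun a => (l a).getD (i a) (d a) := by
  have e : ∀ (i : ℕ) (l : List β) (d : β),
      l.foldl (fun s x => (s.1 + 1, if decide (s.1 = i) = true then x else s.2)) (0, d) =
        (l.length, l.getD i d) := by
    intro i l d
    induction l using List.reverseRecOn with
    | nil => simp
    | append_singleton l x ih =>
      rw [List.foldl_append, ih]
      simp only [List.foldl_cons, List.foldl_nil, List.length_append, List.length_singleton,
        decide_eq_true_eq, Prod.mk.injEq, true_and]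
      rcases lt_trichotomy l.length i with h | h | h
      · rw [if_neg h.ne, List.getD_eq_default _ _ h.le, List.getD_eq_default _ _ (by simp; omega)]
      · subst h; simp [List.getD_eq_getElem?_getD]
      · rw [if_neg h.ne', List.getD_append _ _ _ _ h]
  have h : PolyTime fun a => (l a).foldl
      (fun s x => (s.1 + 1, if decide (s.1 = i a) = true then x else s.2)) (0, d a) := by
    refine foldl (f := fun a s x => (s.1 + 1, if decide (s.1 = i a) = true then x else s.2)) hl
      ((const 0).pair hd) ?_
      (fun a => 4 * treeSize (l a) + 1 + (treeSize (l a) + treeSize (d a)) + 1)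
      (((((PolyBound.const 4).mul hl.size_le).add (.const 1)).add (hl.size_le.add hd.size_le)).add
        (.const 1)) fun a l₁ l₂ h => ?_
    · have h₁ : PolyTime fun x : α × (ℕ × β) × β => x.2.1.1 :=
        PolyTime.fst.comp (PolyTime.fst.comp .snd)
      exact (h₁.add (const 1)).pair (ite (h₁.eq (hi.comp .fst)) (PolyTime.snd.comp .snd)
        (PolyTime.snd.comp (PolyTime.fst.comp .snd)))
    · rw [e, treeSize_prod]
      have h₁ := length_lt_treeSize (l a)
      have h₂ : l₁.length ≤ treeSize (l a) := by rw [h, List.length_append] at h₁; rw [h]; omega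
      have h₃ := treeSize_nat_le_self l₁.length
      have h₄ : treeSize (l₁.getD (i a) (d a)) ≤ treeSize (l a) + treeSize (d a) := by
        by_cases hlt : i a < l₁.length
        · rw [List.getD_eq_getElem _ _ hlt]
          have := treeSize_le_of_mem (l := l a) (a := l₁[i a]) (by simp [h])
          omega
        · rw [List.getD_eq_default _ _ (by omega)]; omega
      simp only; omega
  simpa only [e] using PolyTime.snd.comp h

theorem drop {l : α → List β} {n : α → ℕ} (hl : PolyTime l) (hn : PolyTime n) :
    PolyTime fun a => (l a).drop (n a) := by
  have e : ∀ (n : ℕ) (l' : List β) (l : List β), l.foldl (fun s _ =>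
      if decide (s.1 < n) = true then (s.1 + 1, s.2.tail) else s) (0, l') =
        (min l.length n, l'.drop (min l.length n)) := by
    intro n l' l
    induction l using List.reverseRecOn with
    | nil => simp
    | append_singleton l x ih =>
      rw [List.foldl_append, ih]
      simp only [List.foldl_cons, List.foldl_nil, List.length_append, List.length_singleton,
        decide_eq_true_eq, List.tail_drop]
      split_ifs with h
      · have : min l.length n + 1 = min (l.length + 1) n := by omega
        rw [this]
      · have : min l.length n = min (l.length + 1) n := by omega
        rw [this]
  have h : PolyTime fun a => (l a).foldl (fun s _ =>
      if decide (s.1 < n a) = true then (s.1 + 1, s.2.tail) else s) (0, l a) := by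
    refine foldl (l := l) (b := fun a => (0, l a)) (f := fun a (s : ℕ × List β) (_ : β) =>
      if decide (s.1 < n a) = true then (s.1 + 1, s.2.tail) else s) hl ((const 0).pair hl) ?_
      (fun a => 4 * treeSize (l a) + 1 + treeSize (l a) + 1)
      (((((PolyBound.const 4).mul hl.size_le).add (.const 1)).add hl.size_le).add
        (.const 1)) fun a l₁ l₂ h => ?_
    · have h₁ : PolyTime fun x : α × (ℕ × List β) × β => x.2.1.1 :=
        PolyTime.fst.comp (PolyTime.fst.comp .snd)
      have h₂ : PolyTime fun x : α × (ℕ × List β) × β => x.2.1.2 :=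
        PolyTime.snd.comp (PolyTime.fst.comp .snd)
      have h₃ : PolyTime fun x : α × (ℕ × List β) × β => x.2.1 := PolyTime.fst.comp .snd
      have h₄ : PolyTime fun x : α × (ℕ × List β) × β => decide (x.2.1.1 < n x.1) :=
        h₁.lt (hn.comp .fst)
      have h₅ : PolyTime fun x : α × (ℕ × List β) × β => (x.2.1.1 + 1, x.2.1.2.tail) :=
        (h₁.add (const 1)).pair (tail h₂)
      exact ite h₄ h₅ h₃
    · rw [e, treeSize_prod]
      have h₁ := length_lt_treeSize (l a)
      have h₂ : l₁.length ≤ treeSize (l a) := by rw [h, List.length_append] at h₁; rw [h]; omega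
      have h₃ := treeSize_nat_le_self (min l₁.length (n a))
      have h₄ := treeSize_sublist (List.drop_sublist (min l₁.length (n a)) (l a))
      simp only; omega
  have h' := PolyTime.snd.comp h
  simp only [e] at h'
  have e' : ∀ a, (l a).drop (min (l a).length (n a)) = (l a).drop (n a) := by
    intro a
    rcases le_total (l a).length (n a) with h | h
    · rw [min_eq_left h, List.drop_length, List.drop_eq_nil_of_le h]
    · rw [min_eq_right h]
  simpa only [e'] using h'

end PolyTime

/-! ### Reading the input word and writing the output word -/

/-- The bit of a symbol, if it is one. -/
def symbolBit : Γ' → Option Bool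
  | .bit b => some b
  | _ => none

/-- The symbol of an optional bit, with a comma for a missing bit. -/
def bitSymbol : Option Bool → Γ'
  | some b => .bit b
  | none => .comma

namespace StackProg

/-- Converts the input word on stack `1` to the code of a list on stack `0`. -/
def readInput : StackProg :=
  seq (moveAll 1 2) (seq (push 0 (.bit false)) (loop 2 Option.isSome
    (seq (ite 2 (fun o => o = some (.bit true))
      (pushWord (.bit true :: treeWord (some true)))
      (ite 2 (fun o => o = some (.bit false))
        (pushWord (.bit true :: treeWord (some false)))
        (pushWord (.bit true :: treeWord (none : Option Bool))))) (pop 2))))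

/-- Transferring the word to stack `2` reverses it, so the list grows from its last symbol. Each new
cell is prefixed by a node symbol and the code of its head. -/
theorem runLE_readInput (w : List Γ') :
    RunLE readInput ![[], w, [], []] ![treeWord (w.map symbolBit), [], [], []]
      (14 * w.length + 3) := by
  have key : ∀ (u : List Γ') (l : List (Option Bool)), RunLE (loop 2 Option.isSome
      (seq (ite 2 (fun o => o = some (.bit true))
      (pushWord (.bit true :: treeWord (some true)))
      (ite 2 (fun o => o = some (.bit false))
        (pushWord (.bit true :: treeWord (some false)))
        (pushWord (.bit true :: treeWord (none : Option Bool))))) (pop 2)))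
      ![treeWord l, [], u, []] ![treeWord ((u.map symbolBit).reverse ++ l), [], [], []]
      (12 * u.length + 1) := by
    intro u
    induction u with
    | nil => intro l; exact RunLE.loop_done (by simp)
    | cons x u ih =>
      intro l
      have h₁ : ∀ o : Option Bool, RunLE (pushWord (.bit true :: treeWord o))
          ![treeWord l, [], x :: u, []] ![treeWord (o :: l), [], x :: u, []] 7 := by
        intro o
        have h : treeWord (o :: l) = (.bit true :: treeWord o) ++ treeWord l := by
          simp [treeWord, tree, listTree, DataTree.code]
        rw [h]
        refine (runLE_pushWord _ _ _ _ _).mono ?_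
        rcases o with _ | _ | _ <;> decide
      have h₂ : RunLE (pop 2) ![treeWord (symbolBit x :: l), [], x :: u, []]
        ![treeWord (symbolBit x :: l), [], u, []] 1 := RunLE.pop (by simp)
      have h₃ := ih (symbolBit x :: l)
      refine RunLE.mono (T := 9 + 1 + (12 * u.length + 1) + 1) ?_ (by simp; omega)
      simp only [List.map_cons, List.reverse_cons, List.append_assoc, List.singleton_append]
      refine RunLE.loop_step (by simp) (RunLE.seq ?_ h₂) h₃
      rcases x with _ | b | _ | _ | _
      case bit =>
        cases b
        · exact RunLE.mono (T := 9) (RunLE.ite_false rfl (RunLE.ite_true rfl (h₁ _))) (by omega)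
        · exact RunLE.mono (T := 8) (RunLE.ite_true rfl (h₁ _)) (by omega)
      all_goals exact RunLE.ite_false rfl (RunLE.ite_false rfl (h₁ _))
  have h₁ : RunLE (moveAll 1 2) ![[], w, [], []] ![[], [], w.reverse, []] (2 * w.length + 1) :=
    runLE_moveAll (by decide) rfl (by simp)
  have h₂ : RunLE (push 0 (.bit false)) ![[], [], w.reverse, []]
    ![treeWord ([] : List (Option Bool)), [], w.reverse, []] 1 := RunLE.push (by
      simp [treeWord, tree, listTree, DataTree.code])
  have h₃ := key w.reverse []
  simp only [List.map_reverse, List.reverse_reverse, List.append_nil] at h₃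
  exact (h₁.seq (h₂.seq h₃)).mono (by simp; omega)

/-- Converts the code of a list on stack `0` to the output word on stack `2`. -/
def writeOutput : StackProg :=
  seq (loop 0 isNode (seq (pop 0) (ite 0 isNode
    (seq (pop 0) (seq (pop 0) (ite 0 isNode
      (seq (pop 0) (seq (pop 0) (seq (pop 0) (push 1 (.bit true)))))
      (seq (pop 0) (push 1 (.bit false))))))
    (seq (pop 0) (push 1 .comma))))) (seq (pop 0) (moveAll 1 2))

/-- With `1` for nodes and `0` for leaves, the codes of `none`, `some false` and `some true` are
`0`, `100` and `10100`. The nested tests tell them apart while consuming them. -/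
theorem runLE_writeOutput (l : List (Option Bool)) :
    RunLE writeOutput ![treeWord l, [], [], []] ![[], [], l.map bitSymbol, []]
      (12 * l.length + 3) := by
  have key : ∀ (l : List (Option Bool)) (u : List Γ'), RunLE (loop 0 isNode (seq (pop 0)
      (ite 0 isNode (seq (pop 0) (seq (pop 0) (ite 0 isNode
      (seq (pop 0) (seq (pop 0) (seq (pop 0) (push 1 (.bit true)))))
      (seq (pop 0) (push 1 (.bit false))))))
      (seq (pop 0) (push 1 .comma)))))
      ![treeWord l, u, [], []] ![[.bit false], (l.map bitSymbol).reverse ++ u, [], []]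
      (10 * l.length + 1) := by
    intro l
    induction l with
    | nil => intro u; exact RunLE.loop_done rfl
    | cons x l ih =>
      intro u
      have h₃ := ih (bitSymbol x :: u)
      refine RunLE.mono (T := 9 + (10 * l.length + 1) + 1) ?_ (by simp; omega)
      simp only [List.map_cons, List.reverse_cons, List.append_assoc, List.singleton_append]
      refine RunLE.loop_step rfl ?_ h₃
      rcases x with _ | _ | _
      · exact RunLE.mono (T := 1 + (1 + 1 + 1)) (RunLE.seq (RunLE.pop rfl) (RunLE.ite_false rfl
          (RunLE.seq (RunLE.pop rfl) (RunLE.push (by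
            simp [treeWord, tree, listTree, optionTree, DataTree.code, bitSymbol]))))) (by omega)
      · exact RunLE.mono (T := 1 + ((1 + (1 + ((1 + 1) + 1))) + 1)) (RunLE.seq (RunLE.pop rfl)
          (RunLE.ite_true rfl
          (RunLE.seq (RunLE.pop rfl) (RunLE.seq (RunLE.pop rfl) (RunLE.ite_false rfl
          (RunLE.seq (RunLE.pop rfl) (RunLE.push (by
            simp [treeWord, tree, listTree, optionTree, DataTree.code, bitSymbol])))))))) (by omega)
      · exact RunLE.mono (T := 1 + ((1 + (1 + ((1 + (1 + (1 + 1))) + 1))) + 1))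
          (RunLE.seq (RunLE.pop rfl) (RunLE.ite_true rfl
          (RunLE.seq (RunLE.pop rfl) (RunLE.seq (RunLE.pop rfl) (RunLE.ite_true rfl
          (RunLE.seq (RunLE.pop rfl) (RunLE.seq (RunLE.pop rfl) (RunLE.seq (RunLE.pop rfl)
          (RunLE.push (by
            simp [treeWord, tree, listTree, optionTree, DataTree.code, bitSymbol]))))))))))
          (by omega)
  have h₁ := key l []
  have h₂ : RunLE (pop 0) ![[.bit false], (l.map bitSymbol).reverse ++ [], [], []]
    ![[], (l.map bitSymbol).reverse, [], []] 1 := RunLE.pop (by simp)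
  have h₃ : RunLE (moveAll 1 2) ![[], (l.map bitSymbol).reverse, [], []]
    ![[], [], l.map bitSymbol, []] (2 * (l.map bitSymbol).reverse.length + 1) :=
    runLE_moveAll (by decide) rfl (by simp)
  exact (h₁.seq (h₂.seq h₃)).mono (by simp; omega)

end StackProg

/-! ### The local search on raw data -/

/-- The data of a game as read from the input: the number of vertices, the list of the vertices,
the bits of the adjacency matrix, and the bits of the numerators and denominators of the weights,
followed by those of `ε`. -/
abbrev RawGame : Type := (ℕ × List ℕ) × (List Bool × List (List Bool))

namespace RawGame

/-- Whether `j` is in the shopping range of `i`. -/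
def adj (E : RawGame) (i j : ℕ) : Bool := decide (i = j) || E.2.1.getD (i * E.1.1 + j) false

/-- The numerator of the weight of client `i`. -/
def num (E : RawGame) (i : ℕ) : ℕ := natOfBits (E.2.2.getD (i + i) [])

/-- The denominator of the weight of client `i`. -/
def den (E : RawGame) (i : ℕ) : ℕ := natOfBits (E.2.2.getD (i + i + 1) [])

/-- The number of facilities in the shopping range of client `i`. -/
def count (E : RawGame) (s : List ℕ) (i : ℕ) : ℕ := (s.filter fun v => E.adj i v).length

/-- The sum of two fractions. -/
def addFrac (x y : ℕ × ℕ) : ℕ × ℕ := (x.1 * y.2 + y.1 * x.2, x.2 * y.2)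

/-- The comparison of two fractions. -/
def ltFrac (x y : ℕ × ℕ) : Bool := decide (x.1 * y.2 < y.1 * x.2)

/-- The share of the weight of client `i` that a facility attracts which joins the facilities `s`,
when the clients split their weight uniformly. -/
def share (E : RawGame) (s : List ℕ) (i : ℕ) : ℕ × ℕ := (E.num i, E.den i * (E.count s i + 1))

/-- The load of a facility at `v` which joins the facilities `s`, when the clients split their
weight uniformly. -/
def gain (E : RawGame) (s : List ℕ) (v : ℕ) : ℕ × ℕ :=
  E.1.2.foldl (fun x i => if E.adj i v = true then addFrac x (E.share s i) else x) (0, 1)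

/-- A best location for a facility which joins the facilities `s`, where `m` is the first
candidate. -/
def best (E : RawGame) (s : List ℕ) (m : ℕ) : ℕ :=
  E.1.2.foldl (fun b v => if ltFrac (E.gain s b) (E.gain s v) = true then v else b) m

/-- Whether moving from `m` to `b` increases the load by more than the factor `1 + 2ε/3`. -/
def improves (E : RawGame) (s : List ℕ) (m b : ℕ) : Bool :=
  -- The fraction at index `E.1.1`, right after those of the clients, is `ε`. The inequality is
  -- cross-multiplied to stay within natural numbers.
  decide ((3 * E.den E.1.1 + 2 * E.num E.1.1) * ((E.gain s m).1 * (E.gain s b).2) <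
    3 * E.den E.1.1 * ((E.gain s b).1 * (E.gain s m).2))

/-- One step of the local search: the first facility of the first list is moved if this is a
sufficient improvement, and then all facilities are to be checked again; otherwise it is moved to
the second list, which holds the facilities that have been checked. -/
def step (t : List ℕ × (List ℕ × RawGame)) : List ℕ × (List ℕ × RawGame) :=
  if t.1.isEmpty = true then t
  else if t.2.2.improves (t.2.1 ++ t.1.tail) (t.1.headD 0)
      (t.2.2.best (t.2.1 ++ t.1.tail) (t.1.headD 0)) = true
    then (t.2.2.best (t.2.1 ++ t.1.tail) (t.1.headD 0) :: (t.2.1 ++ t.1.tail), ([], t.2.2))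
    else (t.1.tail, (t.1.headD 0 :: t.2.1, t.2.2))

/-- The blocks of bits of an input word. -/
def tokens (w : List (Option Bool)) : List (List Bool) :=
  (w.foldl (fun s x => if x.isSome = true then (x.getD false :: s.1, s.2)
    else ([], s.1.reverse :: s.2)) (([], []) : List Bool × List (List Bool))).2.reverse

/-- The data of the game from the blocks of bits of the input word. -/
def ofTokens (T : List (List Bool)) (l : List ℕ) : RawGame :=
  ((natOfBits (T.getD 0 []), l.filter fun i => decide (i < natOfBits (T.getD 0 []))),
    -- The matrix has no closing separator, so the third block also contains the first number of the
    -- fraction list, which is recovered by dropping `n²` bits. The surplus bits behind the matrix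
    -- are harmless, because vertices only address positions below `n²`.
    (T.getD 2 [], (T.getD 2 []).drop (natOfBits (T.getD 0 []) * natOfBits (T.getD 0 [])) ::
      T.drop 3))

/-- The initial state of the local search. -/
def init (w : List (Option Bool)) : List ℕ × (List ℕ × RawGame) :=
  (((tokens w).getD 1 []).map (fun _ => 0), ([], ofTokens (tokens w) (List.range w.length)))

/-- The output of the local search. -/
def output (t : List ℕ × (List ℕ × RawGame)) : List (Option Bool) :=
  t.2.1.flatMap fun v => v.bits.map some ++ [none]

end RawGame

/-! ### The local search step is computable in polynomial time -/

namespace PolyTime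
variable {α β γ δ : Type} [TreeCode α] [TreeCode β] [TreeCode γ] [TreeCode δ]
  {E : α → RawGame} {i j v : α → ℕ} {s : α → List ℕ} {x y : α → ℕ × ℕ}

theorem gameAdj (hE : PolyTime E) (hi : PolyTime i) (hj : PolyTime j) :
    PolyTime fun a => (E a).adj (i a) (j a) :=
  (hi.eq hj).or (getD (PolyTime.fst.comp (PolyTime.snd.comp hE))
    ((hi.mul (PolyTime.fst.comp (PolyTime.fst.comp hE))).add hj) (const false))

theorem gameNum (hE : PolyTime E) (hi : PolyTime i) : PolyTime fun a => (E a).num (i a) :=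
  natOfBits (getD (PolyTime.snd.comp (PolyTime.snd.comp hE)) (hi.add hi) (const []))

theorem gameDen (hE : PolyTime E) (hi : PolyTime i) : PolyTime fun a => (E a).den (i a) :=
  natOfBits (getD (PolyTime.snd.comp (PolyTime.snd.comp hE)) ((hi.add hi).add (const 1)) (const []))

theorem gameCount (hE : PolyTime E) (hs : PolyTime s) (hi : PolyTime i) :
    PolyTime fun a => (E a).count (s a) (i a) :=
  length (filter (f := fun a v => (E a).adj (i a) v) hs
    (gameAdj (hE.comp .fst) (hi.comp .fst) .snd))

theorem addFrac (hx : PolyTime x) (hy : PolyTime y) :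
    PolyTime fun a => RawGame.addFrac (x a) (y a) :=
  (((PolyTime.fst.comp hx).mul (PolyTime.snd.comp hy)).add
    ((PolyTime.fst.comp hy).mul (PolyTime.snd.comp hx))).pair
    ((PolyTime.snd.comp hx).mul (PolyTime.snd.comp hy))

theorem ltFrac (hx : PolyTime x) (hy : PolyTime y) :
    PolyTime fun a => RawGame.ltFrac (x a) (y a) :=
  ((PolyTime.fst.comp hx).mul (PolyTime.snd.comp hy)).lt
    ((PolyTime.fst.comp hy).mul (PolyTime.snd.comp hx))

theorem gameShare (hE : PolyTime E) (hs : PolyTime s) (hi : PolyTime i) :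
    PolyTime fun a => (E a).share (s a) (i a) :=
  (gameNum hE hi).pair ((gameDen hE hi).mul ((gameCount hE hs hi).add (const 1)))

theorem natOfBits_getD_lt (E : RawGame) (i : ℕ) :
    _root_.natOfBits (E.2.2.getD i []) < 2 ^ treeSize E := by
  refine (natOfBits_lt _).trans_le (Nat.pow_le_pow_right (by norm_num) ?_)
  by_cases h : i < E.2.2.length
  · rw [List.getD_eq_getElem _ _ h]
    have h₁ := treeSize_le_of_mem (List.getElem_mem h)
    have h₂ := length_lt_treeSize (E.2.2[i])
    rw [treeSize_prod E, treeSize_prod E.2]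
    omega
  · rw [List.getD_eq_default _ _ (by omega)]; simp

theorem share_lt (E : RawGame) (s : List ℕ) (i : ℕ) :
    (E.share s i).1 < 2 ^ (treeSize E + treeSize s) ∧
      (E.share s i).2 < 2 ^ (treeSize E + treeSize s) := by
  have h₁ : E.num i < 2 ^ treeSize E := natOfBits_getD_lt E _
  have h₂ : E.den i < 2 ^ treeSize E := natOfBits_getD_lt E _
  have h₃ : E.count s i + 1 < 2 ^ treeSize s := by
    have := length_lt_treeSize s
    have : E.count s i ≤ s.length := List.length_filter_le _ _
    exact lt_of_le_of_lt (by omega) (treeSize s).lt_two_pow_self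
  rw [pow_add]
  exact ⟨lt_of_lt_of_le h₁ (Nat.le_mul_of_pos_right _ (by positivity)),
    Nat.mul_lt_mul'' h₂ h₃⟩

/-- Fractions are never reduced, yet an addition at most adds the bit lengths, plus one. A sum over
the clients thus keeps polynomial bit length. -/
theorem addFrac_lt {x y : ℕ × ℕ} {a b : ℕ} (hx : x.1 < 2 ^ a ∧ x.2 < 2 ^ a)
    (hy : y.1 < 2 ^ b ∧ y.2 < 2 ^ b) :
    (RawGame.addFrac x y).1 < 2 ^ (a + (b + 1)) ∧ (RawGame.addFrac x y).2 < 2 ^ (a + (b + 1)) := by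
  have h₁ := Nat.mul_lt_mul'' hx.1 hy.2
  have h₂ := Nat.mul_lt_mul'' hx.2 hy.1
  have h₃ := Nat.mul_lt_mul'' hx.2 hy.2
  rw [← add_assoc, pow_succ, pow_add]
  rw [mul_comm x.2 y.1] at h₂
  constructor <;> simp only [RawGame.addFrac] <;> omega

theorem gameGain (hE : PolyTime E) (hs : PolyTime s) (hv : PolyTime v) :
    PolyTime fun a => (E a).gain (s a) (v a) := by
  have hl : PolyTime fun a => (E a).1.2 := PolyTime.snd.comp (PolyTime.fst.comp hE)
  have hi : PolyTime fun x : α × (ℕ × ℕ) × ℕ => x.2.2 := PolyTime.snd.comp .snd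
  have hx : PolyTime fun x : α × (ℕ × ℕ) × ℕ => x.2.1 := PolyTime.fst.comp .snd
  have hf : PolyTime fun x : α × (ℕ × ℕ) × ℕ => if (E x.1).adj x.2.2 (v x.1) = true then
      RawGame.addFrac x.2.1 ((E x.1).share (s x.1) x.2.2) else x.2.1 :=
    ite (gameAdj (hE.comp .fst) hi (hv.comp .fst))
      (addFrac hx (gameShare (hE.comp .fst) (hs.comp .fst) hi)) hx
  refine foldl (l := fun a => (E a).1.2) (b := fun _ => (0, 1))
    (f := fun a (x : ℕ × ℕ) (i : ℕ) => if (E a).adj i (v a) = true then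
      RawGame.addFrac x ((E a).share (s a) i) else x) hl (const _) hf
    (fun a => 8 * (1 + treeSize (E a).1.2 * (treeSize (E a) + treeSize (s a) + 1)) + 3)
    (((PolyBound.const 8).mul ((PolyBound.const 1).add (hl.size_le.mul
      ((hE.size_le.add hs.size_le).add (.const 1))))).add (.const 3)) fun a l₁ l₂ h => ?_
  have key : ∀ (l : List ℕ) (x : ℕ × ℕ) (k : ℕ), x.1 < 2 ^ k ∧ x.2 < 2 ^ k →
      (l.foldl (fun x i => if (E a).adj i (v a) = true then
        RawGame.addFrac x ((E a).share (s a) i) else x) x).1 <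
          2 ^ (k + l.length * (treeSize (E a) + treeSize (s a) + 1)) ∧
      (l.foldl (fun x i => if (E a).adj i (v a) = true then
        RawGame.addFrac x ((E a).share (s a) i) else x) x).2 <
          2 ^ (k + l.length * (treeSize (E a) + treeSize (s a) + 1)) := by
    intro l
    induction l with
    | nil => intro x k hx; simpa using hx
    | cons i l ih =>
      intro x k hx
      have h₁ := addFrac_lt hx (share_lt (E a) (s a) i)
      have h₂ := ih (if (E a).adj i (v a) = true then
        RawGame.addFrac x ((E a).share (s a) i) else x)
        (k + (treeSize (E a) + treeSize (s a) + 1)) (by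
          split_ifs
          · exact h₁
          · have : 2 ^ k ≤ 2 ^ (k + (treeSize (E a) + treeSize (s a) + 1)) :=
              Nat.pow_le_pow_right (by norm_num) (by omega)
            exact ⟨hx.1.trans_le this, hx.2.trans_le this⟩)
      rw [List.length_cons, Nat.succ_mul, List.foldl_cons,
        add_comm (l.length * _) (_ + _ + _), ← add_assoc k]
      exact h₂
  obtain ⟨h₁, h₂⟩ := key l₁ (0, 1) 1 (by norm_num)
  have h₃ := length_lt_treeSize (E a).1.2
  have h₄ : l₁.length ≤ treeSize (E a).1.2 := by rw [h, List.length_append] at h₃; rw [h]; omega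
  have h₅ := Nat.mul_le_mul_right (treeSize (E a) + treeSize (s a) + 1) h₄
  rw [treeSize_prod]
  have h₆ := treeSize_nat_le h₁
  have h₇ := treeSize_nat_le h₂
  omega

theorem gameBest {m : α → ℕ} (hE : PolyTime E) (hs : PolyTime s) (hm : PolyTime m) :
    PolyTime fun a => (E a).best (s a) (m a) := by
  have hl : PolyTime fun a => (E a).1.2 := PolyTime.snd.comp (PolyTime.fst.comp hE)
  have hv : PolyTime fun x : α × ℕ × ℕ => x.2.2 := PolyTime.snd.comp .snd
  have hb : PolyTime fun x : α × ℕ × ℕ => x.2.1 := PolyTime.fst.comp .snd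
  have hf : PolyTime fun x : α × ℕ × ℕ => if RawGame.ltFrac ((E x.1).gain (s x.1) x.2.1)
      ((E x.1).gain (s x.1) x.2.2) = true then x.2.2 else x.2.1 :=
    ite (ltFrac (gameGain (hE.comp .fst) (hs.comp .fst) hb)
      (gameGain (hE.comp .fst) (hs.comp .fst) hv)) hv hb
  refine foldl (l := fun a => (E a).1.2) (b := m)
    (f := fun a (b v : ℕ) => if RawGame.ltFrac ((E a).gain (s a) b)
      ((E a).gain (s a) v) = true then v else b) hl hm hf
    (fun a => treeSize (m a) + treeSize (E a).1.2) (hm.size_le.add hl.size_le) fun a l₁ l₂ h => ?_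
  -- The accumulator is always the first candidate or one of the listed vertices, so it cannot grow.
  have key : ∀ (l : List ℕ) (b : ℕ), (∀ v ∈ l, v ∈ (E a).1.2) →
      treeSize (l.foldl (fun b v => if RawGame.ltFrac ((E a).gain (s a) b)
        ((E a).gain (s a) v) = true then v else b) b) ≤ treeSize b + treeSize (E a).1.2 := by
    intro l
    induction l using List.reverseRecOn with
    | nil => intro b _; simp
    | append_singleton l x ih =>
      intro b hx
      rw [List.foldl_append, List.foldl_cons, List.foldl_nil]
      split_ifs
      · have := treeSize_le_of_mem (hx x (by simp)); omega
      · exact ih b fun v hv => hx v (by simp [hv])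
  exact key l₁ (m a) fun v hv => by simp [h, hv]

theorem gameImproves {m b : α → ℕ} (hE : PolyTime E) (hs : PolyTime s) (hm : PolyTime m)
    (hb : PolyTime b) : PolyTime fun a => (E a).improves (s a) (m a) (b a) := by
  have hn : PolyTime fun a => (E a).1.1 := PolyTime.fst.comp (PolyTime.fst.comp hE)
  have hd := gameDen hE hn
  have hN := gameNum hE hn
  have hgm := gameGain hE hs hm
  have hgb := gameGain hE hs hb
  exact ((((const 3).mul hd).add ((const 2).mul hN)).mul
    ((PolyTime.fst.comp hgm).mul (PolyTime.snd.comp hgb))).lt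
    (((const 3).mul hd).mul ((PolyTime.fst.comp hgb).mul (PolyTime.snd.comp hgm)))

theorem gameStep : PolyTime RawGame.step := by
  have h₁ : PolyTime fun t : List ℕ × (List ℕ × RawGame) => t.1 := .fst
  have h₂ : PolyTime fun t : List ℕ × (List ℕ × RawGame) => t.2.1 := PolyTime.fst.comp .snd
  have h₃ : PolyTime fun t : List ℕ × (List ℕ × RawGame) => t.2.2 := PolyTime.snd.comp .snd
  have hm : PolyTime fun t : List ℕ × (List ℕ × RawGame) => t.1.headD 0 := headD h₁ 0 rfl
  have hr : PolyTime fun t : List ℕ × (List ℕ × RawGame) => t.2.1 ++ t.1.tail :=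
    h₂.append (tail h₁)
  have hb : PolyTime fun t : List ℕ × (List ℕ × RawGame) =>
      t.2.2.best (t.2.1 ++ t.1.tail) (t.1.headD 0) := gameBest h₃ hr hm
  have hi : PolyTime fun t : List ℕ × (List ℕ × RawGame) =>
      t.2.2.improves (t.2.1 ++ t.1.tail) (t.1.headD 0)
        (t.2.2.best (t.2.1 ++ t.1.tail) (t.1.headD 0)) := gameImproves h₃ hr hm hb
  have he : PolyTime fun t : List ℕ × (List ℕ × RawGame) => t.1.isEmpty := isEmpty h₁
  have hy : PolyTime fun t : List ℕ × (List ℕ × RawGame) =>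
      (t.2.2.best (t.2.1 ++ t.1.tail) (t.1.headD 0) :: (t.2.1 ++ t.1.tail), ([] : List ℕ), t.2.2) :=
    (hb.cons hr).pair ((const []).pair h₃)
  have hz : PolyTime fun t : List ℕ × (List ℕ × RawGame) =>
      (t.1.tail, t.1.headD 0 :: t.2.1, t.2.2) := (tail h₁).pair ((hm.cons h₂).pair h₃)
  have hyz := ite hi hy hz
  unfold RawGame.step
  exact ite he .id hyz

theorem gameTokens {w : α → List (Option Bool)} (hw : PolyTime w) :
    PolyTime fun a => RawGame.tokens (w a) := by
  have hx : PolyTime fun x : α × (List Bool × List (List Bool)) × Option Bool => x.2.2 :=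
    PolyTime.snd.comp .snd
  have hc : PolyTime fun x : α × (List Bool × List (List Bool)) × Option Bool => x.2.1.1 :=
    PolyTime.fst.comp (PolyTime.fst.comp .snd)
  have hl : PolyTime fun x : α × (List Bool × List (List Bool)) × Option Bool => x.2.1.2 :=
    PolyTime.snd.comp (PolyTime.fst.comp .snd)
  have h₁ : PolyTime fun o : Option Bool => o.isSome :=
    of_eq_node fun o => by cases o <;> simp [tree, optionTree]
  have h₂ : PolyTime fun o : Option Bool => o.getD false :=
    right fun o => by cases o <;> rfl
  have hf : PolyTime fun x : α × (List Bool × List (List Bool)) × Option Bool =>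
      if x.2.2.isSome = true then (x.2.2.getD false :: x.2.1.1, x.2.1.2)
        else ([], x.2.1.1.reverse :: x.2.1.2) :=
    ite (h₁.comp hx) (((h₂.comp hx).cons hc).pair hl) ((const []).pair (hc.reverse.cons hl))
  refine reverse (PolyTime.snd.comp (foldl_of_growth (l := w)
    (b := fun _ => (([], []) : List Bool × List (List Bool)))
    (f := fun _ (s : List Bool × List (List Bool)) (x : Option Bool) =>
      if x.isSome = true then (x.getD false :: s.1, s.2)
        else ([], s.1.reverse :: s.2)) hw (const _) hf (fun _ => 4) (.const 4) fun a c x _ => ?_))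
  split_ifs
  · rw [treeSize_prod, treeSize_prod, treeSize_cons]
    have := treeSize_bool_le (x.getD false)
    simp only; omega
  · rw [treeSize_prod, treeSize_prod, treeSize_cons, treeSize_nil, treeSize_reverse]
    omega

theorem gameInit : PolyTime RawGame.init := by
  have hT : PolyTime RawGame.tokens := gameTokens .id
  have hr : PolyTime fun w : List (Option Bool) => List.range w.length := range_length .id
  have h₀ : PolyTime fun w => (RawGame.tokens w).getD 0 [] := getD hT (const _) (const _)
  have h₁ : PolyTime fun w => (RawGame.tokens w).getD 1 [] := getD hT (const _) (const _)
  have h₂ : PolyTime fun w => (RawGame.tokens w).getD 2 [] := getD hT (const _) (const _)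
  have hn := natOfBits h₀
  exact (map (f := fun _ _ => 0) h₁ (const 0)).pair ((const []).pair
    ((hn.pair (filter (f := fun w i => decide (i < _root_.natOfBits ((RawGame.tokens w).getD 0 [])))
      hr (lt .snd (hn.comp .fst)))).pair (h₂.pair
      ((drop h₂ (hn.mul hn)).cons (drop hT (const 3))))))

theorem gameOutput : PolyTime RawGame.output := by
  have hs : PolyTime fun x : (List ℕ × (List ℕ × RawGame)) × ℕ => x.2.bits.map Option.some :=
    map (l := fun x : (List ℕ × (List ℕ × RawGame)) × ℕ => x.2.bits)
      (f := fun _ b => Option.some b) (bits .snd) (PolyTime.some .snd)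
  have hc : PolyTime fun x : (List ℕ × (List ℕ × RawGame)) × ℕ =>
      x.2.bits.map Option.some ++ [none] := hs.append (const _)
  have hl : PolyTime fun t : List ℕ × (List ℕ × RawGame) => t.2.1 := PolyTime.fst.comp .snd
  have h : PolyTime fun t : List ℕ × (List ℕ × RawGame) =>
      t.2.1.flatMap fun v => v.bits.map Option.some ++ [none] := by
    refine flatMap (α := List ℕ × (List ℕ × RawGame)) (β := ℕ) (γ := Option Bool)
      (l := fun t => t.2.1) (f := fun _ v => v.bits.map Option.some ++ [none]) hl ?_
    exact hc
  exact h

end PolyTime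

/-! ### Reading a game -/

theorem encodeNat_eq_bits (n : ℕ) : encodeNat n = n.bits := by
  have h : ∀ p : PosNum, encodePosNum p = (p : ℕ).bits ∧ 0 < (p : ℕ) := by
    intro p
    induction p with
    | one => simp [encodePosNum]
    | bit0 p ih =>
      have e : ((PosNum.bit0 p : PosNum) : ℕ) = Nat.bit false (p : ℕ) := by
        rw [Nat.bit_val]; rw [PosNum.cast_bit0]; simp; omega
      rw [e, Nat.bits_append_bit _ _ (fun h => absurd h ih.2.ne')]
      exact ⟨by rw [← ih.1]; rfl, by rw [Nat.bit_val]; simp [ih.2]⟩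
    | bit1 p ih =>
      have e : ((PosNum.bit1 p : PosNum) : ℕ) = Nat.bit true (p : ℕ) := by
        rw [Nat.bit_val]; rw [PosNum.cast_bit1]; simp; omega
      rw [e, Nat.bits_append_bit _ _ (fun h => absurd h ih.2.ne')]
      exact ⟨by rw [← ih.1]; rfl, by rw [Nat.bit_val]; simp⟩
  have h' : ∀ m : Num, encodeNum m = (m : ℕ).bits := by
    intro m
    cases m with
    | zero => simp [encodeNum]
    | pos p => exact (h p).1
  rw [encodeNat, h', Num.to_of_nat]

/-- A block of bits, closed by a separator. -/
def bitBlock (l : List Bool) : List (Option Bool) := l.map some ++ [none]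

theorem map_symbolBit_natCode (m : ℕ) : (FacilityGame.natCode m).map symbolBit = bitBlock m.bits := by
  simp [FacilityGame.natCode, encodingNatΓ', encodeNat_eq_bits, bitBlock, symbolBit,
    inclusionBoolΓ', Function.comp_def]

theorem map_bitSymbol_bitBlock (m : ℕ) :
    (bitBlock m.bits).map bitSymbol = FacilityGame.natCode m := by
  simp [FacilityGame.natCode, encodingNatΓ', encodeNat_eq_bits, bitBlock, bitSymbol,
    Function.comp_def]
  exact ⟨fun _ => rfl, fun _ => rfl⟩

theorem RawGame.tokens_flatMap (T : List (List Bool)) : tokens (T.flatMap bitBlock) = T := by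
  let f : List Bool × List (List Bool) → Option Bool → List Bool × List (List Bool) := fun s x =>
    if x.isSome = true then (x.getD false :: s.1, s.2) else ([], s.1.reverse :: s.2)
  have h₁ : ∀ (l : List Bool) (s : List Bool × List (List Bool)),
      (bitBlock l).foldl f s = ([], (s.1.reverse ++ l) :: s.2) := by
    intro l
    induction l with
    | nil => intro s; simp [bitBlock, f]
    | cons b l ih =>
      intro s
      have := ih (b :: s.1, s.2)
      simp only [bitBlock, List.map_cons, List.cons_append, List.foldl_cons] at this ⊢
      simpa [f] using this
  have h₂ : ∀ (T acc : List (List Bool)),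
      (T.flatMap bitBlock).foldl f ([], acc) = ([], T.reverse ++ acc) := by
    intro T
    induction T with
    | nil => intro acc; rfl
    | cons l T ih => intro acc; simp [h₁, ih]
  have := h₂ T []
  unfold tokens
  rw [this]; simp

theorem List.getElem?_flatMap_pair {α β : Type*} (f g : α → β) (R : List β) :
    ∀ (l : List α) (i : ℕ) (hi : i < l.length),
      (l.flatMap (fun x => [f x, g x]) ++ R)[i + i]? = some (f l[i]) ∧
      (l.flatMap (fun x => [f x, g x]) ++ R)[i + i + 1]? = some (g l[i])
  | [], _, hi => absurd hi (by simp)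
  | x :: l, 0, _ => by simp
  | x :: l, i + 1, hi => by
    have := List.getElem?_flatMap_pair f g R l i (by simpa using hi)
    have e : i + 1 + (i + 1) = i + i + 1 + 1 := by omega
    simpa [e] using this

theorem List.length_flatMap_const {α β : Type*} (f : α → List β) (m : ℕ)
    (hf : ∀ x, (f x).length = m) (l : List α) : (l.flatMap f).length = l.length * m := by
  induction l with
  | nil => simp
  | cons x l ih => simp [ih, hf, Nat.succ_mul, add_comm]

theorem List.getElem?_flatMap_const {α β : Type*} (f : α → List β) (m : ℕ)
    (hf : ∀ x, (f x).length = m) : ∀ (l : List α) (i j : ℕ) (hi : i < l.length), j < m →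
      (l.flatMap f)[i * m + j]? = (f l[i])[j]?
  | [], _, _, hi, _ => absurd hi (by simp)
  | x :: l, 0, j, _, hj => by
    simp [List.getElem?_append_left, hf, hj]
  | x :: l, i + 1, j, hi, hj => by
    have := List.getElem?_flatMap_const f m hf l i j (by simpa using hi) hj
    rw [List.flatMap_cons, List.getElem?_append_right (by rw [hf, Nat.succ_mul]; omega), hf,
      show (i + 1) * m + j - m = i * m + j by rw [Nat.succ_mul]; omega, this]
    rfl

theorem List.filter_lt_range {m n : ℕ} (h : m ≤ n) :
    (List.range n).filter (fun i => decide (i < m)) = List.range m := by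
  obtain ⟨k, rfl⟩ := Nat.exists_eq_add_of_le h
  rw [List.range_add, List.filter_append]
  have h₁ : (List.range m).filter (fun i => decide (i < m)) = List.range m :=
    List.filter_eq_self.2 fun i hi => by simpa using hi
  have h₂ : ((List.range k).map (m + ·)).filter (fun i => decide (i < m)) = [] :=
    List.filter_eq_nil_iff.2 fun i hi => by
      obtain ⟨j, -, rfl⟩ := List.mem_map.1 hi
      simp
  rw [h₁, h₂, List.append_nil]

namespace FacilityGame
variable (G : FacilityGame) (ε : ℚ≥0)

/-- The adjacency matrix, row by row. -/
def matrixBits : List Bool :=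
  (List.finRange G.n).flatMap fun i => (List.finRange G.n).map fun j => decide ((i, j) ∈ G.E)

/-- The numerators and denominators of the weights and of `ε`. -/
def fractionParts : List ℕ :=
  ((List.finRange G.n).flatMap fun i => [(G.w i).num, (G.w i).den]) ++ [ε.num, ε.den]

/-- The raw data of a game, as read from the input word. -/
def raw : RawGame :=
  ((G.n, List.range G.n), (G.matrixBits ++ (G.fractionParts ε).head!.bits,
    (G.fractionParts ε).map Nat.bits))

theorem length_matrixBits : G.matrixBits.length = G.n * G.n := by
  rw [matrixBits, List.length_flatMap_const _ G.n (by simp), List.length_finRange]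

/-- The adjacency matrix alone occupies `n²` symbols. Hence all vertices occur in the range of the
word length from which `RawGame.ofTokens` filters them. -/
theorem n_le_length_inputCode : G.n ≤ (G.inputCode ε).length := by
  have h : (G.matrixBits.map Γ'.bit).length ≤ (G.inputCode ε).length := by
    have : G.matrixBits.map Γ'.bit = (List.finRange G.n).flatMap fun i =>
        (List.finRange G.n).map fun j => Γ'.bit (decide ((i, j) ∈ G.E)) := by
      simp [matrixBits, List.map_flatMap, Function.comp_def]
    rw [inputCode, code, ← this]
    simp only [List.length_append]; omega
  rw [List.length_map, length_matrixBits] at h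
  exact (Nat.le_mul_self _).trans h

theorem exists_fractionParts_eq_cons : ∃ q Q, G.fractionParts ε = q :: Q := by
  cases h : G.fractionParts ε with
  | nil => simp [fractionParts] at h
  | cons q Q => exact ⟨q, Q, rfl⟩

theorem map_symbolBit_inputCode : ∃ q Q, G.fractionParts ε = q :: Q ∧
    (G.inputCode ε).map symbolBit = (G.n.bits :: List.replicate G.k true ::
      (G.matrixBits ++ q.bits) :: Q.map Nat.bits).flatMap bitBlock := by
  obtain ⟨q, Q, h⟩ := G.exists_fractionParts_eq_cons ε
  refine ⟨q, Q, h, ?_⟩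
  have h₁ : (G.inputCode ε).map symbolBit = bitBlock G.n.bits ++
      bitBlock (List.replicate G.k true) ++ (G.matrixBits.map some ++
        (G.fractionParts ε).flatMap fun m => bitBlock m.bits) := by
    have e : ∀ m, List.map symbolBit (natCode m) = bitBlock m.bits := map_symbolBit_natCode
    simp only [inputCode, code, List.map_append, e, List.map_flatMap, fractionParts,
      List.flatMap_append, List.flatMap_assoc, matrixBits, List.flatMap_cons, List.flatMap_nil,
      List.append_nil, List.append_assoc, List.map_map]
    congr 1
    simp [bitBlock, symbolBit, Function.comp_def]
  rw [h₁, h]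
  simp only [List.flatMap_cons, List.flatMap_map, bitBlock, List.map_append, List.append_assoc]

theorem init_inputCode : RawGame.init ((G.inputCode ε).map symbolBit) =
    (List.replicate G.k 0, ([], G.raw ε)) := by
  obtain ⟨q, Q, h, hw⟩ := G.map_symbolBit_inputCode ε
  have hn := G.n_le_length_inputCode ε
  have hl : ((G.inputCode ε).map symbolBit).length = (G.inputCode ε).length := List.length_map _
  unfold RawGame.init
  rw [hl, hw, RawGame.tokens_flatMap]
  simp only [RawGame.ofTokens, List.getD_cons_zero, List.getD_cons_succ, natOfBits_bits,
    List.filter_lt_range hn, raw, h, List.drop_succ_cons, List.drop_zero, List.head!_cons,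
    List.map_cons, List.map_replicate]
  rw [List.drop_left' G.length_matrixBits]

theorem raw_adj (i j : Fin G.n) :
    (G.raw ε).adj i j = decide (j ∈ G.shoppingRange i) := by
  have h : (G.matrixBits ++ (G.fractionParts ε).head!.bits)[(i : ℕ) * G.n + j]? =
      some (decide ((i, j) ∈ G.E)) := by
    have hlt : (i : ℕ) * G.n + j < G.n * G.n := by
      have h₁ := Nat.mul_le_mul_right G.n (Nat.succ_le_of_lt i.2)
      rw [Nat.succ_mul] at h₁
      have := j.2
      omega
    rw [List.getElem?_append_left (by rw [length_matrixBits]; exact hlt), matrixBits,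
      List.getElem?_flatMap_const _ G.n (by simp) _ _ _ (by simp) j.2]
    simp
  simp only [RawGame.adj, raw, List.getD_eq_getElem?_getD, h, Option.getD_some]
  rw [Bool.eq_iff_iff]
  have e : (i : ℕ) = j ↔ j = i := by rw [Fin.val_inj, eq_comm]
  simp [shoppingRange, e]

theorem natOfBits_getD_map_bits (l : List ℕ) (i m : ℕ) (h : l[i]? = some m) :
    natOfBits ((l.map Nat.bits).getD i []) = m := by
  rw [List.getD_eq_getElem?_getD, List.getElem?_map, h, Option.map_some, Option.getD_some,
    natOfBits_bits]

theorem raw_num (i : Fin G.n) : (G.raw ε).num i = (G.w i).num := by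
  refine natOfBits_getD_map_bits _ _ _ ?_
  rw [fractionParts, (List.getElem?_flatMap_pair _ _ _ _ _ (by simp)).1]
  simp

theorem raw_den (i : Fin G.n) : (G.raw ε).den i = (G.w i).den := by
  refine natOfBits_getD_map_bits _ _ _ ?_
  rw [fractionParts, (List.getElem?_flatMap_pair _ _ _ _ _ (by simp)).2]
  simp

theorem length_fractionParts_left :
    ((List.finRange G.n).flatMap fun i => [(G.w i).num, (G.w i).den]).length = G.n + G.n := by
  rw [List.length_flatMap_const _ 2 (by simp), List.length_finRange]; omega

theorem raw_num_n : (G.raw ε).num G.n = ε.num := by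
  refine natOfBits_getD_map_bits _ _ _ ?_
  rw [fractionParts, List.getElem?_append_right (by rw [length_fractionParts_left]),
    length_fractionParts_left]
  simp

theorem raw_den_n : (G.raw ε).den G.n = ε.den := by
  refine natOfBits_getD_map_bits _ _ _ ?_
  rw [fractionParts, List.getElem?_append_right (by rw [length_fractionParts_left]; omega),
    length_fractionParts_left]
  simp

theorem map_bitSymbol_output (s : G.Profile) (E : RawGame) :
    (RawGame.output ([], (List.ofFn fun j => (s j : ℕ)), E)).map bitSymbol = G.profileCode s := by
  have e : ∀ m : ℕ, List.map bitSymbol (m.bits.map some ++ [none]) = natCode m :=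
    map_bitSymbol_bitBlock
  simp only [RawGame.output, profileCode, List.map_flatMap, e, List.ofFn_eq_map, List.flatMap_map]

end FacilityGame

namespace FacilityGame
variable (G : FacilityGame)

/-! ### Client equilibria -/

theorem load_update {G : FacilityGame} (x : G.Distribution) (i : Fin G.n) (y : Fin G.k → ℝ)
    (j : Fin G.k) : load (Function.update x i y) j = load x j - x i j + y j := by
  have h : ∑ l, (Function.update x i y l j - x l j) = y j - x i j := by
    rw [Finset.sum_eq_single i (fun l _ hl => by rw [Function.update_of_ne hl, sub_self])
      (fun h => absurd (Finset.mem_univ i) h), Function.update_self]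
  rw [Finset.sum_sub_distrib] at h
  unfold load
  linarith

theorem clientCost_update {G : FacilityGame} (x : G.Distribution) (i : Fin G.n)
    (y : Fin G.k → ℝ) :
    clientCost (Function.update x i y) i = ∑ j, y j * (load x j - x i j + y j) := by
  simp only [clientCost, load_update, Function.update_self]

/-- The potential function of the client game. -/
def clientPotential {G : FacilityGame} (x : G.Distribution) : ℝ :=
  ∑ j, (load x j ^ 2 + ∑ i, x i j ^ 2)

/-- For each facility, replacing `x` by `y` in a load `ℓ` changes `ℓ² + x²` by `2 (y (ℓ - x + y) - x
ℓ)`; the contributions of other clients cancel. The client game is thus an exact potential game up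
to the factor `2`. -/
theorem clientPotential_update {G : FacilityGame} (x : G.Distribution) (i : Fin G.n)
    (y : Fin G.k → ℝ) : clientPotential (Function.update x i y) - clientPotential x =
      2 * (clientCost (Function.update x i y) i - clientCost x i) := by
  rw [clientCost_update, clientCost, clientPotential, clientPotential, ← Finset.sum_sub_distrib,
    ← Finset.sum_sub_distrib, Finset.mul_sum]
  refine Finset.sum_congr rfl fun j _ => ?_
  have h : ∑ l, (Function.update x i y l j ^ 2 - x l j ^ 2) = y j ^ 2 - x i j ^ 2 := by
    rw [Finset.sum_eq_single i (fun l _ hl => by rw [Function.update_of_ne hl, sub_self])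
      (fun h => absurd (Finset.mem_univ i) h), Function.update_self]
  rw [Finset.sum_sub_distrib] at h
  rw [load_update]
  linear_combination h

variable {G}

theorem IsFeasible.le_weight {s : G.Profile} {i : Fin G.n} {y : Fin G.k → ℝ}
    (h : G.IsFeasible s i y) (j : Fin G.k) : y j ≤ G.w i := by
  by_cases hj : j ∈ G.facilitiesInRange s i
  · rw [← h.2.2 ⟨j, hj⟩]
    exact Finset.single_le_sum (fun l _ => h.1 l) hj
  · rw [h.2.1 j hj]; positivity

theorem isCompact_setOf_isFeasible (s : G.Profile) (i : Fin G.n) :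
    IsCompact {y : Fin G.k → ℝ | G.IsFeasible s i y} := by
  refine IsCompact.of_isClosed_subset
    (isCompact_univ_pi fun _ : Fin G.k => isCompact_Icc (a := (0 : ℝ)) (b := (G.w i : ℝ))) ?_
    (fun y hy j _ => ⟨hy.1 j, hy.le_weight j⟩)
  simp only [IsFeasible, Set.ofPred_and, Set.ofPred_forall]
  refine (isClosed_iInter fun j => isClosed_le continuous_const (continuous_apply j)).inter
    ((isClosed_iInter fun j => isClosed_iInter fun _ =>
      isClosed_eq (continuous_apply j) continuous_const).inter
    (isClosed_iInter fun _ => isClosed_eq ?_ continuous_const))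
  exact continuous_finsetSum _ fun j _ => continuous_apply j

theorem exists_isFeasible (s : G.Profile) (i : Fin G.n) : ∃ y, G.IsFeasible s i y := by
  by_cases h : (G.facilitiesInRange s i).Nonempty
  · obtain ⟨j, hj⟩ := h
    refine ⟨Pi.single j (G.w i : ℝ), fun l => ?_, fun l hl => ?_, fun _ => ?_⟩
    · by_cases hl : l = j
      · subst hl; rw [Pi.single_eq_same]; positivity
      · simp [hl]
    · have hlj : l ≠ j := fun h => hl (h ▸ hj)
      exact Pi.single_eq_of_ne hlj _
    · rw [Finset.sum_eq_single j (fun l _ hl => Pi.single_eq_of_ne hl _) (fun h => absurd hj h),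
        Pi.single_eq_same]
  · exact ⟨0, fun _ => le_rfl, fun _ _ => rfl, fun h' => absurd h' h⟩

/-- A minimiser of the potential over the compact product of the feasible sets admits no improving
deviation of a single client. -/
theorem exists_equilibrium_at (s : G.Profile) : ∃ x : G.Distribution, ∀ i,
    G.IsFeasible s i (x i) ∧ ∀ y, G.IsFeasible s i y →
      clientCost x i ≤ clientCost (Function.update x i y) i := by
  have hc : IsCompact {x : G.Distribution | ∀ i, G.IsFeasible s i (x i)} := by
    have := isCompact_univ_pi fun i => isCompact_setOf_isFeasible s i
    simpa [Set.pi] using this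
  choose y₀ hy₀ using exists_isFeasible s
  have hcont : Continuous fun x : G.Distribution => clientPotential x := by
    unfold clientPotential load
    fun_prop
  obtain ⟨x, hx, hmin⟩ := hc.exists_isMinOn ⟨y₀, hy₀⟩ hcont.continuousOn
  refine ⟨x, fun i => ⟨hx i, fun y hy => ?_⟩⟩
  have h : clientPotential x ≤ clientPotential (Function.update x i y) := hmin (fun l => by
    by_cases hl : l = i
    · subst hl; simpa using hy
    · simpa [Function.update_of_ne hl] using hx l)
  have := clientPotential_update x i y
  linarith

theorem exists_isClientEquilibrium : ∃ σ : G.Profile → G.Distribution, G.IsClientEquilibrium σ := by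
  choose σ hσ using exists_equilibrium_at (G := G)
  exact ⟨σ, hσ⟩

/-- The marginal cost of a facility to a client is its load plus her own contribution. If a used
facility had a larger one than another facility in range, shifting a little weight would pay off. -/
theorem IsClientEquilibrium.marginal_le {σ : G.Profile → G.Distribution}
    (hσ : G.IsClientEquilibrium σ) {s : G.Profile} {i : Fin G.n} {j l : Fin G.k}
    (hj : j ∈ G.facilitiesInRange s i) (hl : l ∈ G.facilitiesInRange s i) (hpos : 0 < σ s i l) :
    load (σ s) l + σ s i l ≤ load (σ s) j + σ s i j := by
  rcases eq_or_ne j l with rfl | hne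
  · exact le_rfl
  by_contra! hlt
  obtain ⟨hf, hopt⟩ := hσ s i
  set x := σ s with hx
  set g := load x l + x i l - (load x j + x i j) with hg
  -- Shifting `t` changes the cost by `-t g + 2 t²`, which is negative for `0 < t ≤ g / 4`; the
  -- other bound keeps the shifted distribution nonnegative.
  set t := min (x i l) (g / 4) with ht
  have ht₀ : 0 < t := lt_min hpos (by linarith)
  have ht₁ : t ≤ x i l := min_le_left _ _
  have ht₂ : t ≤ g / 4 := min_le_right _ _
  let d : Fin G.k → ℝ := Pi.single j t - Pi.single l t
  have hdj : d j = t := by simp [d, Pi.single_eq_of_ne hne]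
  have hdl : d l = -t := by simp [d, Pi.single_eq_of_ne hne.symm]
  have hd : ∀ m, m ≠ j → m ≠ l → d m = 0 := fun m h₁ h₂ => by
    simp [d, Pi.single_eq_of_ne h₁, Pi.single_eq_of_ne h₂]
  have hfeas : G.IsFeasible s i (x i + d) := by
    refine ⟨fun m => ?_, fun m hm => ?_, fun h => ?_⟩
    · rw [Pi.add_apply]
      have := hf.1 m
      by_cases h₁ : m = j
      · subst h₁; linarith
      by_cases h₂ : m = l
      · subst h₂; linarith
      · rw [hd m h₁ h₂]; linarith
    · rw [Pi.add_apply, hf.2.1 m hm, hd m (fun h => hm (h ▸ hj)) (fun h => hm (h ▸ hl)), add_zero]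
    · simp only [Pi.add_apply]
      rw [Finset.sum_add_distrib, hf.2.2 h]
      have : ∑ m ∈ G.facilitiesInRange s i, d m = 0 := by
        simp [d, Finset.sum_sub_distrib, Finset.sum_pi_single', hj, hl]
      rw [this, add_zero]
  have h := hopt _ hfeas
  rw [clientCost_update, clientCost, ← sub_nonneg, ← Finset.sum_sub_distrib] at h
  have hsum : ∑ m, ((x i + d) m * (load x m - x i m + (x i + d) m) - x i m * load x m) =
      ∑ m, (d m * (load x m + x i m) + d m ^ 2) := by
    refine Finset.sum_congr rfl fun m _ => ?_
    rw [Pi.add_apply]; ring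
  rw [hsum, ← Finset.sum_subset (Finset.subset_univ {j, l}) (fun m _ hm => by
    simp only [Finset.mem_insert, Finset.mem_singleton, not_or] at hm
    rw [hd m hm.1 hm.2]; ring), Finset.sum_pair hne, hdj, hdl] at h
  nlinarith

/-! ### Equilibrium loads versus uniform loads -/

/-- The load of a facility if the clients split their weight uniformly. -/
noncomputable def uniformLoad (G : FacilityGame) (s : G.Profile) (j : Fin G.k) : ℝ :=
  ∑ i, if s j ∈ G.shoppingRange i then (G.w i : ℝ) / (G.facilitiesInRange s i).card else 0

theorem mem_facilitiesInRange {s : G.Profile} {i : Fin G.n} {j : Fin G.k} :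
    j ∈ G.facilitiesInRange s i ↔ s j ∈ G.shoppingRange i := by
  simp [facilitiesInRange]

/-- At a least loaded facility the marginal inequality turns into one between contributions: a
client gives it at least as much as any other facility she uses, hence at least the average. -/
theorem IsClientEquilibrium.uniformLoad_le_load {σ : G.Profile → G.Distribution}
    (hσ : G.IsClientEquilibrium σ) {s : G.Profile} {m : Fin G.k}
    (hm : ∀ j, load (σ s) m ≤ load (σ s) j) : G.uniformLoad s m ≤ load (σ s) m := by
  refine Finset.sum_le_sum fun i _ => ?_
  obtain ⟨hf, -⟩ := hσ s i
  split_ifs with h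
  · have hmem := mem_facilitiesInRange.2 h
    rw [div_le_iff₀ (by exact_mod_cast Finset.card_pos.2 ⟨m, hmem⟩), ← hf.2.2 ⟨m, hmem⟩, mul_comm,
      ← nsmul_eq_mul]
    refine Finset.sum_le_card_nsmul _ _ _ fun j hj => ?_
    rcases (hf.1 j).eq_or_lt with h₀ | h₀
    · rw [← h₀]; exact hf.1 m
    · have h₁ := hσ.marginal_le hmem hj h₀
      have h₂ := hm j
      linarith
  · exact hf.1 m

/-- The dual argument: a client using a most loaded facility gives every other facility in her range
at least as much, so its share is at most the average. -/
theorem IsClientEquilibrium.load_le_uniformLoad {σ : G.Profile → G.Distribution}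
    (hσ : G.IsClientEquilibrium σ) {s : G.Profile} {q : Fin G.k}
    (hq : ∀ j, load (σ s) j ≤ load (σ s) q) : load (σ s) q ≤ G.uniformLoad s q := by
  refine Finset.sum_le_sum fun i _ => ?_
  obtain ⟨hf, -⟩ := hσ s i
  split_ifs with h
  · have hmem := mem_facilitiesInRange.2 h
    rw [le_div_iff₀ (by exact_mod_cast Finset.card_pos.2 ⟨q, hmem⟩), ← hf.2.2 ⟨q, hmem⟩, mul_comm,
      ← nsmul_eq_mul]
    refine Finset.card_nsmul_le_sum _ _ _ fun j hj => ?_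
    rcases (hf.1 q).eq_or_lt with h₀ | h₀
    · rw [← h₀]; exact hf.1 j
    · have h₁ := hσ.marginal_le hj hmem h₀
      have h₂ := hq j
      linarith
  · exact (hf.2.1 q (fun hmem => h (mem_facilitiesInRange.1 hmem))).le

theorem card_facilitiesInRange_update_le (s : G.Profile) (j : Fin G.k) (v i : Fin G.n) :
    (G.facilitiesInRange (Function.update s j v) i).card ≤ (G.facilitiesInRange s i).card + 1 := by
  refine (Finset.card_le_card (t := insert j (G.facilitiesInRange s i)) fun l hl => ?_).trans
    (Finset.card_insert_le _ _)
  rw [mem_facilitiesInRange] at hl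
  by_cases h : l = j
  · simp [h]
  · rw [Function.update_of_ne h] at hl
    exact Finset.mem_insert_of_mem (mem_facilitiesInRange.2 hl)

/-- Both sides sum over the clients who reach the same location. Between the two profiles `j` moves
back and `m` moves, so each range count grows by at most `2`; since it was at least `1`, it at most
triples. -/
theorem uniformLoad_update_le (s : G.Profile) (j m q : Fin G.k) (v : Fin G.n) :
    G.uniformLoad (Function.update s j v) q ≤
      3 * G.uniformLoad (Function.update s m (Function.update s j v q)) m := by
  rw [uniformLoad, uniformLoad, Finset.mul_sum]
  refine Finset.sum_le_sum fun i _ => ?_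
  rw [Function.update_self]
  split_ifs with h
  · have h₁ : 0 < (G.facilitiesInRange (Function.update s j v) i).card :=
      Finset.card_pos.2 ⟨q, mem_facilitiesInRange.2 h⟩
    have h₂ : 0 < (G.facilitiesInRange
        (Function.update s m (Function.update s j v q)) i).card :=
      Finset.card_pos.2 ⟨m, mem_facilitiesInRange.2 (by rwa [Function.update_self])⟩
    have h₃ := card_facilitiesInRange_update_le s m (Function.update s j v q) i
    have h₄ := card_facilitiesInRange_update_le (Function.update s j v) j (s j) i
    rw [Function.update_idem, Function.update_eq_self] at h₄
    have h₅ : (G.facilitiesInRange (Function.update s m (Function.update s j v q)) i).card ≤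
        3 * (G.facilitiesInRange (Function.update s j v) i).card := by omega
    rw [← mul_div_assoc, div_le_div_iff₀ (by exact_mod_cast h₁) (by exact_mod_cast h₂)]
    have h₆ : ((G.facilitiesInRange (Function.update s m (Function.update s j v q)) i).card : ℝ) ≤
        3 * (G.facilitiesInRange (Function.update s j v) i).card := by exact_mod_cast h₅
    have hw : (0 : ℝ) ≤ G.w i := by positivity
    nlinarith
  · simp

/-- Profiles in which no facility can increase its load under uniform splitting by more than the
factor `α` are `3α`-approximate subgame perfect. -/
theorem IsClientEquilibrium.isApproxSPE {σ : G.Profile → G.Distribution}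
    (hσ : G.IsClientEquilibrium σ) {s : G.Profile} {α : ℝ} (hα : 0 ≤ α)
    (hs : ∀ m v, G.uniformLoad (Function.update s m v) m ≤ α * G.uniformLoad s m) :
    G.IsApproxSPE (3 * α) s σ := by
  refine ⟨fun j v => ?_, hσ⟩
  have : Nonempty (Fin G.k) := ⟨j⟩
  -- True and uniform loads are comparable only at extreme facilities, hence the detour through a
  -- maximum after the deviation and a minimum before it.
  obtain ⟨q, hq⟩ := Finite.exists_max fun l => load (σ (Function.update s j v)) l
  obtain ⟨m, hm⟩ := Finite.exists_min fun l => load (σ s) l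
  calc load (σ (Function.update s j v)) j ≤ load (σ (Function.update s j v)) q := hq j
    _ ≤ G.uniformLoad (Function.update s j v) q := hσ.load_le_uniformLoad hq
    _ ≤ 3 * G.uniformLoad (Function.update s m (Function.update s j v q)) m :=
      uniformLoad_update_le s j m q v
    _ ≤ 3 * (α * G.uniformLoad s m) := by gcongr; exact hs _ _
    _ ≤ 3 * (α * load (σ s) m) := by gcongr; exact hσ.uniformLoad_le_load hm
    _ ≤ 3 * (α * load (σ s) j) := by gcongr; exact hm j
    _ = 3 * α * load (σ s) j := by ring

end FacilityGame

/-! ### Fractions -/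

namespace RawGame

/-- The value of a fraction. -/
noncomputable def fracVal (x : ℕ × ℕ) : ℝ := x.1 / x.2

theorem fracVal_addFrac {x y : ℕ × ℕ} (hx : 0 < x.2) (hy : 0 < y.2) :
    fracVal (addFrac x y) = fracVal x + fracVal y ∧ 0 < (addFrac x y).2 := by
  refine ⟨?_, Nat.mul_pos hx hy⟩
  have hx' : (x.2 : ℝ) ≠ 0 := by positivity
  have hy' : (y.2 : ℝ) ≠ 0 := by positivity
  simp only [fracVal, addFrac, Nat.cast_add, Nat.cast_mul]
  field_simp

theorem ltFrac_iff {x y : ℕ × ℕ} (hx : 0 < x.2) (hy : 0 < y.2) :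
    ltFrac x y = true ↔ fracVal x < fracVal y := by
  rw [fracVal, fracVal, div_lt_div_iff₀ (by positivity) (by positivity), ltFrac, decide_eq_true_eq]
  exact_mod_cast Iff.rfl

theorem count_perm (E : RawGame) {s s' : List ℕ} (h : s.Perm s') (i : ℕ) :
    E.count s i = E.count s' i := (h.filter _).length_eq

theorem count_cons (E : RawGame) (v : ℕ) (s : List ℕ) (i : ℕ) :
    E.count (v :: s) i = if E.adj i v = true then E.count s i + 1 else E.count s i := by
  simp only [count, List.filter_cons]
  split_ifs <;> simp

theorem count_le_length (E : RawGame) (s : List ℕ) (i : ℕ) : E.count s i ≤ s.length :=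
  List.length_filter_le _ _

end RawGame

/-! ### Gains, best locations and the improvement test -/

/-- The quantities that govern the local search: the number `n` of vertices, the adjacency and the
weights. -/
structure SearchGame where
  /-- The data of the game. -/
  E : RawGame
  /-- The number of vertices. -/
  n : ℕ
  n_eq : E.1.1 = n
  vertices_eq : E.1.2 = List.range n
  den_pos : ∀ i < n, 0 < E.den i
  den_n_pos : 0 < E.den n
  num_n_pos : 0 < E.num n

namespace SearchGame
open RawGame
variable (H : SearchGame)

/-- The weight of a client. -/
noncomputable def weight (i : ℕ) : ℝ := fracVal (H.E.num i, H.E.den i)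

theorem weight_nonneg (i : ℕ) : 0 ≤ H.weight i := by unfold weight fracVal; positivity

/-- The load of a facility at `v` which joins the facilities `s`, when the clients split their
weight uniformly. -/
noncomputable def gainVal (s : List ℕ) (v : ℕ) : ℝ :=
  ∑ i ∈ Finset.range H.n, if H.E.adj i v = true then H.weight i / (H.E.count s i + 1) else 0

theorem gainVal_nonneg (s : List ℕ) (v : ℕ) : 0 ≤ H.gainVal s v :=
  Finset.sum_nonneg fun i _ => by
    have := H.weight_nonneg i
    split_ifs <;> positivity

theorem gainVal_perm {s s' : List ℕ} (h : s.Perm s') (v : ℕ) : H.gainVal s v = H.gainVal s' v := by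
  simp only [gainVal, H.E.count_perm h]

theorem fracVal_gain (s : List ℕ) (v : ℕ) :
    fracVal (H.E.gain s v) = H.gainVal s v ∧ 0 < (H.E.gain s v).2 := by
  have key : ∀ m ≤ H.n, fracVal ((List.range m).foldl
      (fun x i => if H.E.adj i v = true then addFrac x (H.E.share s i) else x) (0, 1)) =
        ∑ i ∈ Finset.range m, (if H.E.adj i v = true then H.weight i / (H.E.count s i + 1) else 0) ∧
      0 < ((List.range m).foldl
        (fun x i => if H.E.adj i v = true then addFrac x (H.E.share s i) else x) (0, 1)).2 := by
    intro m
    induction m with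
    | zero => intro _; simp [fracVal]
    | succ m ih =>
      intro hm
      obtain ⟨h₁, h₂⟩ := ih (by omega)
      rw [List.range_succ, List.foldl_append, Finset.sum_range_succ, ← h₁]
      simp only [List.foldl_cons, List.foldl_nil]
      split_ifs with h
      · have hd := H.den_pos m (by omega)
        have h₃ := fracVal_addFrac h₂ (y := H.E.share s m) (Nat.mul_pos hd (Nat.succ_pos _))
        refine ⟨h₃.1.trans ?_, h₃.2⟩
        congr 1
        simp only [weight, fracVal, share, Nat.cast_mul, Nat.cast_add, Nat.cast_one]
        rw [div_div]
      · exact ⟨by simp, h₂⟩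
  have := key H.n le_rfl
  rw [← H.vertices_eq] at this
  exact this

theorem best_spec (s : List ℕ) (m : ℕ) :
    (∀ v < H.n, H.gainVal s v ≤ H.gainVal s (H.E.best s m)) ∧
      (H.E.best s m = m ∨ H.E.best s m < H.n) := by
  have key : ∀ l ≤ H.n, ∀ b, b = (List.range l).foldl (fun b v =>
      if ltFrac (H.E.gain s b) (H.E.gain s v) = true then v else b) m →
      (∀ v < l, H.gainVal s v ≤ H.gainVal s b) ∧ (b = m ∨ b < H.n) := by
    intro l
    induction l with
    | zero => rintro _ b rfl; exact ⟨fun v hv => absurd hv (by omega), Or.inl rfl⟩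
    | succ l ih =>
      intro hl b hb
      obtain ⟨h₁, h₂⟩ := ih (by omega) _ rfl
      rw [List.range_succ, List.foldl_append, List.foldl_cons, List.foldl_nil] at hb
      set b' := (List.range l).foldl (fun b v =>
        if ltFrac (H.E.gain s b) (H.E.gain s v) = true then v else b) m
      have hlt := ltFrac_iff (H.fracVal_gain s b').2 (H.fracVal_gain s l).2
      rw [(H.fracVal_gain s b').1, (H.fracVal_gain s l).1] at hlt
      split_ifs at hb with h
      · subst hb
        refine ⟨fun v hv => ?_, Or.inr (by omega)⟩
        rcases Nat.lt_succ_iff_lt_or_eq.1 hv with hv | rfl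
        · exact (h₁ v hv).trans (hlt.1 h).le
        · exact le_rfl
      · subst hb
        refine ⟨fun v hv => ?_, h₂⟩
        rcases Nat.lt_succ_iff_lt_or_eq.1 hv with hv | rfl
        · exact h₁ v hv
        · exact not_lt.1 (mt hlt.2 h)
  refine key H.n le_rfl _ ?_
  rw [← H.vertices_eq]; rfl

/-- The approximation parameter `ε`. -/
noncomputable def eps : ℝ := fracVal (H.E.num H.n, H.E.den H.n)

theorem eps_pos : 0 < H.eps := by
  have h₁ := H.num_n_pos
  have h₂ := H.den_n_pos
  unfold eps fracVal; positivity

theorem improves_iff (s : List ℕ) (m b : ℕ) :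
    H.E.improves s m b = true ↔ (1 + 2 * H.eps / 3) * H.gainVal s m < H.gainVal s b := by
  obtain ⟨h₁, h₂⟩ := H.fracVal_gain s m
  obtain ⟨h₃, h₄⟩ := H.fracVal_gain s b
  have h₅ := H.den_n_pos
  rw [← h₁, ← h₃, improves, decide_eq_true_eq, H.n_eq, eps]
  simp only [fracVal]
  have e : (1 + 2 * ((H.E.num H.n : ℝ) / H.E.den H.n) / 3) *
      (((H.E.gain s m).1 : ℝ) / (H.E.gain s m).2) =
      ((3 * H.E.den H.n + 2 * H.E.num H.n) * (H.E.gain s m).1 : ℝ) /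
        (3 * H.E.den H.n * (H.E.gain s m).2) := by
    field_simp
  rw [e, div_lt_div_iff₀ (by positivity) (by positivity)]
  rw [← Nat.cast_lt (α := ℝ)]
  push_cast
  constructor <;> intro h <;> nlinarith

/-! ### The potential of the local search -/

/-- The potential of a list of locations. -/
noncomputable def potential (s : List ℕ) : ℝ :=
  ∑ i ∈ Finset.range H.n, H.weight i * (harmonic (H.E.count s i) : ℝ)

/-- Consecutive harmonic numbers differ by `1 / (c + 1)`, which is the share a newcomer receives
from a client with `c` facilities in range. This is what makes the uniform game an exact potential
game. -/
theorem potential_cons (v : ℕ) (s : List ℕ) :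
    H.potential (v :: s) = H.potential s + H.gainVal s v := by
  rw [potential, potential, gainVal, ← Finset.sum_add_distrib]
  refine Finset.sum_congr rfl fun i _ => ?_
  rw [count_cons]
  split_ifs with h
  · rw [harmonic_succ]
    push_cast
    rw [mul_add, div_eq_mul_inv]
  · rw [add_zero]

theorem potential_perm {s s' : List ℕ} (h : s.Perm s') : H.potential s = H.potential s' := by
  simp only [potential, H.E.count_perm h]

theorem potential_nil : H.potential [] = 0 := by simp [potential, count]

theorem gainVal_le_gainVal_nil (s : List ℕ) (v : ℕ) : H.gainVal s v ≤ H.gainVal [] v := by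
  refine Finset.sum_le_sum fun i _ => ?_
  have hw := H.weight_nonneg i
  split_ifs
  · refine div_le_div_of_nonneg_left hw (by simp [count]) ?_
    simp [count]
  · exact le_rfl

theorem gainVal_nil_le (s : List ℕ) (v : ℕ) :
    H.gainVal [] v ≤ (s.length + 1) * H.gainVal s v := by
  rw [gainVal, gainVal, Finset.mul_sum]
  refine Finset.sum_le_sum fun i _ => ?_
  have hw := H.weight_nonneg i
  split_ifs
  · have h : (H.E.count s i : ℝ) ≤ s.length := by exact_mod_cast H.E.count_le_length s i
    rw [← mul_div_assoc, le_div_iff₀ (by positivity)]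
    simp only [count, List.filter_nil, List.length_nil, Nat.cast_zero, zero_add, div_one] at h ⊢
    nlinarith
  · simp

theorem potential_nonneg (s : List ℕ) : 0 ≤ H.potential s := by
  induction s with
  | nil => rw [potential_nil]
  | cons v s ih => rw [potential_cons]; have := H.gainVal_nonneg s v; linarith

/-- The facilities are inserted one at a time; each gain is largest when no other facility is
present. -/
theorem potential_le {s : List ℕ} {C : ℝ} (h : ∀ v ∈ s, H.gainVal [] v ≤ C) :
    H.potential s ≤ s.length * C := by
  induction s with
  | nil => simp [potential_nil]
  | cons v s ih =>
    have h₁ := ih fun v hv => h v (by simp [hv])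
    have h₂ := (H.gainVal_le_gainVal_nil s v).trans (h v (by simp))
    rw [potential_cons, List.length_cons]
    push_cast
    linarith

/-- A lower bound for the positive weights. -/
noncomputable def unit : ℝ := (2 ^ treeSize H.E)⁻¹

theorem unit_pos : 0 < H.unit := by unfold unit; positivity

theorem unit_le_weight {i : ℕ} (hi : i < H.n) (h : H.weight i ≠ 0) : H.unit ≤ H.weight i := by
  have hd : H.E.den i < 2 ^ treeSize H.E := PolyTime.natOfBits_getD_lt _ _
  have hp := H.den_pos i hi
  have hn : 1 ≤ H.E.num i := by
    rw [Nat.one_le_iff_ne_zero]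
    intro h₀
    exact h (by simp [weight, fracVal, h₀])
  rw [unit, weight, fracVal, ← one_div, div_le_div_iff₀ (by positivity) (by positivity)]
  simp only
  rw [one_mul]
  have h₁ : H.E.den i ≤ H.E.num i * 2 ^ treeSize H.E := hd.le.trans (Nat.le_mul_of_pos_left _ hn)
  exact_mod_cast h₁

theorem gainVal_nil_le_pow (v : ℕ) : H.gainVal [] v ≤ treeSize H.E * 2 ^ treeSize H.E := by
  have h : ∀ i ∈ Finset.range H.n, (if H.E.adj i v = true then
      H.weight i / (H.E.count [] i + 1) else 0) ≤ 2 ^ treeSize H.E := by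
    intro i hi
    have hn : H.E.num i < 2 ^ treeSize H.E := PolyTime.natOfBits_getD_lt _ _
    have hd := H.den_pos i (Finset.mem_range.1 hi)
    split_ifs
    · simp only [count, List.filter_nil, List.length_nil, Nat.cast_zero, zero_add, div_one, weight,
        fracVal]
      rw [div_le_iff₀ (by positivity)]
      have : H.E.num i ≤ 2 ^ treeSize H.E * H.E.den i := hn.le.trans (Nat.le_mul_of_pos_right _ hd)
      exact_mod_cast this
    · positivity
  refine (Finset.sum_le_card_nsmul _ _ _ h).trans ?_
  rw [Finset.card_range, nsmul_eq_mul]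
  have hn : H.n ≤ treeSize H.E := by
    have h₁ := length_lt_treeSize H.E.1.2
    rw [treeSize_prod H.E, treeSize_prod H.E.1]
    rw [H.vertices_eq, List.length_range] at h₁
    rw [H.vertices_eq]
    omega
  gcongr

/-- A positive gain contains the share of some client of positive weight. This weight is at least
`unit`, and it is split among at most `s.length + 1` facilities. -/
theorem unit_le_gainVal {s : List ℕ} {v : ℕ} (h : 0 < H.gainVal s v) :
    H.unit ≤ (s.length + 1) * H.gainVal s v := by
  have h' : ∑ _i ∈ Finset.range H.n, (0 : ℝ) < H.gainVal s v := by
    rw [Finset.sum_const_zero]; exact h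
  obtain ⟨i, hi, hpos⟩ := Finset.exists_lt_of_sum_lt h'
  have hle : (if H.E.adj i v = true then H.weight i / (H.E.count s i + 1) else 0) ≤
      H.gainVal s v := Finset.single_le_sum (f := fun i => if H.E.adj i v = true then
        H.weight i / ((H.E.count s i : ℝ) + 1) else 0) (fun l _ => by
          have := H.weight_nonneg l
          split_ifs <;> positivity) hi
  split_ifs at hpos hle with ha
  · have hw : H.weight i ≠ 0 := by intro h₀; rw [h₀, zero_div] at hpos; exact lt_irrefl _ hpos
    have h₁ := H.unit_le_weight (Finset.mem_range.1 hi) hw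
    have h₂ : (H.E.count s i : ℝ) ≤ s.length := by exact_mod_cast H.E.count_le_length s i
    rw [div_le_iff₀ (by positivity)] at hle
    nlinarith
  · exact absurd hpos (lt_irrefl _)

/-- A sufficient improvement increases the potential by a constant factor. -/
theorem potential_move {s : List ℕ} {m b R : ℕ} (hs : ∀ v ∈ s, v < H.n)
    (hb : ∀ v < H.n, H.gainVal s v ≤ H.gainVal s b)
    (himp : (1 + 2 * H.eps / 3) * H.gainVal s m < H.gainVal s b)
    (hR : ((s.length + 1 : ℕ) : ℝ) ^ 2 * (3 + 2 * H.eps) ≤ R * H.eps) :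
    (H.potential (m :: s) + H.unit) * (1 + 1 / R) ≤ H.potential (b :: s) + H.unit := by
  have hε := H.eps_pos
  have hm := H.gainVal_nonneg s m
  have hbpos : 0 < H.gainVal s b := lt_of_le_of_lt (by positivity) himp
  have hunit := H.unit_le_gainVal hbpos
  set k : ℝ := ((s.length + 1 : ℕ) : ℝ) with hk
  have hk' : (s.length : ℝ) + 1 = k := by rw [hk]; push_cast; rfl
  have hk₁ : 1 ≤ k := by rw [← hk']; have : (0 : ℝ) ≤ s.length := by positivity
                         linarith
  have hRpos : (0 : ℝ) < R := by
    by_contra hneg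
    have h₁ : (R : ℝ) = 0 := le_antisymm (not_lt.1 hneg) (by positivity)
    rw [h₁, zero_mul] at hR
    have : 0 < k ^ 2 * (3 + 2 * H.eps) := by positivity
    linarith
  -- Every other facility stands at a vertex whose gain is at most that of the best location `b`.
  -- Even as the sole facility there it would gain at most `k` times as much.
  have hpot : H.potential s ≤ s.length * (k * H.gainVal s b) := by
    refine H.potential_le fun v hv => (H.gainVal_nil_le s v).trans ?_
    rw [hk']
    exact mul_le_mul_of_nonneg_left (hb v (hs v hv)) (by linarith)
  rw [hk'] at hunit
  have hlen : (s.length : ℝ) = k - 1 := by linarith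
  rw [hlen] at hpot
  have hmb : H.gainVal s m ≤ H.gainVal s b := by nlinarith
  rw [potential_cons, potential_cons]
  -- The three terms are at most `(k - 1) k`, `1` and `k` times the gain at `b`, in total `k² + 1 ≤
  -- 2 k²` times.
  have hQ : H.potential s + H.gainVal s m + H.unit ≤ 2 * k ^ 2 * H.gainVal s b := by
    nlinarith [mul_nonneg (mul_nonneg (sub_nonneg.2 hk₁) (sub_nonneg.2 hk₁)) hbpos.le]
  -- The improvement condition says that the increase exceeds the fraction `2ε / (3 + 2ε)` of the
  -- gain at `b`; `hR` is tailored to this fraction.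
  have hgain : 2 * k ^ 2 * H.gainVal s b ≤ R * (H.gainVal s b - H.gainVal s m) := by
    have h₁ : 2 * H.eps * H.gainVal s b ≤
        (3 + 2 * H.eps) * (H.gainVal s b - H.gainVal s m) := by nlinarith
    have h₂ : 2 * (k ^ 2 * (3 + 2 * H.eps)) * H.gainVal s b ≤ 2 * (R * H.eps) * H.gainVal s b := by
      gcongr
    have h₃ : R * (2 * H.eps * H.gainVal s b) ≤
        R * ((3 + 2 * H.eps) * (H.gainVal s b - H.gainVal s m)) := by gcongr
    have h₄ : (3 + 2 * H.eps) * (2 * k ^ 2 * H.gainVal s b) ≤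
        (3 + 2 * H.eps) * (R * (H.gainVal s b - H.gainVal s m)) := by nlinarith
    exact le_of_mul_le_mul_left h₄ (by positivity)
  have hfin : (H.potential s + H.gainVal s m + H.unit) * (1 / R) ≤
      H.gainVal s b - H.gainVal s m := by
    rw [mul_one_div, div_le_iff₀ hRpos]
    linarith
  linarith

/-! ### Termination of the local search -/

/-- A facility at `q` cannot increase its load by more than the factor `1 + 2ε/3`. -/
def Stable (s : List ℕ) (q : ℕ) : Prop :=
  ∀ r, s.Perm (q :: r) → ∀ v < H.n, H.gainVal r v ≤ (1 + 2 * H.eps / 3) * H.gainVal r q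

/-- The invariant of the local search with `k` facilities. -/
structure Invariant (k : ℕ) (t : List ℕ × (List ℕ × RawGame)) : Prop where
  game : t.2.2 = H.E
  length : t.2.1.length + t.1.length = k
  lt : ∀ v ∈ t.2.1 ++ t.1, v < H.n
  stable : ∀ q ∈ t.2.1, H.Stable (t.2.1 ++ t.1) q

/-- A step of the local search keeps the invariant. It either checks the first facility or
increases the potential by a constant factor. -/
theorem step_spec {k R : ℕ} {t : List ℕ × (List ℕ × RawGame)} (ht : H.Invariant k t)
    (hne : t.1 ≠ []) (hR : (k : ℝ) ^ 2 * (3 + 2 * H.eps) ≤ R * H.eps) :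
    H.Invariant k (step t) ∧
      (((step t).1.length + 1 = t.1.length ∧
        H.potential ((step t).2.1 ++ (step t).1) = H.potential (t.2.1 ++ t.1)) ∨
      (H.potential (t.2.1 ++ t.1) + H.unit) * (1 + 1 / R) ≤
        H.potential ((step t).2.1 ++ (step t).1) + H.unit) := by
  obtain ⟨todo, done, E⟩ := t
  obtain ⟨hE, hlen, hlt, hst⟩ := ht
  simp only at hE hlen hlt hst hne
  subst hE
  cases todo with
  | nil => exact absurd rfl hne
  | cons m tl =>
    have hperm : (done ++ m :: tl).Perm (m :: (done ++ tl)) := List.perm_middle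
    obtain ⟨hb₁, hb₂⟩ := H.best_spec (done ++ tl) m
    have himp := H.improves_iff (done ++ tl) m (H.E.best (done ++ tl) m)
    by_cases h : H.E.improves (done ++ tl) m (H.E.best (done ++ tl) m) = true
    · have e : step (m :: tl, done, H.E) =
          (H.E.best (done ++ tl) m :: (done ++ tl), [], H.E) :=
        (if_neg (by simp)).trans (if_pos h)
      rw [e]
      have hlt' : ∀ v ∈ done ++ tl, v < H.n := fun v hv =>
        hlt v (hperm.mem_iff.2 (by simp at hv ⊢; tauto))
      -- A move may spoil stability elsewhere, so the checked list restarts empty and the stability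
      -- condition holds vacuously.
      refine ⟨⟨rfl, ?_, ?_, by simp⟩, Or.inr ?_⟩
      · simp at hlen ⊢; omega
      · intro v hv
        simp only [List.nil_append] at hv
        rcases List.mem_cons.1 hv with rfl | hv
        · rcases hb₂ with h₁ | h₁
          · rw [h₁]; exact hlt m (by simp)
          · exact h₁
        · exact hlt' v hv
      · simp only [List.nil_append]
        rw [H.potential_perm hperm]
        refine H.potential_move hlt' hb₁ (himp.1 h) ?_
        have : (done ++ tl).length + 1 = k := by simp at hlen ⊢; omega
        rw [this]; exact hR
    · have e : step (m :: tl, done, H.E) = (tl, m :: done, H.E) :=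
        (if_neg (by simp)).trans (if_neg h)
      rw [e]
      have hperm' : (m :: done ++ tl).Perm (done ++ m :: tl) := hperm.symm
      refine ⟨⟨rfl, ?_, fun v hv => hlt v (hperm'.mem_iff.1 hv), ?_⟩, Or.inl ⟨rfl,
        H.potential_perm hperm'⟩⟩
      · simp at hlen ⊢; omega
      · intro q hq r hr
        rcases List.mem_cons.1 hq with rfl | hq
        · have hr' : (done ++ tl).Perm r := List.Perm.cons_inv hr
          intro v hv
          rw [← H.gainVal_perm hr', ← H.gainVal_perm hr']
          exact (hb₁ v hv).trans (not_lt.1 (mt himp.2 h))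
        · exact hst q hq r (hperm'.symm.trans hr)

theorem Invariant.potential_le {k : ℕ} {t : List ℕ × (List ℕ × RawGame)} (ht : H.Invariant k t) :
    H.potential (t.2.1 ++ t.1) ≤ k * (treeSize H.E * 2 ^ treeSize H.E) := by
  have := H.potential_le (s := t.2.1 ++ t.1) fun v _ => H.gainVal_nil_le_pow v
  rwa [List.length_append, ht.length] at this

/-- The hypothesis says that `j` more improvements would push the shifted potential above its upper
bound, so fewer than `j` can occur; `j = 0` is contradictory. The outer induction counts
improvements, the inner one the facilities still to be checked. An improvement costs one step and
leaves a new list of `k` facilities to check, hence the factor `k + 1`. -/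
theorem exists_iterate_step {k R : ℕ} (hR : (k : ℝ) ^ 2 * (3 + 2 * H.eps) ≤ R * H.eps) (j : ℕ) :
    ∀ t, H.Invariant k t → k * (treeSize H.E * 2 ^ treeSize H.E) + H.unit <
      (H.potential (t.2.1 ++ t.1) + H.unit) * (1 + 1 / R) ^ j →
      ∃ N ≤ j * (k + 1) + t.1.length, (step^[N] t).1 = [] ∧
        ∀ i ≤ N, H.Invariant k (step^[i] t) := by
  induction j with
  | zero =>
    intro t ht hlt
    have := ht.potential_le
    rw [pow_zero, mul_one] at hlt
    linarith
  | succ j ihj =>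
    intro t
    generalize hl : t.1.length = l
    induction l generalizing t with
    | zero =>
      intro ht _
      refine ⟨0, by omega, List.length_eq_zero_iff.1 hl, fun i hi => ?_⟩
      obtain rfl : i = 0 := by omega
      exact ht
    | succ l ihl =>
      intro ht hlt
      have hne : t.1 ≠ [] := by rintro h; simp [h] at hl
      obtain ⟨hinv, hstep⟩ := H.step_spec ht hne hR
      have hcons : ∀ N, (∀ i ≤ N, H.Invariant k (step^[i] (step t))) →
          ∀ i ≤ N + 1, H.Invariant k (step^[i] t) := by
        intro N hN i hi
        cases i with
        | zero => exact ht
        | succ i => exact hN i (by omega)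
      rcases hstep with ⟨h₁, h₂⟩ | h
      · obtain ⟨N, hN, h₃, h₄⟩ := ihl (step t) (by omega) hinv (by rwa [h₂])
        exact ⟨N + 1, by omega, h₃, hcons N h₄⟩
      · obtain ⟨N, hN, h₃, h₄⟩ := ihj (step t) hinv (hlt.trans_le (by
          rw [pow_succ', ← mul_assoc]
          gcongr))
        refine ⟨N + 1, ?_, h₃, hcons N h₄⟩
        have := hinv.length
        rw [Nat.succ_mul]; omega

/-- By Bernoulli's inequality, `R` improvements at least double the shifted potential. -/
theorem two_le_pow {R : ℕ} (hR : 0 < R) : (2 : ℝ) ≤ (1 + 1 / R) ^ R := by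
  have h := one_add_mul_le_pow (a := (1 / R : ℝ)) (le_trans (by norm_num) (by positivity : (0:ℝ) ≤ 1 / R)) R
  have e : (R : ℝ) * (1 / R) = 1 := by field_simp
  linarith

/-- The local search ends after polynomially many steps. -/
theorem exists_iterate_step_eq_nil {k N : ℕ} (hN : 1 ≤ N * H.eps)
    {t : List ℕ × (List ℕ × RawGame)} (ht : H.Invariant k t) :
    ∃ M ≤ ((k + 1) ^ 2 * (3 * N + 2)) * (3 * treeSize H.E + k + 1) * (k + 1) + k,
      (step^[M] t).1 = [] ∧ ∀ i ≤ M, H.Invariant k (step^[i] t) := by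
  -- As `N ε ≥ 1`, the factor `3 N + 2` times `ε` dominates `3 + 2ε`. Using `k + 1` keeps `R`
  -- positive without facilities.
  set R := (k + 1) ^ 2 * (3 * N + 2) with hRdef
  set B := treeSize H.E with hB
  have hε := H.eps_pos
  have hRpos : 0 < R := by positivity
  have hR : (k : ℝ) ^ 2 * (3 + 2 * H.eps) ≤ R * H.eps := by
    have h₁ : (k : ℝ) ^ 2 * (3 + 2 * H.eps) ≤ (k + 1) ^ 2 * (3 * (N * H.eps) + 2 * H.eps) := by
      gcongr
      · linarith
      · linarith
    rw [hRdef]; push_cast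
    nlinarith
  -- The shifted potential starts at `unit = 2 ^ (-B)` or more and stays below `2 ^ (k + 2 B) + 1`,
  -- so `3 B + k + 1` doublings are too many.
  obtain ⟨M, hM, h₁, h₂⟩ := H.exists_iterate_step hR (R * (3 * B + k + 1)) t ht (by
    have hpow : (2 : ℝ) ^ (3 * B + k + 1) ≤ (1 + 1 / R) ^ (R * (3 * B + k + 1)) := by
      rw [pow_mul]
      exact pow_le_pow_left₀ (by norm_num) (two_le_pow hRpos) _
    have hP := H.potential_nonneg (t.2.1 ++ t.1)
    have hk : (k : ℝ) < 2 ^ k := by exact_mod_cast k.lt_two_pow_self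
    have hB' : (B : ℝ) < 2 ^ B := by exact_mod_cast B.lt_two_pow_self
    have hu : H.unit * 2 ^ B = 1 := by
      rw [unit]; exact inv_mul_cancel₀ (by positivity)
    have h2B : (1 : ℝ) ≤ 2 ^ B := one_le_pow₀ (by norm_num)
    have h2k : (1 : ℝ) ≤ 2 ^ k := one_le_pow₀ (by norm_num)
    have hupos := H.unit_pos
    calc (k : ℝ) * (B * 2 ^ B) + H.unit < 2 ^ k * (2 ^ B * 2 ^ B) + 1 := by
          have h₃ : (B : ℝ) * 2 ^ B < 2 ^ B * 2 ^ B := by gcongr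
          have : (k : ℝ) * (B * 2 ^ B) < 2 ^ k * (2 ^ B * 2 ^ B) :=
            mul_lt_mul'' hk h₃ (by positivity) (by positivity)
          have h₀ : H.unit ≤ 1 := by nlinarith
          linarith
      _ ≤ H.unit * 2 ^ (3 * B + k + 1) := by
          have e : H.unit * 2 ^ (3 * B + k + 1) = 2 * (2 ^ k * (2 ^ B * 2 ^ B)) := by
            calc H.unit * 2 ^ (3 * B + k + 1) =
                (H.unit * 2 ^ B) * (2 * (2 ^ k * (2 ^ B * 2 ^ B))) := by ring
              _ = _ := by rw [hu, one_mul]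
          rw [e]
          have : (1 : ℝ) ≤ 2 ^ k * (2 ^ B * 2 ^ B) :=
            one_le_mul_of_one_le_of_one_le h2k (one_le_mul_of_one_le_of_one_le h2B h2B)
          linarith
      _ ≤ (H.potential (t.2.1 ++ t.1) + H.unit) * (1 + 1 / R) ^ (R * (3 * B + k + 1)) := by
          gcongr
          linarith)
  refine ⟨M, hM.trans ?_, h₁, h₂⟩
  have := ht.length
  omega

end SearchGame

/-! ### The local search on a game -/

namespace FacilityGame
open RawGame
variable (G : FacilityGame) {ε : ℚ≥0} (hε : 0 < ε)

/-- The local search of a game. -/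
def searchGame : SearchGame where
  E := G.raw ε
  n := G.n
  n_eq := rfl
  vertices_eq := rfl
  den_pos i hi := by
    rw [show i = ((⟨i, hi⟩ : Fin G.n) : ℕ) from rfl, raw_den]
    exact NNRat.den_pos _
  den_n_pos := by rw [raw_den_n]; exact NNRat.den_pos _
  num_n_pos := by rw [raw_num_n]; exact NNRat.num_pos.2 hε

theorem searchGame_eps : (G.searchGame hε).eps = ε := by
  have h₁ : (G.searchGame hε).E.num (G.searchGame hε).n = ε.num := G.raw_num_n ε
  have h₂ : (G.searchGame hε).E.den (G.searchGame hε).n = ε.den := G.raw_den_n ε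
  rw [SearchGame.eps, fracVal, h₁, h₂, NNRat.cast_def]

theorem searchGame_weight (i : Fin G.n) : (G.searchGame hε).weight i = G.w i := by
  have h₁ : (G.searchGame hε).E.num i = (G.w i).num := G.raw_num ε i
  have h₂ : (G.searchGame hε).E.den i = (G.w i).den := G.raw_den ε i
  rw [SearchGame.weight, fracVal, h₁, h₂, NNRat.cast_def]

theorem count_ofFn (s : G.Profile) (i : Fin G.n) :
    (G.raw ε).count (List.ofFn fun j => (s j : ℕ)) i = (G.facilitiesInRange s i).card := by
  rw [count, List.ofFn_eq_map, List.filter_map, List.length_map, facilitiesInRange]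
  have h : ((fun v => (G.raw ε).adj i v) ∘ fun j => (s j : ℕ)) =
      fun j => decide (s j ∈ G.shoppingRange i) := funext fun j => G.raw_adj ε i (s j)
  rw [h]
  simp [Finset.card, Finset.filter, Fin.univ_def]

theorem ofFn_perm (s : G.Profile) (m : Fin G.k) : (List.ofFn fun j => (s j : ℕ)).Perm
    ((s m : ℕ) :: (List.ofFn fun j => (s j : ℕ)).eraseIdx m) := by
  have h := List.getElem_cons_eraseIdx_perm (l := List.ofFn fun j => (s j : ℕ)) (n := m) (by simp)
  rw [List.getElem_ofFn] at h
  exact h.symm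

/-- For a client who reaches `m`, the facilities in range are those among the others plus `m`
itself, which gives the denominator `count + 1` of the gain. -/
theorem uniformLoad_eq (s : G.Profile) (m : Fin G.k) : G.uniformLoad s m =
    (G.searchGame hε).gainVal ((List.ofFn fun j => (s j : ℕ)).eraseIdx m) (s m) := by
  have hn : (G.searchGame hε).n = G.n := rfl
  rw [SearchGame.gainVal, hn, Finset.sum_range, uniformLoad]
  refine Finset.sum_congr rfl fun i _ => ?_
  have hE : (G.searchGame hε).E = G.raw ε := rfl
  rw [hE, raw_adj, searchGame_weight]
  simp only [decide_eq_true_eq]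
  split_ifs with h
  · have hc := G.count_ofFn (ε := ε) s i
    rw [count_perm _ (G.ofFn_perm s m), count_cons, raw_adj, if_pos (by simpa using h)] at hc
    rw [← hc]
    push_cast
    rfl
  · rfl

/-- Deleting the entry of `m` forgets its location, so the uniform loads before and after the move
are gains over the same list. -/
theorem uniformLoad_update_le_of_stable {s : G.Profile}
    (hs : ∀ q ∈ List.ofFn fun j => (s j : ℕ),
      (G.searchGame hε).Stable (List.ofFn fun j => (s j : ℕ)) q)
    (m : Fin G.k) (v : Fin G.n) : G.uniformLoad (Function.update s m v) m ≤
      (1 + 2 * (ε : ℝ) / 3) * G.uniformLoad s m := by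
  have h := hs (s m) (by simp) _ (G.ofFn_perm s m) v v.2
  rw [searchGame_eps] at h
  rw [G.uniformLoad_eq hε, G.uniformLoad_eq hε, Function.update_self]
  have e : (List.ofFn fun j => (Function.update s m v j : ℕ)).eraseIdx m =
      (List.ofFn fun j => (s j : ℕ)).eraseIdx m := by
    have : (List.ofFn fun j => (Function.update s m v j : ℕ)) =
        (List.ofFn fun j => (s j : ℕ)).set m v := by
      refine List.ext_getElem (by simp) fun i h₁ h₂ => ?_
      rw [List.getElem_ofFn, List.getElem_set, List.getElem_ofFn]
      by_cases hi : (⟨i, by simpa using h₁⟩ : Fin G.k) = m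
      · rw [hi, Function.update_self, if_pos (by rw [← hi])]
      · rw [Function.update_of_ne hi, if_neg (fun h => hi (Fin.ext h.symm))]
    rw [this, List.eraseIdx_set_eq]
  rw [e]
  exact h

theorem invariant_init (hn : 0 < G.n) : (G.searchGame hε).Invariant G.k
    (List.replicate G.k 0, ([], G.raw ε)) where
  game := rfl
  length := by simp
  lt v hv := by
    have h : v = 0 := by simp at hv; exact hv.2
    rw [h]; exact hn
  stable q hq := by simp at hq

theorem exists_profile {D : List ℕ} {E : RawGame}
    (h : (G.searchGame hε).Invariant G.k ([], (D, E))) :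
    ∃ s : G.Profile, D = (List.ofFn fun j => (s j : ℕ)) ∧
      ∀ σ, G.IsClientEquilibrium σ → G.IsApproxSPE (3 + 2 * (ε : ℝ)) s σ := by
  have hl : D.length = G.k := by simpa using h.length
  have hlt : ∀ v ∈ D, v < G.n := fun v hv => h.lt v (by simpa using hv)
  let s : G.Profile := fun j => ⟨D[(j : ℕ)]'(by omega), hlt _ (List.getElem_mem _)⟩
  have hs : D = List.ofFn fun j => (s j : ℕ) :=
    List.ext_getElem (by simp [hl]) fun i h₁ h₂ => by simp [s]
  refine ⟨s, hs, fun σ hσ => ?_⟩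
  have e : (3 + 2 * (ε : ℝ)) = 3 * (1 + 2 * (ε : ℝ) / 3) := by ring
  rw [e]
  refine hσ.isApproxSPE (by positivity) (G.uniformLoad_update_le_of_stable hε ?_)
  intro q hq
  rw [← hs] at hq ⊢
  have := h.stable q hq
  rwa [List.append_nil] at this

/-- The state holds `k` locations in all, each below `n`, besides the unchanged game data. This is
the size bound required by `PolyTime.exists_while`. -/
theorem treeSize_le_of_invariant {H : SearchGame} {k S : ℕ} {t : List ℕ × (List ℕ × RawGame)}
    (h : H.Invariant k t) (hk : k ≤ S) (hS : treeSize H.E ≤ S) :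
    treeSize t ≤ 2 * (S * (4 * S + 2) + 1) + S + 2 := by
  have hn : H.n ≤ S := by
    have h₁ := length_lt_treeSize H.E.1.2
    rw [treeSize_prod H.E, treeSize_prod H.E.1] at hS
    rw [H.vertices_eq, List.length_range] at h₁
    rw [H.vertices_eq] at hS
    omega
  have hv : ∀ v ∈ t.2.1 ++ t.1, treeSize v ≤ 4 * S + 1 := fun v hv => by
    have h₁ := h.lt v hv
    have h₂ := treeSize_nat_le_self v
    omega
  have h₁ := treeSize_list_le (l := t.1) fun v hv' => hv v (by simp [hv'])
  have h₂ := treeSize_list_le (l := t.2.1) fun v hv' => hv v (by simp [hv'])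
  have hl := h.length
  have h₃ : t.1.length * (4 * S + 1 + 1) ≤ S * (4 * S + 2) := Nat.mul_le_mul (by omega) le_rfl
  have h₄ : t.2.1.length * (4 * S + 1 + 1) ≤ S * (4 * S + 2) := Nat.mul_le_mul (by omega) le_rfl
  rw [treeSize_prod, treeSize_prod, h.game]
  omega

theorem treeSize_map_symbolBit_le (w : List Γ') : treeSize (w.map symbolBit) ≤ 6 * w.length + 1 := by
  have h := treeSize_list_le (l := w.map symbolBit) (B := 5) fun o _ => by
    rcases o with _ | _ | _ <;> decide
  rw [List.length_map] at h
  omega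

theorem step_eq_self (t : List ℕ × (List ℕ × RawGame)) (h : t.1 = []) : RawGame.step t = t := by
  unfold RawGame.step
  rw [h]; rfl

/-! ### Assembling the program -/

/-- The local search runs in polynomial time on the stack machine. -/
theorem exists_program : ∃ (P : StackProg) (p : Polynomial ℕ),
    ∀ (G : FacilityGame) (_hn : 0 < G.n) (ε : ℚ≥0) (hε : 0 < ε),
      ∃ (D : List ℕ) (E : RawGame), (G.searchGame hε).Invariant G.k ([], (D, E)) ∧
        P.RunLE ![[], G.inputCode ε, [], []]
          ![[], [], (RawGame.output ([], (D, E))).map bitSymbol, []]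
          (p.eval ((G.inputCode ε).length + ⌈1 / ε⌉₊)) := by
  obtain ⟨p₁, q₁, h₁⟩ := PolyTime.gameInit
  obtain ⟨p₂, q₂, h₂⟩ := PolyTime.exists_while PolyTime.gameStep step_eq_self
  obtain ⟨p₃, q₃, h₃⟩ := PolyTime.gameOutput
  obtain ⟨q₄, h₄⟩ := PolyTime.gameInit.size_le
  obtain ⟨q₅, h₅⟩ := PolyTime.gameOutput.size_le
  let X : Polynomial ℕ := Polynomial.X
  -- In terms of the input length plus `⌈1 / ε⌉`, the polynomials `S`, `M` and `N` bound the initial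
  -- state, every state of the search, and the number of rounds.
  let S : Polynomial ℕ := q₄.comp (6 * X + 1)
  let M : Polynomial ℕ := 2 * (S * (4 * S + 2) + 1) + S + 2
  let N : Polynomial ℕ := ((S + 1) ^ 2 * (3 * X + 2)) * (3 * S + S + 1) * (S + 1) + S
  refine ⟨.seq .readInput (.seq p₁ (.seq p₂ (.seq p₃ .writeOutput))),
    (14 * X + 3) + (q₁.comp (6 * X + 1) + ((N + 1) * q₂.comp M + (q₃.comp M +
      (12 * q₅.comp M + 3)))), fun G hn ε hε => ?_⟩
  set w := (G.inputCode ε).map symbolBit with hw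
  set L := (G.inputCode ε).length with hL
  set x := L + ⌈1 / ε⌉₊ with hx
  have hwS : treeSize w ≤ 6 * x + 1 := by
    have := treeSize_map_symbolBit_le (G.inputCode ε)
    rw [← hw] at this
    omega
  have hinit : RawGame.init w = (List.replicate G.k 0, ([], G.raw ε)) := G.init_inputCode ε
  have hsize : treeSize (RawGame.init w) ≤ S.eval x := by
    refine (h₄ w).trans ((q₄.eval_nat_mono hwS).trans (le_of_eq ?_))
    simp [S, X]
  have hkS : G.k ≤ S.eval x := by
    have := length_lt_treeSize (List.replicate G.k 0)
    rw [hinit, treeSize_prod] at hsize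
    simp only [List.length_replicate] at this hsize
    omega
  have hBS : treeSize (G.searchGame hε).E ≤ S.eval x := by
    rw [hinit, treeSize_prod, treeSize_prod] at hsize
    change treeSize (G.raw ε) ≤ _
    simp only at hsize
    omega
  -- The number of rounds depends on `1 / ε` itself and not only on its bit length, which is why `⌈1
  -- / ε⌉` enters the running time.
  have hN : 1 ≤ (⌈1 / ε⌉₊ : ℝ) * (G.searchGame hε).eps := by
    rw [searchGame_eps]
    have h : 1 / ε ≤ (⌈1 / ε⌉₊ : ℚ≥0) := Nat.le_ceil _
    rw [div_le_iff₀ hε] at h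
    exact_mod_cast h
  obtain ⟨K, hK, hnil, hinv⟩ :=
    (G.searchGame hε).exists_iterate_step_eq_nil hN (G.invariant_init hε hn)
  have hMsize : ∀ i ≤ K, treeSize (RawGame.step^[i] (RawGame.init w)) ≤ M.eval x := by
    intro i hi
    rw [hinit]
    refine (treeSize_le_of_invariant (hinv i hi) hkS hBS).trans (le_of_eq ?_)
    simp [M]
  have hKN : K ≤ N.eval x := by
    refine hK.trans ?_
    have e : N.eval x = ((S.eval x + 1) ^ 2 * (3 * x + 2)) * (3 * S.eval x + S.eval x + 1) *
        (S.eval x + 1) + S.eval x := by simp [N, X]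
    rw [e]
    have : ⌈1 / ε⌉₊ ≤ x := by omega
    gcongr
  have hfin := hinv K le_rfl
  rw [← hinit] at hnil hfin
  set t := RawGame.step^[K] (RawGame.init w) with ht
  obtain ⟨todo, D, E⟩ := t
  obtain rfl : todo = [] := hnil
  refine ⟨D, E, hfin, ?_⟩
  have hrun := h₂ K (M.eval x) (RawGame.init w) [] (by rw [← ht]) hMsize
  rw [← ht] at hrun
  have hT : treeSize (([], D, E) : List ℕ × (List ℕ × RawGame)) ≤ M.eval x := by
    rw [ht]; exact hMsize K le_rfl
  have r₁ := StackProg.runLE_readInput (G.inputCode ε)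
  have r₂ := h₁ w []
  have r₃ := h₃ ([], D, E) []
  have r₄ := StackProg.runLE_writeOutput (RawGame.output ([], D, E))
  simp only [List.append_nil] at r₂ r₃ hrun
  refine (r₁.seq (r₂.seq (hrun.seq (r₃.seq r₄)))).mono ?_
  have e : Polynomial.eval x ((14 * X + 3) + (q₁.comp (6 * X + 1) + ((N + 1) * q₂.comp M +
      (q₃.comp M + (12 * q₅.comp M + 3))))) = (14 * x + 3) + (q₁.eval (6 * x + 1) +
      ((N.eval x + 1) * q₂.eval (M.eval x) + (q₃.eval (M.eval x) +
        (12 * q₅.eval (M.eval x) + 3)))) := by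
    simp [X]
  rw [e]
  have b₁ : L ≤ x := by omega
  have b₂ := q₁.eval_nat_mono hwS
  have b₃ := q₃.eval_nat_mono hT
  have b₄ : (RawGame.output ([], D, E)).length ≤ q₅.eval (M.eval x) :=
    (length_lt_treeSize _).le.trans ((h₅ _).trans (q₅.eval_nat_mono hT))
  dsimp only at b₂ b₃
  gcongr

end FacilityGame

/-- There are a (multi-stack) Turing machine and a polynomial `p` such that, for every game `G` with
at least one vertex and every rational `ε > 0`, the machine, started on the code of `(G, ε)`, halts
after at most `p (L + ⌈1/ε⌉)` steps, where `L` is the length of the input word, and outputs the code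
of a placement profile `s` that forms, together with the client equilibrium `σ`, a
`(3 + 2ε)`-approximate subgame perfect equilibrium of the Min-2-FLG. -/
theorem mainTheorem6 :
    ∃ (M : Turing.TM2ComputableAux Computability.Γ' Computability.Γ') (p : Polynomial ℕ),
      ∀ (G : FacilityGame) (_hn : 0 < G.n) (ε : ℚ≥0) (_hε : 0 < ε),
        ∃ s : G.Profile,
          Nonempty (Turing.TM2OutputsInTime M.tm
            ((G.inputCode ε).map M.inputAlphabet.symm)
            (some ((G.profileCode s).map M.outputAlphabet.symm))
            (p.eval ((G.inputCode ε).length + ⌈1 / ε⌉₊))) ∧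
          (∃ σ : G.Profile → G.Distribution, G.IsApproxSPE (3 + 2 * (ε : ℝ)) s σ) ∧
          (∀ σ : G.Profile → G.Distribution, G.IsClientEquilibrium σ →
            G.IsApproxSPE (3 + 2 * (ε : ℝ)) s σ) := by
  obtain ⟨P, p, h⟩ := FacilityGame.exists_program
  refine ⟨P.machineAux, p + 1, fun G hn ε hε => ?_⟩
  obtain ⟨D, E, hinv, t, ht, hrun⟩ := h G hn ε hε
  obtain ⟨s, rfl, hs⟩ := G.exists_profile hε hinv
  rw [G.map_bitSymbol_output] at hrun
  obtain ⟨σ, hσ⟩ := FacilityGame.exists_isClientEquilibrium (G := G)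
  exact ⟨s, hrun.outputsInTime (by simpa using ht), ⟨σ, hs σ hσ⟩, hs⟩
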